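/- Let $\eta>0$ and $\alpha\in\mathbb R$. For $\omega\in\mathbb C$ and a meromorphic $f$ write $\int_{a}^{\omega}f$ ($a\in\mathbb R$) for the integral along the contour $[a,a+i\,\mathrm{Im}\,\omega]\cup[a+i\,\mathrm{Im}\,\omega,\omega]$, and put $$K(\mu)=\frac{\sinh 2\eta}{2\pi\sin(\mu+i\eta)\sin(\mu-i\eta)},\qquad p_0'(\mu)=\frac{\sinh\eta}{\sin(\mu+\frac{i\eta}2)\sin(\mu-\frac{i\eta}2)},\qquad \theta(\omega)=2i\pi\int_{-\pi/2}^{\omega}K,\qquad p_0(\omega)=\int_{-\pi/2}^{\omega}p_0'.$$ **Bethe roots.** Let $L=2N>0$, and let $\mu_1,\dots,\mu_N\in\mathbb C$ be pairwise distinct, with $\mathrm{Re}\,\mu_a\in[-\frac\pi2,\frac\pi2)$, and satisfy $$-e^{2i\pi\alpha}=\Big(\frac{\sin(\mu_a-\frac{i\eta}2)}{\sin(\mu_a+\frac{i\eta}2)}\Big)^{L}\prod_{b=1}^N\frac{\sin(\mu_a-\mu_b+i\eta)}{\sin(\mu_a-\mu_b-i\eta)}\qquad(a=1,\dots,N).$$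 The counting function is $\hat\xi_\mu(\omega)=\frac{p_0(\omega)}{2\pi}-\frac1{2i\pi L}\sum_{k=1}^N\theta(\omega-\mu_k)+\frac{1-2\alpha}{2L}$. Fix, independently of $L$, an integer $n\ge0$ and constants $\varkappa,\tau>0$, and assume: * exactly $n$ of the $\mu_a$ are non-real; call them $z_1,\dots,z_n$; they satisfy $\big||\mathrm{Im}\,z_a|-\eta\big|\ge\tau$; * on $[-\frac\pi2,\frac\pi2]$ the function $\hat\xi_\mu$ is real valued with $\hat\xi_\mu'>\varkappa$. Let $n_w$ be the number of $z_a$ with $|\mathrm{Im}\,z_a|>\eta$. Let $\iota\in\mathbb Z$, $x_\mu\in\mathbb R$ and $\nu_1,\dots,\nu_{N+n_w}\in\mathbb R$ be such that $\hat\xi_\mu(x_\mu-\frac\pi2)=\frac{1-2\iota}{2L}$, $\hat\xi_\mu(\nu_a)=\frac{a-\iota}L$ and $\nu_a\in[x_\mu-\frac\pi2,x_\mu+\frac\pi2]\cap[-\frac\pi2,\frac\pi2)$ for all $a$. The holes $\nu_{h_1},\dots,\nu_{h_{n_h}}$ are those $\nu_a$ that are not among the $\mu_j$. **Dressed functions.**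 Let $K[f](\omega)=\int_{-\pi/2}^{\pi/2}K(\omega-s)f(s)\,ds$. On $[-\frac\pi2,\frac\pi2]$ let $\phi(\cdot,z)$ and $p$ be the unique continuous solutions of $$(I+K)[\phi(\cdot,z)](x)=\theta(x-z),\qquad (I+K)[p](x)=\frac{p_0(x)}{2\pi}+\frac1{2i\pi}\Big\{p(-\tfrac\pi2)\,\theta(x+\tfrac\pi2)-p(\tfrac\pi2)\,\theta(x-\tfrac\pi2)\Big\},$$ and let $\tilde\varphi(x,z)=\phi(x,z)-\frac12\mathbf 1_{|\mathrm{Im}\,z|<\eta}\,\phi(x,\frac\pi2)$. These functions are continued analytically from $[-\frac\pi2,\frac\pi2]$ to $\omega\in\mathbb C$, first along $\mathbb R$ and then along $[a,a+i\,\mathrm{Im}\,\omega]\cup[a+i\,\mathrm{Im}\,\omega,\omega]$, where $a=-\frac\pi2$ for $p$ and $a=\mathrm{Re}\,z-\frac\pi2$ for $\tilde\varphi(\cdot,z)$ (the contours used for $p_0(\omega)$ and $\theta(\omega-z)$). Branch points are $\pi m+i(k+\frac12)\eta$ ($k,m\in\mathbb Z$) for $p$, and $z+\pi m+ik\eta$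 for $\tilde\varphi(\cdot,z)$, with $m\in\mathbb Z$ and $k\in\mathbb Z\setminus\{0\}$ if $|\mathrm{Im}\,z|<\eta$, $k\in\{0,-1\}$ if $\mathrm{Im}\,z>\eta$, $k\in\{0,1\}$ if $\mathrm{Im}\,z<-\eta$. Put $$\xi^{(\infty)}_\mu(\omega)=p(\omega)+\frac1{2i\pi L}\Big\{\sum_{a=1}^{n_h}\tilde\varphi(\omega,\nu_{h_a})-\sum_{a=1}^n\tilde\varphi(\omega,z_a)\Big\}+\frac{1-\alpha-\iota}{2L}.$$ **Proposition.** For every $\delta>0$ and $M\in\mathbb N$ there is a constant $C$, depending only on $\eta,\alpha,n,\varkappa,\tau,\delta,M$, such that for all $L$, all such solutions and all $\omega$ for which the contours defining the functions $\xi^{(\infty)}_\mu$ below avoid the branch points: * if $|\mathrm{Im}\,\omega|\le\eta-\delta$, then $\big|\hat\xi_\mu(\omega)-\xi^{(\infty)}_\mu(\omega)\big|\le C L^{-M}$; * if $\mathrm{Im}\,\omega\ge\eta+\delta$, then $\big|\hat\xi_\mu(\omega)-\big(\xi^{(\infty)}_\mu(\omega)+\xi^{(\infty)}_\mu(\omega-i\eta)-\frac{1-2\iota}{2L}\big)\big|\le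 C L^{-M}$; * if $\mathrm{Im}\,\omega\le-\eta-\delta$, then $\big|\hat\xi_\mu(\omega)-\big(\xi^{(\infty)}_\mu(\omega)+\xi^{(\infty)}_\mu(\omega+i\eta)-\frac{1-2\iota}{2L}\big)\big|\le C L^{-M}$. That is, the three asymptotic formulas hold up to $O(L^{-\infty})$, uniformly in $\omega$ at finite distance from the boundary of the respective domain. -/

import Mathlib

noncomputable section

namespace XXZ

open Set MeasureTheory

/-! ### Bare functions -/

/-- The kernel `K(μ) = sinh(2η) / (2π sin(μ+iη) sin(μ-iη))`. -/
def kernel (η : ℝ) (μ : ℂ) : ℂ :=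
  (Real.sinh (2 * η) : ℂ) /
    (2 * Real.pi * Complex.sin (μ + Complex.I * η) * Complex.sin (μ - Complex.I * η))

/-- The derivative of the bare momentum, `p₀'(μ) = sinh η / (sin(μ+iη/2) sin(μ-iη/2))`. -/
def bareMomentumDeriv (η : ℝ) (μ : ℂ) : ℂ :=
  (Real.sinh η : ℂ) /
    (Complex.sin (μ + Complex.I * (η / 2)) * Complex.sin (μ - Complex.I * (η / 2)))

/-- The integral of `f` from `-π/2` to `ω` along the oriented segments
`[-π/2, -π/2 + i Im ω] ∪ [-π/2 + i Im ω, ω]`. -/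
def contourIntegral (f : ℂ → ℂ) (ω : ℂ) : ℂ :=
  (∫ t in (0 : ℝ)..ω.im, f (-(Real.pi / 2 : ℝ) + t * Complex.I) * Complex.I) +
    ∫ t in (-(Real.pi / 2))..ω.re, f (t + ω.im * Complex.I)

/-- The bare phase `θ`. -/
def barePhase (η : ℝ) (ω : ℂ) : ℂ :=
  2 * Complex.I * Real.pi * contourIntegral (kernel η) ω

/-- The bare momentum `p₀`. -/
def bareMomentum (η : ℝ) (ω : ℂ) : ℂ :=
  contourIntegral (bareMomentumDeriv η) ω

/-! ### Bethe equations and the counting function -/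

/-- The pairwise distinct numbers `μ₁, …, μ_N`, normalised by `Re μ_a ∈ [-π/2, π/2)`, solve the
`α`-twisted Bethe equations of the chain of even length `L = 2N > 0`
(sector of zero total longitudinal spin). -/
structure IsBetheSolution (η α : ℝ) (L N : ℕ) (μ : Fin N → ℂ) : Prop where
  length_pos : 0 < L
  length_eq : L = 2 * N
  injective : Function.Injective μ
  re_mem : ∀ a, (μ a).re ∈ Ico (-(Real.pi / 2)) (Real.pi / 2)
  bethe : ∀ a, -Complex.exp (2 * Complex.I * Real.pi * α) =
    (Complex.sin (μ a - Complex.I * (η / 2)) / Complex.sin (μ a + Complex.I * (η / 2))) ^ L *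
      ∏ b, Complex.sin (μ a - μ b + Complex.I * η) / Complex.sin (μ a - μ b - Complex.I * η)

/-- The counting function `ξ̂_μ`. -/
def countingFunction (η α : ℝ) (L N : ℕ) (μ : Fin N → ℂ) (ω : ℂ) : ℂ :=
  bareMomentum η ω / (2 * Real.pi) -
    1 / (2 * Complex.I * Real.pi * L) * ∑ k, barePhase η (ω - μ k) +
    (1 - 2 * α) / (2 * L)

open Classical in
/-- The indices of the complex (non-real) roots. -/
def complexRoots {N : ℕ} (μ : Fin N → ℂ) : Finset (Fin N) :=
  Finset.univ.filter fun a => (μ a).im ≠ 0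

open Classical in
/-- The number `n_w` of wide roots, i.e. of roots with `|Im μ_a| > η`. -/
def wideCount (η : ℝ) {N : ℕ} (μ : Fin N → ℂ) : ℕ :=
  (Finset.univ.filter fun a => η < |(μ a).im|).card

/-- The counting function is real valued on `[-π/2, π/2]`, and its derivative there
is bounded below by `ϰ`. -/
def IsUniformlyIncreasing (ϰ η α : ℝ) (L N : ℕ) (μ : Fin N → ℂ) : Prop :=
  ∀ x ∈ Icc (-(Real.pi / 2)) (Real.pi / 2),
    (countingFunction η α L N μ (x : ℝ)).im = 0 ∧
    ϰ < (deriv (countingFunction η α L N μ) ((x : ℝ) : ℂ)).re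

/-- The integer `ι`, the point `x` and the real points `ν₁, …, ν_{N+n_w}` attached to a solution:
`ξ̂(x - π/2) = (1-2ι)/(2L)`, `ξ̂(ν_a) = (a-ι)/L`, and all the `ν_a` lie in
`[x - π/2, x + π/2] ∩ [-π/2, π/2)` (which fixes `ι`). The values `ν a` for `a = 0` or
`a > N + n_w` play no role. -/
structure IsRealParametrisation (η α : ℝ) (L N : ℕ) (μ : Fin N → ℂ)
    (ι : ℤ) (x : ℝ) (ν : ℕ → ℝ) : Prop where
  start : countingFunction η α L N μ ((x - Real.pi / 2 : ℝ) : ℂ) = (1 - 2 * ι) / (2 * L)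
  value : ∀ a ∈ Finset.Icc 1 (N + wideCount η μ),
    countingFunction η α L N μ ((ν a : ℝ) : ℂ) = (a - ι) / L
  mem : ∀ a ∈ Finset.Icc 1 (N + wideCount η μ),
    ν a ∈ Icc (x - Real.pi / 2) (x + Real.pi / 2) ∩ Ico (-(Real.pi / 2)) (Real.pi / 2)

open Classical in
/-- The hole indices `h₁ < … < h_{n_h}`: those `a ∈ {1, …, N + n_w}` for which `ν_a` is not one
of the Bethe roots. -/
def holes (η : ℝ) {N : ℕ} (μ : Fin N → ℂ) (ν : ℕ → ℝ) : Finset ℕ :=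
  (Finset.Icc 1 (N + wideCount η μ)).filter fun a => ∀ j, μ j ≠ (ν a : ℂ)

/-! ### Linear integral equations on `[-π/2, π/2]` -/

/-- The integral operator `K[f](ω) = ∫_{-π/2}^{π/2} K(ω-s) f(s) ds`. -/
def kernelOp (η : ℝ) (f : ℝ → ℂ) (ω : ℂ) : ℂ :=
  ∫ s in (-(Real.pi / 2))..(Real.pi / 2), kernel η (ω - s) * f s

/-- `f` is a continuous solution of `(I + K)[f](x) = θ(x - z)` on `[-π/2, π/2]`. -/
def SolvesPhaseEquation (η : ℝ) (z : ℂ) (f : ℝ → ℂ) : Prop :=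
  ContinuousOn f (Icc (-(Real.pi / 2)) (Real.pi / 2)) ∧
  ∀ x ∈ Icc (-(Real.pi / 2)) (Real.pi / 2),
    f x + kernelOp η f (x : ℝ) = barePhase η (x - z)

/-- `f` is a continuous solution on `[-π/2, π/2]` of
`(I + K)[f](x) = p₀(x)/(2π) + (f(-π/2) θ(x+π/2) - f(π/2) θ(x-π/2))/(2iπ)`. -/
def SolvesMomentumEquation (η : ℝ) (f : ℝ → ℂ) : Prop :=
  ContinuousOn f (Icc (-(Real.pi / 2)) (Real.pi / 2)) ∧
  ∀ x ∈ Icc (-(Real.pi / 2)) (Real.pi / 2),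
    f x + kernelOp η f (x : ℝ) = bareMomentum η (x : ℝ) / (2 * Real.pi) +
      1 / (2 * Complex.I * Real.pi) *
        (f (-(Real.pi / 2)) * barePhase η ((x + Real.pi / 2 : ℝ) : ℂ) -
          f (Real.pi / 2) * barePhase η ((x - Real.pi / 2 : ℝ) : ℂ))

/-- The dressed phase `x ↦ φ(x, z)` on `[-π/2, π/2]`. -/
def dressedPhase (η : ℝ) (z : ℂ) : ℝ → ℂ :=
  Classical.epsilon (SolvesPhaseEquation η z)

/-- The dressed momentum `p` on `[-π/2, π/2]`. -/
def dressedMomentum (η : ℝ) : ℝ → ℂ :=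
  Classical.epsilon (SolvesMomentumEquation η)

open Classical in
/-- The homogenised dressed phase `φ̃(x, z) = φ(x, z) - (1/2) 1_{|Im z| < η} φ(x, π/2)`
on `[-π/2, π/2]`. -/
def homDressedPhase (η : ℝ) (z : ℂ) (x : ℝ) : ℂ :=
  dressedPhase η z x -
    1 / 2 * (if |z.im| < η then 1 else 0) * dressedPhase η ((Real.pi / 2 : ℝ) : ℂ) x

/-! ### Analytic continuation -/

/-- The contour `[a, a + i Im ω] ∪ [a + i Im ω, ω]` starting at the real point `a`. -/
def contour (a : ℝ) (ω : ℂ) : Set ℂ :=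
  segment ℝ (a : ℂ) (a + ω.im * Complex.I) ∪ segment ℝ (a + ω.im * Complex.I) ω

/-- `v` is the value at `ω` of the analytic continuation of `f`, starting from `[-π/2, π/2]`:
first along the real axis, then along `contour a ω`. (The real axis together with the contour is
connected, so there is at most one such `v`.) -/
def IsContinuationValue (f : ℝ → ℂ) (a : ℝ) (ω v : ℂ) : Prop :=
  ∃ (U : Set ℂ) (g : ℂ → ℂ), IsOpen U ∧ (∀ x : ℝ, (x : ℂ) ∈ U) ∧ contour a ω ⊆ U ∧
    DifferentiableOn ℂ g U ∧ (∀ x ∈ Icc (-(Real.pi / 2)) (Real.pi / 2), g (x : ℝ) = f x) ∧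
    g ω = v

/-- The analytic continuation of `f` to `ω` along `contour a ω`. -/
def continuation (f : ℝ → ℂ) (a : ℝ) (ω : ℂ) : ℂ :=
  Classical.epsilon (IsContinuationValue f a ω)

/-- The dressed momentum `p(ω)`, continued along the contour used for `p₀(ω)`. -/
def momentum (η : ℝ) (ω : ℂ) : ℂ :=
  continuation (dressedMomentum η) (-(Real.pi / 2)) ω

/-- The homogenised dressed phase `φ̃(ω, z)`, continued along the contour on which `ω - z`
follows the vertical line and the horizontal line used for `θ(ω - z)`. -/
def phase (η : ℝ) (ω z : ℂ) : ℂ :=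
  continuation (homDressedPhase η z) (z.re - Real.pi / 2) ω

/-- The branch points `πm + i(k + 1/2)η` of `p`. -/
def momentumBranchPoints (η : ℝ) : Set ℂ :=
  {s | ∃ k m : ℤ, s = Real.pi * m + (k + 1 / 2) * η * Complex.I}

/-- The branch points of `φ̃(·, z)`: `z + πm + ikη` with `k ≠ 0` if `|Im z| < η`, with
`k ∈ {0, -1}` if `Im z > η`, and with `k ∈ {0, 1}` if `Im z < -η`. -/
def phaseBranchPoints (η : ℝ) (z : ℂ) : Set ℂ :=
  {s | ∃ k m : ℤ, ((|z.im| < η ∧ k ≠ 0) ∨ (η < z.im ∧ (k = 0 ∨ k = -1)) ∨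
      (z.im < -η ∧ (k = 0 ∨ k = 1))) ∧ s = z + Real.pi * m + k * η * Complex.I}

/-- The contours that define `ξ^{(∞)}_μ(ω)` avoid the branch points. -/
structure IsRegularPoint (η : ℝ) {N : ℕ} (μ : Fin N → ℂ) (ν : ℕ → ℝ) (ω : ℂ) : Prop where
  momentum : Disjoint (contour (-(Real.pi / 2)) ω) (momentumBranchPoints η)
  roots : ∀ a ∈ complexRoots μ,
    Disjoint (contour ((μ a).re - Real.pi / 2) ω) (phaseBranchPoints η (μ a))
  holes : ∀ a ∈ holes η μ ν,
    Disjoint (contour (ν a - Real.pi / 2) ω) (phaseBranchPoints η (ν a : ℂ))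

/-- The asymptotic counting function `ξ^{(∞)}_μ`. -/
def asymptoticCountingFunction (η α : ℝ) (L : ℕ) {N : ℕ} (μ : Fin N → ℂ) (ι : ℤ) (ν : ℕ → ℝ)
    (ω : ℂ) : ℂ :=
  momentum η ω +
    1 / (2 * Complex.I * Real.pi * L) *
      (∑ a ∈ holes η μ ν, phase η ω (ν a : ℂ) - ∑ a ∈ complexRoots μ, phase η ω (μ a)) +
    (1 - α - ι) / (2 * L)

end XXZ

end

noncomputable section
namespace XXZ
open Set MeasureTheory Filter Topology
open Complex (I)
open scoped Interval

/-! ### Sines, cotangents and the elementary kernels -/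

/-! Write `ξ̂` for the counting function and `ρ = ξ̂'` for `density`. By the Bethe equations `L ξ̂`
is an integer at every real root, and on one period the points where it takes the relevant integer
values are exactly `ν_1, …, ν_{N+n_w}`. A sum over all roots is therefore a sum over this grid,
minus the holes, plus the complex roots (`sum_node`). On the grid, `L ξ̂` is a uniform coordinate
whose density `ρ` is `π`-periodic, holomorphic and bounded away from zero in a strip of width
independent of `L`. For a test function whose derivative is periodic and bounded holomorphic in a
strip, Euler–Maclaurin has no boundary terms beyond the trapezoidal one, so that `(1/L) ∑ f(ν_a)`
equals `∫ f ρ`, up to an end correction, with error `O(L^{-M})` for every `M`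
(`exists_trapezoidal_bound`, `exists_sum_sub_integral_bound`). This is the only approximation in the
whole argument; everything else is an identity or the stability of a linear equation.

In the strip `|Im ω| < η` the test function is `θ(ω - s)`. After an integration by parts the rule
says that `ξ̂ + K ξ̂` equals, up to `O(L^{-M})`, the source to which `I + K` maps `ξ^{(∞)}`
(`sourceDefect_eq`). Since `K` is a stochastic kernel with positive minimum, `I + K` is stable
(`norm_le_of_norm_add_kernelOp_le`). This compares `ξ̂` with `ξ^{(∞)}` on the real interval, and the
integral equation itself carries the comparison into the strip (`exists_bound_of_abs_le`).

For `|Im ω| > η` the test function is `p₀(v - s)` with `v = ω ∓ iη/2`, which is periodic and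
holomorphic on one side of the axis. Its integral against `ρ` is computed exactly by residues
(`integral_bareMomentum_mul_density`). Combined with `θ(u + iη/2) = i (p₀(u + iη) + p₀(u))` and the
functional equations relating `p` and `φ̃` at `v ± iη/2`, this turns the difference to be estimated
into precisely an error of the trapezoidal rule (`countingFunction_sub_asymptotic`).

The functional equations rest on explicit formulas. On functions holomorphic below the axis `K` acts
as the shift by `-iη`, so `I + K` is inverted by an alternating sum of shifted cotangents
(`altCot`). This gives `p` and, for non-wide `z`, `φ̃`; for wide `z` the dressed phase is a shifted
bare momentum. All branches are controlled by keeping the horizontal legs of the contours free of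
poles (`slit`), and the continuations are identified by the identity theorem. -/

lemma abs_im_le_norm_sin (w : ℂ) : |w.im| ≤ ‖Complex.sin w‖ := by
  have h1 : |w.im| ≤ |Real.sinh w.im| := by
    rw [Real.abs_sinh]
    exact Real.self_le_sinh_iff.2 (abs_nonneg _)
  refine h1.trans (abs_le_of_sq_le_sq ?_ (norm_nonneg _))
  rw [← Complex.normSq_eq_norm_sq, Complex.normSq_apply]
  have hw : Complex.sin w = (Real.sin w.re * Real.cosh w.im : ℝ) +
      (Real.cos w.re * Real.sinh w.im : ℝ) * I := by
    conv_lhs => rw [← Complex.re_add_im w, Complex.sin_add_mul_I]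
    push_cast
    ring
  rw [hw]
  simp only [Complex.add_re, Complex.add_im, Complex.ofReal_re, Complex.ofReal_im, Complex.re_ofReal_mul,
    Complex.im_ofReal_mul, Complex.I_re, Complex.I_im]
  have e1 := Real.sin_sq_add_cos_sq w.re
  have e2 := Real.cosh_sq w.im
  have : (Real.sin w.re * Real.cosh w.im + Real.cos w.re * Real.sinh w.im * 0) *
      (Real.sin w.re * Real.cosh w.im + Real.cos w.re * Real.sinh w.im * 0) +
      (0 + Real.cos w.re * Real.sinh w.im * 1) * (0 + Real.cos w.re * Real.sinh w.im * 1) =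
      Real.sinh w.im ^ 2 + Real.sin w.re ^ 2 := by
    have : Real.sin w.re ^ 2 * Real.cosh w.im ^ 2 + Real.cos w.re ^ 2 * Real.sinh w.im ^ 2 =
      Real.sinh w.im ^ 2 + Real.sin w.re ^ 2 := by
      rw [e2, show Real.cos w.re ^ 2 = 1 - Real.sin w.re ^ 2 by linarith]; ring
    linarith
  rw [this]
  nlinarith [sq_nonneg (Real.sin w.re)]

lemma sin_ne_zero_of_im_ne_zero {w : ℂ} (h : w.im ≠ 0) : Complex.sin w ≠ 0 := by
  intro h0
  have := abs_im_le_norm_sin w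
  rw [h0, norm_zero] at this
  exact h (abs_nonpos_iff.1 this)

/-- The vertical legs of the contours lie on this line after translation, so they never meet a pole.
Only the horizontal legs need a hypothesis. -/
lemma sin_ne_zero_of_re_eq {w : ℂ} (h : w.re = -(Real.pi / 2)) : Complex.sin w ≠ 0 := by
  intro h0
  obtain ⟨k, hk⟩ := Complex.sin_eq_zero_iff.1 h0
  have h1 : w.re = k * Real.pi := by
    rw [hk]; simp
  rw [h] at h1
  have h2 : (-(1 / 2) : ℝ) = k := by
    have := Real.pi_pos
    field_simp at h1
    linarith
  have h3 : (2 * k + 1 : ℝ) = 0 := by linarith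
  have h4 : (2 * k + 1 : ℤ) = 0 := by exact_mod_cast h3
  omega

lemma sin_add_pi_eq_zero_iff (w : ℂ) : Complex.sin (w + Real.pi) = 0 ↔ Complex.sin w = 0 := by
  rw [Complex.sin_add_pi, neg_eq_zero]

lemma cot_add_pi (w : ℂ) : Complex.cot (w + Real.pi) = Complex.cot w := by
  rw [Complex.cot_eq_cos_div_sin, Complex.cot_eq_cos_div_sin, Complex.sin_add_pi,
    Complex.cos_add_pi, neg_div_neg_eq]

lemma cot_neg (w : ℂ) : Complex.cot (-w) = -Complex.cot w := by
  rw [Complex.cot_eq_cos_div_sin, Complex.cot_eq_cos_div_sin, Complex.sin_neg, Complex.cos_neg,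
    div_neg]

lemma differentiableAt_cot {w : ℂ} (h : Complex.sin w ≠ 0) :
    DifferentiableAt ℂ Complex.cot w := by
  have : Complex.cot = fun w => Complex.cos w / Complex.sin w := by
    funext w; exact Complex.cot_eq_cos_div_sin w
  rw [this]
  exact Complex.differentiableAt_cos.div Complex.differentiableAt_sin h

lemma cot_sub_I {w : ℂ} (h : Complex.sin w ≠ 0) :
    Complex.cot w - I = 2 * I / (Complex.exp (2 * I * w) - 1) := by
  have e : Complex.exp (2 * I * w) = Complex.exp (w * I) * Complex.exp (w * I) := by
    rw [← Complex.exp_add]; ring_nf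
  have hs : Complex.sin w = (Complex.exp (-(w * I)) - Complex.exp (w * I)) * I / 2 := by
    rw [Complex.sin]; ring_nf
  have hc : Complex.cos w = (Complex.exp (w * I) + Complex.exp (-(w * I))) / 2 := by
    rw [Complex.cos]; ring_nf
  have hm : Complex.exp (-(w * I)) * Complex.exp (w * I) = 1 := by
    rw [← Complex.exp_add]; simp
  have h1 : Complex.exp (2 * I * w) - 1 ≠ 0 := by
    intro h0
    apply h
    rw [hs]
    have : Complex.exp (w * I) * (Complex.exp (-(w * I)) - Complex.exp (w * I)) = 0 := by
      rw [e] at h0; linear_combination hm - h0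
    rcases mul_eq_zero.1 this with h2 | h2
    · exact absurd h2 (Complex.exp_ne_zero _)
    · rw [h2]; simp
  rw [Complex.cot_eq_cos_div_sin]
  have : Complex.cos w - I * Complex.sin w = Complex.exp (-(w * I)) := by
    rw [hs, hc]; linear_combination (-(Complex.exp (-(w * I)) - Complex.exp (w * I)) / 2) * Complex.I_mul_I
  rw [eq_div_iff h1, sub_mul, div_mul_eq_mul_div, sub_eq_iff_eq_add, div_eq_iff h]
  have key : (Complex.cos w - I * Complex.sin w) * (Complex.exp (2 * I * w) - 1) =
      2 * I * Complex.sin w := by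
    rw [this, e, hs]
    linear_combination (Complex.exp (w * I)) * hm - (Complex.exp (-(w * I)) - Complex.exp (w * I)) * Complex.I_mul_I
  linear_combination key

/-- Towards `-i∞` the cotangent approaches `i` exponentially fast. The convergence of `altCot` and
all limits at `-i∞` come from here. -/
lemma norm_cot_sub_I_le {w : ℂ} (h : w.im < 0) :
    ‖Complex.cot w - I‖ ≤ 2 / (Real.exp (-2 * w.im) - 1) := by
  rw [cot_sub_I (sin_ne_zero_of_im_ne_zero h.ne), norm_div]
  have h1 : ‖(2 * I : ℂ)‖ = 2 := by simp
  have h2 : Real.exp (-2 * w.im) - 1 ≤ ‖Complex.exp (2 * I * w) - 1‖ := by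
    have := norm_sub_norm_le (Complex.exp (2 * I * w)) 1
    rw [Complex.norm_exp, norm_one] at this
    have e : (2 * I * w).re = -2 * w.im := by simp
    rwa [e] at this
  have h3 : 0 < Real.exp (-2 * w.im) - 1 := by
    have : (1 : ℝ) < Real.exp (-2 * w.im) := by
      rw [Real.one_lt_exp_iff]; linarith
    linarith
  rw [h1]
  exact div_le_div_of_nonneg_left (by norm_num) h3 h2

/-- The difference of cotangents `-i (cot (w - ic) - cot (w + ic))`, which is
`sinh (2c) / (sin (w + ic) sin (w - ic))`. -/
def cotDiff (c : ℝ) (w : ℂ) : ℂ :=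
  -I * (Complex.cot (w - I * c) - Complex.cot (w + I * c))

lemma sinh_div_sin_mul_sin (c : ℝ) {w : ℂ} (h1 : Complex.sin (w + I * c) ≠ 0)
    (h2 : Complex.sin (w - I * c) ≠ 0) :
    (Real.sinh (2 * c) : ℂ) / (Complex.sin (w + I * c) * Complex.sin (w - I * c)) =
      cotDiff c w := by
  rw [cotDiff, Complex.cot_eq_cos_div_sin, Complex.cot_eq_cos_div_sin, div_sub_div _ _ h2 h1,
    mul_div_assoc', div_eq_div_iff (mul_ne_zero h1 h2) (mul_ne_zero h2 h1)]
  have e : Complex.cos (w - I * c) * Complex.sin (w + I * c) -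
      Complex.sin (w - I * c) * Complex.cos (w + I * c) = I * Real.sinh (2 * c) := by
    have : Complex.sin ((w + I * c) - (w - I * c)) = I * Real.sinh (2 * c) := by
      rw [show (w + I * c) - (w - I * c) = (2 * c : ℂ) * I by ring, Complex.sin_mul_I]
      push_cast; ring
    rw [← this]; linear_combination -Complex.sin_sub (w + I * c) (w - I * c)
  rw [e]
  linear_combination (Complex.sin (w + I * c) * Complex.sin (w - I * c) * Real.sinh (2 * c)) * Complex.I_mul_I

lemma kernel_eq_cotDiff {η : ℝ} {w : ℂ} (h1 : Complex.sin (w + I * η) ≠ 0)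
    (h2 : Complex.sin (w - I * η) ≠ 0) :
    kernel η w = cotDiff η w / (2 * Real.pi) := by
  rw [kernel, ← sinh_div_sin_mul_sin η h1 h2, div_div]
  congr 1; ring

lemma bareMomentumDeriv_eq_cotDiff {η : ℝ} {w : ℂ} (h1 : Complex.sin (w + I * (η / 2)) ≠ 0)
    (h2 : Complex.sin (w - I * (η / 2)) ≠ 0) :
    bareMomentumDeriv η w = cotDiff (η / 2) w := by
  rw [bareMomentumDeriv, ← sinh_div_sin_mul_sin (η / 2)]
  · push_cast; rw [show 2 * (η / 2 : ℂ) = η by ring]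
  · push_cast; exact h1
  · push_cast; exact h2

lemma kernel_add_pi (η : ℝ) (w : ℂ) : kernel η (w + Real.pi) = kernel η w := by
  simp only [kernel]
  rw [show w + Real.pi + I * η = w + I * η + Real.pi by ring,
    show w + Real.pi - I * η = w - I * η + Real.pi by ring, Complex.sin_add_pi, Complex.sin_add_pi]
  congr 1; ring

lemma bareMomentumDeriv_add_pi (η : ℝ) (w : ℂ) :
    bareMomentumDeriv η (w + Real.pi) = bareMomentumDeriv η w := by
  simp only [bareMomentumDeriv]
  rw [show w + Real.pi + I * (η / 2) = w + I * (η / 2) + Real.pi by ring,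
    show w + Real.pi - I * (η / 2) = w - I * (η / 2) + Real.pi by ring, Complex.sin_add_pi,
    Complex.sin_add_pi, neg_mul_neg]

lemma kernel_neg (η : ℝ) (w : ℂ) : kernel η (-w) = kernel η w := by
  simp only [kernel]
  rw [show -w + I * η = -(w - I * η) by ring, show -w - I * η = -(w + I * η) by ring,
    Complex.sin_neg, Complex.sin_neg]
  congr 1; ring

lemma bareMomentumDeriv_neg (η : ℝ) (w : ℂ) :
    bareMomentumDeriv η (-w) = bareMomentumDeriv η w := by
  simp only [bareMomentumDeriv]
  rw [show -w + I * (η / 2) = -(w - I * (η / 2)) by ring,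
    show -w - I * (η / 2) = -(w + I * (η / 2)) by ring,
    Complex.sin_neg, Complex.sin_neg]
  congr 1; ring

lemma bareMomentumDeriv_conj (η : ℝ) (w : ℂ) :
    bareMomentumDeriv η (starRingEnd ℂ w) = starRingEnd ℂ (bareMomentumDeriv η w) := by
  simp only [bareMomentumDeriv, map_div₀, map_mul, Complex.conj_ofReal, ← Complex.sin_conj, map_add,
    map_sub, Complex.conj_I, Complex.conj_ofNat]
  congr 1
  ring_nf

lemma differentiableAt_kernel {η : ℝ} {w : ℂ} (h1 : Complex.sin (w + I * η) ≠ 0)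
    (h2 : Complex.sin (w - I * η) ≠ 0) : DifferentiableAt ℂ (kernel η) w := by
  unfold kernel
  refine DifferentiableAt.div (by fun_prop) (by fun_prop) ?_
  exact mul_ne_zero (mul_ne_zero (by simp [Real.pi_ne_zero]) h1) h2

lemma differentiableAt_bareMomentumDeriv {η : ℝ} {w : ℂ}
    (h1 : Complex.sin (w + I * (η / 2)) ≠ 0) (h2 : Complex.sin (w - I * (η / 2)) ≠ 0) :
    DifferentiableAt ℂ (bareMomentumDeriv η) w := by
  unfold bareMomentumDeriv
  exact DifferentiableAt.div (by fun_prop) (by fun_prop) (mul_ne_zero h1 h2)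

/-- The kernel is bounded away from its poles. -/
lemma norm_kernel_le (η : ℝ) {d : ℝ} (hd : 0 < d) {w : ℂ} (h : d ≤ |(|w.im| - |η|)|) :
    ‖kernel η w‖ ≤ |Real.sinh (2 * η)| / (2 * Real.pi * d * d) := by
  -- `‖sin u‖ ≥ |Im u|`, so the bound depends on the height of `w` only and is uniform in its real
  -- part.
  have h1 : d ≤ ‖Complex.sin (w + I * η)‖ := by
    refine le_trans ?_ (abs_im_le_norm_sin _)
    have e : (w + I * η).im = w.im - -η := by simp
    rw [e, ← abs_neg η] at *
    exact h.trans (abs_abs_sub_abs_le_abs_sub _ _)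
  have h2 : d ≤ ‖Complex.sin (w - I * η)‖ := by
    refine le_trans ?_ (abs_im_le_norm_sin _)
    have e : (w - I * η).im = w.im - η := by simp
    rw [e]
    exact h.trans (abs_abs_sub_abs_le_abs_sub _ _)
  have hp := Real.pi_pos
  rw [kernel, norm_div, norm_mul, norm_mul, norm_mul, Complex.norm_real, Complex.norm_real,
    Complex.norm_ofNat, Real.norm_eq_abs, Real.norm_eq_abs, abs_of_pos hp]
  gcongr

lemma norm_bareMomentumDeriv_le (η : ℝ) {d : ℝ} (hd : 0 < d) {w : ℂ}
    (h : d ≤ |(|w.im| - |η / 2|)|) :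
    ‖bareMomentumDeriv η w‖ ≤ |Real.sinh η| / (d * d) := by
  have h1 : d ≤ ‖Complex.sin (w + I * (η / 2))‖ := by
    refine le_trans ?_ (abs_im_le_norm_sin _)
    have e : (w + I * (η / 2)).im = w.im - -(η / 2) := by
      simp
    rw [e]; rw [← abs_neg (η / 2)] at h
    exact h.trans (abs_abs_sub_abs_le_abs_sub _ _)
  have h2 : d ≤ ‖Complex.sin (w - I * (η / 2))‖ := by
    refine le_trans ?_ (abs_im_le_norm_sin _)
    have e : (w - I * (η / 2)).im = w.im - η / 2 := by
      simp
    rw [e]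
    exact h.trans (abs_abs_sub_abs_le_abs_sub _ _)
  rw [bareMomentumDeriv, norm_div, norm_mul, Complex.norm_real, Real.norm_eq_abs]
  gcongr

/-! ### The contour integral as a primitive -/

/-- The points `w` for which the horizontal segment from `-π/2 + i Im w` to `w` lies in `A`. -/
def slit (A : Set ℂ) : Set ℂ :=
  {w | ∀ t ∈ [[-(Real.pi / 2), w.re]], (t + w.im * I : ℂ) ∈ A}

lemma mem_of_mem_slit {A : Set ℂ} {w : ℂ} (h : w ∈ slit A) : w ∈ A := by
  have := h w.re right_mem_uIcc
  rwa [Complex.re_add_im] at this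

/-- Parametrised over the fixed compact interval `[0, 1]`, the segment depends continuously on `w`,
and compactness makes the condition stable under small changes of `w`. -/
lemma isOpen_slit {A : Set ℂ} (hA : IsOpen A) : IsOpen (slit A) := by
  have e : slit A = {w | ∀ s ∈ Icc (0 : ℝ) 1,
      ((-(Real.pi / 2) + s * (w.re - -(Real.pi / 2)) : ℝ) + w.im * I : ℂ) ∈ A} := by
    ext w
    simp only [slit, mem_ofPred_eq, ← segment_eq_uIcc, segment_eq_image', forall_mem_image,
      smul_eq_mul]
  rw [e, isOpen_iff_mem_nhds]
  intro w hw
  refine isCompact_Icc.eventually_forall_of_forall_eventually fun s hs => ?_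
  have hc : Continuous fun p : ℂ × ℝ =>
      ((-(Real.pi / 2) + p.2 * (p.1.re - -(Real.pi / 2)) : ℝ) + p.1.im * I : ℂ) := by
    fun_prop
  exact hc.continuousAt.preimage_mem_nhds (hA.mem_nhds (hw s hs))

lemma slit_mono {A B : Set ℂ} (h : A ⊆ B) : slit A ⊆ slit B := fun _ hw t ht => h (hw t ht)

lemma intervalIntegrable_vertical {f : ℂ → ℂ} {A : Set ℂ} (hf : DifferentiableOn ℂ f A) {x : ℝ}
    {a b : ℝ} (hv : ∀ y ∈ [[a, b]], (x + y * I : ℂ) ∈ A) :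
    IntervalIntegrable (fun t : ℝ => f (x + t * I)) volume a b := by
  apply ContinuousOn.intervalIntegrable
  exact hf.continuousOn.comp (by fun_prop) hv

lemma intervalIntegrable_horizontal {f : ℂ → ℂ} {A : Set ℂ} (hf : DifferentiableOn ℂ f A) {y : ℝ}
    {a b : ℝ} (hv : ∀ x ∈ [[a, b]], (x + y * I : ℂ) ∈ A) :
    IntervalIntegrable (fun t : ℝ => f (t + y * I)) volume a b := by
  apply ContinuousOn.intervalIntegrable
  exact hf.continuousOn.comp (by fun_prop) hv

/-- `A` is not assumed simply connected. A local primitive `g` exists on a small ball inside the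
slit region, and the rectangle swept by the horizontal legs between the heights `Im w₀` and `Im w`
stays in `A`. Cauchy's theorem on this rectangle reduces the difference of the two contour integrals
to `g w - g w₀`. -/
theorem hasDerivAt_contourIntegral {f : ℂ → ℂ} {A : Set ℂ} (hA : IsOpen A)
    (hf : DifferentiableOn ℂ f A) (hv : ∀ y : ℝ, (-(Real.pi / 2 : ℝ) + y * I : ℂ) ∈ A)
    {w₀ : ℂ} (hw₀ : w₀ ∈ slit A) : HasDerivAt (contourIntegral f) (f w₀) w₀ := by
  obtain ⟨r, hr, hb⟩ := Metric.isOpen_iff.1 (isOpen_slit hA) w₀ hw₀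
  have hbA : Metric.ball w₀ r ⊆ A := fun w hw => mem_of_mem_slit (hb hw)
  obtain ⟨g, hg⟩ := (hf.mono hbA).isExactOn_ball
  have hv' : ∀ y : ℝ, (((-(Real.pi / 2) : ℝ) : ℂ) + y * I) ∈ A := by
    intro y; have := hv y; push_cast at this ⊢; exact this
  have hvert : ∀ a b : ℝ, IntervalIntegrable (fun t : ℝ => f (-(Real.pi / 2 : ℝ) + t * I) * I)
      volume a b := by
    intro a b
    have := (intervalIntegrable_vertical (a := a) (b := b) hf (fun y _ => hv' y)).mul_const I
    simpa using this
  have key : ∀ w ∈ Metric.ball w₀ r, contourIntegral f w = g w - g w₀ + contourIntegral f w₀ := by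
    intro w hw
    have hcv : ∀ y ∈ [[w₀.im, w.im]], (w₀.re + y * I : ℂ) ∈ Metric.ball w₀ r := by
      intro y hy
      rw [Metric.mem_ball, dist_eq_norm] at hw ⊢
      refine lt_of_le_of_lt ?_ hw
      have e : (w₀.re + y * I : ℂ) - w₀ = ((y - w₀.im : ℝ) : ℂ) * I := by
        apply Complex.ext <;> simp
      rw [e, norm_mul, Complex.norm_I, mul_one, Complex.norm_real, Real.norm_eq_abs]
      refine le_trans ?_ (Complex.abs_im_le_norm _)
      rw [Complex.sub_im]
      exact Set.abs_sub_left_of_mem_uIcc hy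
    have hch : ∀ x ∈ [[w₀.re, w.re]], (x + w.im * I : ℂ) ∈ Metric.ball w₀ r := by
      intro x hx
      rw [Metric.mem_ball, dist_eq_norm] at hw ⊢
      refine lt_of_le_of_lt ?_ hw
      have e : (x + w.im * I : ℂ) - w₀ = ⟨x - w₀.re, w.im - w₀.im⟩ := by
        apply Complex.ext <;> simp
      have e2 : w - w₀ = ⟨w.re - w₀.re, w.im - w₀.im⟩ := by
        apply Complex.ext <;> simp
      rw [e, e2, Complex.norm_def, Complex.norm_def]
      apply Real.sqrt_le_sqrt
      simp only [Complex.normSq_apply]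
      have := Set.abs_sub_left_of_mem_uIcc hx
      have := sq_le_sq.2 this
      nlinarith
    have hrect := Complex.integral_boundary_rect_eq_zero_of_differentiableOn f
      (((-(Real.pi / 2) : ℝ) : ℂ) + w₀.im * I) (w₀.re + w.im * I) (hf.mono (by
        rintro p ⟨hp1, hp2⟩
        simp only [Complex.add_re, Complex.ofReal_re, Complex.mul_re, Complex.I_re, mul_zero,
          Complex.ofReal_im, Complex.I_im, mul_one, sub_self, add_zero, mem_preimage,
          Complex.add_im, Complex.mul_im, zero_add] at hp1 hp2
        have h1 := hb (hcv p.im hp2) p.re (by simpa using hp1)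
        simpa [Complex.re_add_im] using h1))
    simp only [Complex.add_re, Complex.ofReal_re, Complex.mul_re, Complex.I_re, mul_zero,
          Complex.ofReal_im, Complex.I_im, mul_one, sub_self, add_zero,
          Complex.add_im, Complex.mul_im, zero_add, smul_eq_mul] at hrect
    have hi1 : (∫ t in (-(Real.pi / 2))..w.re, f (t + w.im * I)) =
        (∫ t in (-(Real.pi / 2))..w₀.re, f (t + w.im * I)) + ∫ t in w₀.re..w.re, f (t + w.im * I) := by
      rw [intervalIntegral.integral_add_adjacent_intervals]
      · exact intervalIntegrable_horizontal hf fun x hx => by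
          simpa using hb (hcv w.im right_mem_uIcc) x (by simpa using hx)
      · exact intervalIntegrable_horizontal hf fun x hx => hbA (hch x hx)
    have hi2 : (∫ t in (0 : ℝ)..w.im, f (-(Real.pi / 2 : ℝ) + t * I) * I) =
        (∫ t in (0 : ℝ)..w₀.im, f (-(Real.pi / 2 : ℝ) + t * I) * I) +
        ∫ t in w₀.im..w.im, f (-(Real.pi / 2 : ℝ) + t * I) * I := by
      rw [intervalIntegral.integral_add_adjacent_intervals (hvert _ _) (hvert _ _)]
    have hf1 : (∫ t in w₀.re..w.re, f (t + w.im * I)) = g w - g (w₀.re + w.im * I) := by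
      rw [intervalIntegral.integral_eq_sub_of_hasDerivAt (f := fun t : ℝ => g (t + w.im * I))
        (f' := fun t : ℝ => f (t + w.im * I)), Complex.re_add_im]
      · intro x hx
        have h1 := hg _ (hch x hx)
        have h2 : HasDerivAt (fun t : ℝ => ((t : ℂ) + w.im * I)) 1 x :=
          (Complex.ofRealCLM.hasDerivAt).add_const _
        have h3 := h1.comp x h2
        rw [mul_one] at h3
        exact h3
      · exact intervalIntegrable_horizontal hf fun x hx => hbA (hch x hx)
    have hf2 : I * (∫ t in w₀.im..w.im, f (w₀.re + t * I)) = g (w₀.re + w.im * I) - g w₀ := by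
      rw [← intervalIntegral.integral_const_mul,
        intervalIntegral.integral_eq_sub_of_hasDerivAt (f := fun t : ℝ => g (w₀.re + t * I))
        (f' := fun t : ℝ => I * f (w₀.re + t * I)), Complex.re_add_im]
      · intro x hx
        have h1 := hg _ (hcv x hx)
        have h2 : HasDerivAt (fun t : ℝ => ((w₀.re : ℂ) + t * I)) I x := by
          simpa using ((Complex.ofRealCLM.hasDerivAt (x := x)).mul_const I).const_add (w₀.re : ℂ)
        have := h1.comp x h2
        rwa [mul_comm] at this
      · exact (intervalIntegrable_vertical hf fun x hx => hbA (hcv x hx)).const_mul I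
    have hi3 : (∫ t in w₀.im..w.im, f (-(Real.pi / 2 : ℝ) + t * I) * I) =
        I * ∫ t in w₀.im..w.im, f (((-(Real.pi / 2) : ℝ) : ℂ) + t * I) := by
      rw [← intervalIntegral.integral_const_mul]
      push_cast
      simp only [mul_comm]
    rw [contourIntegral, contourIntegral, hi1, hi2, hi3]
    linear_combination hf1 + hf2 - hrect
  have hw0g := hg w₀ (Metric.mem_ball_self hr)
  refine ((hw0g.sub_const (g w₀)).add_const (contourIntegral f w₀)).congr_of_eventuallyEq ?_
  filter_upwards [Metric.ball_mem_nhds w₀ hr] with w hw using key w hw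

lemma contourIntegral_const_mul (a : ℂ) (f : ℂ → ℂ) (w : ℂ) :
    contourIntegral (fun u => a * f u) w = a * contourIntegral f w := by
  simp only [contourIntegral, mul_assoc, intervalIntegral.integral_const_mul, mul_add]

lemma integral_zero_neg (g : ℝ → ℂ) (y : ℝ) :
    (∫ t in (0 : ℝ)..(-y), g t) = -∫ t in (0 : ℝ)..y, g (-t) := by
  rw [intervalIntegral.integral_comp_neg, neg_zero, intervalIntegral.integral_symm]

lemma contourIntegral_conj {f : ℂ → ℂ} (hf : ∀ u, f (starRingEnd ℂ u) = starRingEnd ℂ (f u))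
    (w : ℂ) : contourIntegral f (starRingEnd ℂ w) = starRingEnd ℂ (contourIntegral f w) := by
  have hconj : ∀ (g : ℝ → ℂ) (a b : ℝ), starRingEnd ℂ (∫ t in a..b, g t) =
      ∫ t in a..b, starRingEnd ℂ (g t) := by
    intro g a b
    simp only [intervalIntegral, map_sub, integral_conj]
  rw [contourIntegral, contourIntegral, map_add, hconj, hconj]
  congr 1
  · rw [Complex.conj_im, integral_zero_neg, ← intervalIntegral.integral_neg]
    refine intervalIntegral.integral_congr fun t _ => ?_
    simp only [map_mul, ← hf, Complex.conj_I, map_add, map_neg, Complex.conj_ofReal]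
    push_cast
    ring_nf
  · rw [Complex.conj_re, Complex.conj_im]
    refine intervalIntegral.integral_congr fun t _ => ?_
    simp only [← hf, map_add, map_mul, Complex.conj_ofReal, Complex.conj_I]
    push_cast
    ring_nf

/-- A functional equation for the integrand yields one for the contour integral. -/
theorem contourIntegral_add_shift {T e : ℂ → ℂ} {A : Set ℂ} (hT : DifferentiableOn ℂ T A)
    (hv : ∀ y : ℝ, (-(Real.pi / 2 : ℝ) + y * I : ℂ) ∈ A)
    (heven : ∀ y : ℝ, T (-(Real.pi / 2 : ℝ) + (-y : ℝ) * I) = T (-(Real.pi / 2 : ℝ) + y * I))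
    {h : ℝ} {v : ℂ} (h1 : v + I * h ∈ slit A) (h2 : v - I * h ∈ slit A)
    (hev : ∀ y : ℝ, T (-(Real.pi / 2 : ℝ) + y * I + I * h) + T (-(Real.pi / 2 : ℝ) + y * I - I * h) =
      e (-(Real.pi / 2 : ℝ) + y * I))
    (heh : ∀ t ∈ [[-(Real.pi / 2), v.re]], T (t + v.im * I + I * h) + T (t + v.im * I - I * h) =
      e (t + v.im * I)) :
    contourIntegral T (v + I * h) + contourIntegral T (v - I * h) = contourIntegral e v := by
  set V : ℝ → ℂ := fun y => T (-(Real.pi / 2 : ℝ) + y * I) * I with hV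
  have hvi : ∀ a b : ℝ, IntervalIntegrable V volume a b := by
    intro a b
    have := (intervalIntegrable_vertical (a := a) (b := b) (x := -(Real.pi / 2)) hT
      (fun y _ => by have := hv y; push_cast at this ⊢; exact this)).mul_const I
    simpa [hV] using this
  have hVe : ∀ y, V (-y) = V y := fun y => by simp only [hV]; rw [heven]
  have im1 : (v + I * h).im = v.im + h := by simp
  have im2 : (v - I * h).im = v.im - h := by simp
  have re1 : (v + I * h).re = v.re := by simp
  have re2 : (v - I * h).re = v.re := by simp
  have hh1 : IntervalIntegrable (fun t : ℝ => T (t + (v.im + h : ℝ) * I)) volume (-(Real.pi / 2)) v.re :=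
    intervalIntegrable_horizontal hT fun t ht => by
      have := h1 t (by rwa [re1]); rwa [im1] at this
  have hh2 : IntervalIntegrable (fun t : ℝ => T (t + (v.im - h : ℝ) * I)) volume (-(Real.pi / 2)) v.re :=
    intervalIntegrable_horizontal hT fun t ht => by
      have := h2 t (by rwa [re2]); rwa [im2] at this
  rw [contourIntegral, contourIntegral, contourIntegral, im1, im2, re1, re2]
  have hH : (∫ t in (-(Real.pi / 2))..v.re, T (t + (v.im + h : ℝ) * I)) +
      (∫ t in (-(Real.pi / 2))..v.re, T (t + (v.im - h : ℝ) * I)) =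
      ∫ t in (-(Real.pi / 2))..v.re, e (t + v.im * I) := by
    rw [← intervalIntegral.integral_add hh1 hh2]
    refine intervalIntegral.integral_congr fun t ht => ?_
    rw [← heh t ht]
    push_cast
    ring_nf
  have hVV : (∫ y in (0 : ℝ)..(v.im + h), V y) + (∫ y in (0 : ℝ)..(v.im - h), V y) =
      ∫ y in (0 : ℝ)..v.im, e (-(Real.pi / 2 : ℝ) + y * I) * I := by
    have e1 : (∫ y in (0 : ℝ)..v.im, e (-(Real.pi / 2 : ℝ) + y * I) * I) =
        (∫ y in (0 : ℝ)..v.im, V (y + h)) + ∫ y in (0 : ℝ)..v.im, V (y - h) := by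
      rw [← intervalIntegral.integral_add]
      · refine intervalIntegral.integral_congr fun t ht => ?_
        simp only [hV]
        rw [← hev t]
        push_cast
        ring_nf
      · simpa using (hvi (0 + h) (v.im + h)).comp_add_right h
      · simpa using (hvi (0 - h) (v.im - h)).comp_sub_right h
    rw [e1, intervalIntegral.integral_comp_add_right, intervalIntegral.integral_comp_sub_right,
      zero_add, zero_sub]
    -- After translation the two vertical legs start at `h` and `-h` instead of `0`; the missing
    -- pieces cancel because the integrand is even on the vertical line.
    have e2 : (∫ y in (0 : ℝ)..h, V y) + (∫ y in (0 : ℝ)..(-h), V y) = 0 := by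
      have : (∫ y in (0 : ℝ)..(-h), V y) = -∫ y in (0 : ℝ)..h, V y := by
        rw [integral_zero_neg]
        simp only [hVe]
      rw [this]; ring
    have e3 := intervalIntegral.integral_add_adjacent_intervals (hvi 0 h) (hvi h (v.im + h))
    have e4 := intervalIntegral.integral_add_adjacent_intervals (hvi 0 (-h)) (hvi (-h) (v.im - h))
    linear_combination -e3 - e4 + e2
  linear_combination hH + hVV

/-! ### Contours -/

lemma mem_contour {a : ℝ} {ω p : ℂ} : p ∈ contour a ω ↔
    (p.re = a ∧ p.im ∈ [[0, ω.im]]) ∨ (p.im = ω.im ∧ p.re ∈ [[a, ω.re]]) := by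
  have hv : segment ℝ (a : ℂ) (a + ω.im * I) = {p : ℂ | p.re = a ∧ p.im ∈ [[0, ω.im]]} := by
    ext p
    rw [segment_eq_image', ← segment_eq_uIcc, segment_eq_image']
    constructor
    · rintro ⟨s, hs, rfl⟩
      simp only [mem_ofPred_eq]
      exact ⟨by simp, s, hs, by simp⟩
    · rintro ⟨h1, s, hs, h2⟩
      refine ⟨s, hs, Complex.ext ?_ ?_⟩
      · simp [h1]
      · simpa using h2
  have hh : segment ℝ (a + ω.im * I : ℂ) ω = {p : ℂ | p.im = ω.im ∧ p.re ∈ [[a, ω.re]]} := by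
    ext p
    rw [segment_eq_image', ← segment_eq_uIcc, segment_eq_image']
    constructor
    · rintro ⟨s, hs, rfl⟩
      exact ⟨by simp, s, hs, by simp⟩
    · rintro ⟨h1, s, hs, h2⟩
      refine ⟨s, hs, Complex.ext ?_ ?_⟩
      · simpa using h2
      · simp [h1]
  rw [contour, mem_union, hv, hh]
  rfl

lemma mem_contour_self (a : ℝ) (ω : ℂ) : ω ∈ contour a ω :=
  mem_contour.2 (Or.inr ⟨rfl, right_mem_uIcc⟩)

lemma ofReal_mem_contour (a : ℝ) (ω : ℂ) : (a : ℂ) ∈ contour a ω :=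
  mem_contour.2 (Or.inl ⟨by simp, by simp⟩)

lemma isPreconnected_contour (a : ℝ) (ω : ℂ) : IsPreconnected (contour a ω) :=
  (convex_segment _ _).isPreconnected.union (a + ω.im * I : ℂ) (right_mem_segment _ _ _)
    (left_mem_segment _ _ _) (convex_segment _ _).isPreconnected

lemma contour_subset_slit {A : Set ℂ} (hv : ∀ y : ℝ, (-(Real.pi / 2 : ℝ) + y * I : ℂ) ∈ A) {w : ℂ}
    (hw : w ∈ slit A) : contour (-(Real.pi / 2)) w ⊆ slit A := by
  intro p hp t ht
  rcases mem_contour.1 hp with ⟨h1, -⟩ | ⟨h1, h2⟩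
  · rw [h1, uIcc_self, mem_singleton_iff] at ht
    rw [ht]
    simpa using hv p.im
  · rw [h1]
    exact hw t (uIcc_subset_uIcc_left h2 ht)

/-- Each point is joined to the base point `-π/2` by its own contour, which stays in the slit
region. -/
lemma isPreconnected_slit {A : Set ℂ} (hv : ∀ y : ℝ, (-(Real.pi / 2 : ℝ) + y * I : ℂ) ∈ A) :
    IsPreconnected (slit A) :=
  isPreconnected_of_forall ((-(Real.pi / 2) : ℝ) : ℂ) fun w hw =>
    ⟨contour (-(Real.pi / 2)) w, contour_subset_slit hv hw, ofReal_mem_contour _ _,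
      mem_contour_self _ _, isPreconnected_contour _ _⟩

lemma neg_pi_div_two_mem_slit {A : Set ℂ}
    (hv : ∀ y : ℝ, (-(Real.pi / 2 : ℝ) + y * I : ℂ) ∈ A) : (-(Real.pi / 2 : ℝ) : ℂ) ∈ slit A := by
  intro t ht
  have h1 : (-(Real.pi / 2 : ℝ) : ℂ).re = -(Real.pi / 2) := by
    rw [Complex.neg_re, Complex.ofReal_re]
  rw [h1, uIcc_self, mem_singleton_iff] at ht
  have := hv 0
  rw [ht]
  simpa using this

lemma contourIntegral_neg_pi_div_two (f : ℂ → ℂ) :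
    contourIntegral f (-(Real.pi / 2 : ℝ)) = 0 := by
  have h1 : (-(Real.pi / 2 : ℝ) : ℂ).re = -(Real.pi / 2) := by
    rw [Complex.neg_re, Complex.ofReal_re]
  have h2 : (-(Real.pi / 2 : ℝ) : ℂ).im = 0 := by
    rw [Complex.neg_im, Complex.ofReal_im, neg_zero]
  rw [contourIntegral, h1, h2]
  simp

/-- The exponential of the contour integral of a logarithmic derivative. -/
theorem exp_contourIntegral {f R : ℂ → ℂ} {A : Set ℂ} (hA : IsOpen A)
    (hf : DifferentiableOn ℂ f A) (hv : ∀ y : ℝ, (-(Real.pi / 2 : ℝ) + y * I : ℂ) ∈ A)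
    (hR : ∀ u ∈ A, HasDerivAt R (R u * f u) u) (hR1 : R (-(Real.pi / 2 : ℝ)) = 1)
    {w : ℂ} (hw : w ∈ slit A) : Complex.exp (contourIntegral f w) = R w := by
  set H : ℂ → ℂ := fun u => R u * Complex.exp (-contourIntegral f u)
  have hH : ∀ u ∈ slit A, HasDerivAt H 0 u := by
    intro u hu
    exact ((hR u (mem_of_mem_slit hu)).mul
      ((hasDerivAt_contourIntegral hA hf hv hu).neg.cexp)).congr_deriv (by ring)
  have hc := (isOpen_slit hA).is_const_of_deriv_eq_zero (isPreconnected_slit hv)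
    (fun u hu => (hH u hu).differentiableAt.differentiableWithinAt)
    (fun u hu => (hH u hu).deriv) hw (neg_pi_div_two_mem_slit hv)
  simp only [H, contourIntegral_neg_pi_div_two, hR1, neg_zero, Complex.exp_zero, mul_one] at hc
  rw [Complex.exp_neg] at hc
  have := Complex.exp_ne_zero (contourIntegral f w)
  field_simp at hc
  exact hc.symm

/-! ### Periodic holomorphic functions on the lower half plane -/

/-- `f` is holomorphic and `π`-periodic on the closed lower half plane and tends to `l` at `-i∞`. -/
structure LowerPeriodic (f : ℂ → ℂ) (l : ℂ) : Prop where
  diff : ∀ s : ℂ, s.im ≤ 0 → DifferentiableAt ℂ f s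
  per : ∀ s : ℂ, s.im ≤ 0 → f (s + Real.pi) = f s
  lim : Tendsto f (comap Complex.im atBot) (𝓝 l)

/-- Periodicity makes the vertical sides of a rectangle cancel, so the segment can be pushed down to
`-i∞`, where the integrand is nearly `l`. -/
lemma LowerPeriodic.integral_eq {f : ℂ → ℂ} {l : ℂ} (h : LowerPeriodic f l) :
    (∫ s in (-(Real.pi / 2))..(Real.pi / 2), f (s : ℝ)) = Real.pi * l := by
  have hp := Real.pi_pos
  have hdo : ∀ S : Set ℂ, (∀ s ∈ S, s.im ≤ 0) → DifferentiableOn ℂ f S := fun S hS s hs =>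
    (h.diff s (hS s hs)).differentiableWithinAt
  have hshift : ∀ B : ℝ, B ≤ 0 → (∫ s in (-(Real.pi / 2))..(Real.pi / 2), f (s : ℝ)) =
      ∫ s in (-(Real.pi / 2))..(Real.pi / 2), f (s + B * I) := by
    intro B hB
    have := Complex.integral_boundary_rect_eq_zero_of_differentiableOn f
      (((-(Real.pi / 2) : ℝ) : ℂ) + B * I) ((Real.pi / 2 : ℝ) : ℂ) (hdo _ (by
        rintro p ⟨-, hp2⟩
        simp only [Complex.add_im, Complex.ofReal_im, Complex.mul_im, Complex.ofReal_re,
          Complex.I_im, mul_one, Complex.I_re, mul_zero, add_zero, zero_add, mem_preimage,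
          uIcc_of_le hB] at hp2
        exact hp2.2))
    simp only [Complex.add_im, Complex.ofReal_im, Complex.mul_im, Complex.ofReal_re,
          Complex.I_im, mul_one, Complex.I_re, mul_zero, add_zero, zero_add, Complex.add_re,
          Complex.mul_re, sub_self, zero_mul, Complex.ofReal_zero] at this
    have hs : (∫ y in B..0, f (((Real.pi / 2 : ℝ) : ℂ) + y * I)) =
        ∫ y in B..0, f (((-(Real.pi / 2) : ℝ) : ℂ) + y * I) := by
      refine intervalIntegral.integral_congr fun y hy => ?_
      rw [uIcc_of_le hB] at hy
      rw [← h.per (((-(Real.pi / 2) : ℝ) : ℂ) + y * I) (by simpa using hy.2)]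
      congr 1
      push_cast
      ring
    rw [hs] at this
    linear_combination -this
  rw [← sub_eq_zero, ← norm_eq_zero]
  refine le_antisymm (le_of_forall_pos_le_add fun ε hε => ?_) (norm_nonneg _)
  have hl := (Metric.tendsto_nhds.1 h.lim) (ε / Real.pi) (by positivity)
  rw [eventually_comap] at hl
  obtain ⟨B, hB1, hB2⟩ := (hl.and (eventually_le_atBot (0 : ℝ))).exists
  rw [hshift B hB2]
  have hc : (Real.pi * l : ℂ) = ∫ s in (-(Real.pi / 2))..(Real.pi / 2), l := by
    rw [intervalIntegral.integral_const, Complex.real_smul]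
    push_cast; ring
  rw [hc, ← intervalIntegral.integral_sub]
  · refine (intervalIntegral.norm_integral_le_of_norm_le_const (C := ε / Real.pi) ?_).trans ?_
    · intro x _
      rw [← dist_eq_norm]
      exact (hB1 (x + B * I) (by simp)).le
    · rw [sub_neg_eq_add, add_halves, abs_of_pos hp, zero_add, div_mul_cancel₀ _ hp.ne']
  · exact intervalIntegrable_horizontal (A := {s : ℂ | s.im ≤ 0}) (hdo _ fun s hs => hs)
      fun x _ => by simpa using hB2
  · exact intervalIntegrable_const

lemma tendsto_im_sub (a : ℂ) : Tendsto (fun s : ℂ => s - a) (comap Complex.im atBot)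
    (comap Complex.im atBot) := by
  rw [tendsto_comap_iff]
  have : (Complex.im ∘ fun s : ℂ => s - a) = fun s => s.im + (-a.im) := by
    funext s; simp [sub_eq_add_neg]
  rw [this]
  exact tendsto_atBot_add_const_right _ _ tendsto_comap

lemma tendsto_two_div_exp_sub_one : Tendsto (fun y : ℝ => 2 / (Real.exp (-2 * y) - 1)) atBot (𝓝 0) := by
  refine Tendsto.div_atTop tendsto_const_nhds ?_
  refine tendsto_atTop_add_const_right _ (-1) ?_
  exact Real.tendsto_exp_atTop.comp (tendsto_id.const_mul_atBot_of_neg (by norm_num))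

lemma tendsto_cot_atBot : Tendsto Complex.cot (comap Complex.im atBot) (𝓝 I) := by
  rw [tendsto_iff_norm_sub_tendsto_zero]
  refine squeeze_zero' (Eventually.of_forall fun _ => norm_nonneg _) ?_
    (tendsto_two_div_exp_sub_one.comp tendsto_comap)
  filter_upwards [tendsto_comap.eventually (eventually_lt_atBot (0 : ℝ))] with w hw
  exact norm_cot_sub_I_le hw

/-! ### Integrals over a period against cotangents and kernels -/

lemma lowerPeriodic_cot {a : ℂ} (ha : 0 < a.im) : LowerPeriodic (fun s => Complex.cot (s - a)) I where
  diff s hs := by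
    have : Complex.sin (s - a) ≠ 0 := sin_ne_zero_of_im_ne_zero (by rw [Complex.sub_im]; linarith)
    exact DifferentiableAt.comp (f := fun s => s - a) s (differentiableAt_cot this) (by fun_prop)
  per s _ := by rw [show s + Real.pi - a = s - a + Real.pi by ring, cot_add_pi]
  lim := tendsto_cot_atBot.comp (tendsto_im_sub a)

lemma integral_cot_sub_of_pos {a : ℂ} (ha : 0 < a.im) :
    (∫ s in (-(Real.pi / 2))..(Real.pi / 2), Complex.cot ((s : ℝ) - a)) = Real.pi * I :=
  (lowerPeriodic_cot ha).integral_eq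

lemma integral_comp_neg_symm (g : ℝ → ℂ) :
    (∫ s in (-(Real.pi / 2))..(Real.pi / 2), g (-s)) =
      ∫ s in (-(Real.pi / 2))..(Real.pi / 2), g s := by
  rw [intervalIntegral.integral_comp_neg, neg_neg]

/-- The pole now blocks the way to `-i∞`; the reflection `s ↦ -s` moves it above the axis. -/
lemma integral_cot_sub_of_neg {a : ℂ} (ha : a.im < 0) :
    (∫ s in (-(Real.pi / 2))..(Real.pi / 2), Complex.cot ((s : ℝ) - a)) = -(Real.pi * I) := by
  rw [← integral_comp_neg_symm, ← integral_cot_sub_of_pos (a := -a) (by simpa using ha),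
    ← intervalIntegral.integral_neg]
  refine intervalIntegral.integral_congr fun s _ => ?_
  rw [← cot_neg]
  congr 1
  push_cast; ring

lemma LowerPeriodic.mul_cot {f : ℂ → ℂ} {l : ℂ} (h : LowerPeriodic f l) {a : ℂ} (ha : 0 < a.im) :
    LowerPeriodic (fun s => f s * Complex.cot (s - a)) (l * I) where
  diff s hs := (h.diff s hs).mul ((lowerPeriodic_cot ha).diff s hs)
  per s hs := by simp only [h.per s hs, (lowerPeriodic_cot ha).per s hs]
  lim := h.lim.mul (lowerPeriodic_cot ha).lim

lemma LowerPeriodic.integral_mul_cot_of_pos {f : ℂ → ℂ} {l : ℂ} (h : LowerPeriodic f l) {a : ℂ}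
    (ha : 0 < a.im) :
    (∫ s in (-(Real.pi / 2))..(Real.pi / 2), f (s : ℝ) * Complex.cot ((s : ℝ) - a)) =
      Real.pi * (l * I) :=
  (h.mul_cot ha).integral_eq

lemma LowerPeriodic.add_int_mul_pi {f : ℂ → ℂ} {l : ℂ} (h : LowerPeriodic f l) {s : ℂ}
    (hs : s.im ≤ 0) (m : ℤ) : f (s + m * Real.pi) = f s := by
  have him : ∀ m : ℤ, (s + m * Real.pi).im ≤ 0 := by intro m; simpa using hs
  induction m using Int.induction_on with
  | zero => simp
  | succ k ih =>
    rw [← ih, ← h.per _ (him k)]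
    congr 1; push_cast; ring
  | pred k ih =>
    rw [← ih, ← h.per (s + ((-(k : ℤ) - 1 : ℤ) : ℂ) * Real.pi) (him _)]
    congr 1; push_cast; ring

/-- `(f s - f a) cot (s - a)` with the singularities removed. -/
def subMulCot (f : ℂ → ℂ) (a s : ℂ) : ℂ :=
  if Complex.sin (s - a) = 0 then deriv f s else (f s - f a) * Complex.cot (s - a)

/-- Subtracting the single constant `f a` cancels the poles of the cotangent at all points `a + πm`,
because `f` is periodic. The residue formula `LowerPeriodic.integral_mul_cot_of_neg` then needs only
the shift of contour. -/
lemma LowerPeriodic.subMulCot {f : ℂ → ℂ} {l : ℂ} (h : LowerPeriodic f l) {a : ℂ}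
    (ha : a.im < 0) : LowerPeriodic (subMulCot f a) ((l - f a) * I) where
  diff := by
    intro s hs
    by_cases hsin : Complex.sin (s - a) = 0
    · obtain ⟨m, hm⟩ := Complex.sin_eq_zero_iff.1 hsin
      have hs_eq : s = a + m * Real.pi := by rw [← hm]; ring
      have hsim : s.im < 0 := by rw [hs_eq]; simpa using ha
      have hfs : f s = f a := by rw [hs_eq, h.add_int_mul_pi ha.le]
      have hopen : {u : ℂ | u.im < 0} ∈ 𝓝 s :=
        (isOpen_lt Complex.continuous_im continuous_const).mem_nhds hsim
      have hd1 : DifferentiableAt ℂ (dslope f s) s :=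
        ((Complex.differentiableOn_dslope hopen).2 fun u hu =>
          (h.diff u (le_of_lt hu)).differentiableWithinAt).differentiableAt hopen
      have hd2 : DifferentiableAt ℂ (dslope (fun u => Complex.sin (u - a)) s) s :=
        ((Complex.differentiableOn_dslope hopen).2 fun u _ =>
          DifferentiableAt.differentiableWithinAt (by fun_prop)).differentiableAt hopen
      have hsd : dslope (fun u => Complex.sin (u - a)) s s = Complex.cos (s - a) := by
        rw [dslope_same]
        have : HasDerivAt (fun u => Complex.sin (u - a)) (Complex.cos (s - a) * 1) s :=
          ((hasDerivAt_id s).sub_const a).csin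
        rw [this.deriv, mul_one]
      have hcos : Complex.cos (s - a) ≠ 0 := by
        intro h0
        have := Complex.sin_sq_add_cos_sq (s - a)
        rw [h0, hsin] at this
        norm_num at this
      have hne : ∀ᶠ u in 𝓝 s, dslope (fun u => Complex.sin (u - a)) s u ≠ 0 :=
        hd2.continuousAt.eventually_ne (by rwa [hsd])
      -- Near a pole the function is a quotient of divided differences of `f` and of the sine, times
      -- a cosine. At the pole itself this quotient is `deriv f s`, the default value in the
      -- definition.
      refine DifferentiableAt.congr_of_eventuallyEq (f := fun u => dslope f s u *
        (Complex.cos (u - a) / dslope (fun u => Complex.sin (u - a)) s u)) ?_ ?_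
      · exact hd1.mul (DifferentiableAt.div (by fun_prop) hd2 (by rwa [hsd]))
      · filter_upwards [hne] with u hu
        by_cases hus : u = s
        · rw [hus, XXZ.subMulCot, if_pos hsin, hsd, dslope_same, div_self hcos, mul_one]
        · have hus' : u - s ≠ 0 := sub_ne_zero.2 hus
          rw [dslope_of_ne _ hus, slope_def_field] at hu
          simp only [hsin, sub_zero] at hu
          have hsu : Complex.sin (u - a) ≠ 0 := fun h0 => hu (by rw [h0, zero_div])
          rw [XXZ.subMulCot, if_neg hsu, dslope_of_ne _ hus, dslope_of_ne _ hus, slope_def_field,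
            slope_def_field, hsin, hfs, Complex.cot_eq_cos_div_sin]
          field_simp
          ring
    · have hopen : ∀ᶠ u in 𝓝 s, Complex.sin (u - a) ≠ 0 :=
        (show ContinuousAt (fun u => Complex.sin (u - a)) s by fun_prop).eventually_ne hsin
      refine DifferentiableAt.congr_of_eventuallyEq
        (f := fun u => (f u - f a) * Complex.cot (u - a)) ?_ ?_
      · exact ((h.diff s hs).sub_const _).mul (DifferentiableAt.comp (f := fun s => s - a) s
          (differentiableAt_cot hsin) (by fun_prop))
      · filter_upwards [hopen] with u hu
        rw [XXZ.subMulCot, if_neg hu]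
  per := by
    intro s hs
    rw [XXZ.subMulCot, XXZ.subMulCot, show s + Real.pi - a = s - a + Real.pi by ring]
    by_cases hsin : Complex.sin (s - a) = 0
    · rw [if_pos ((sin_add_pi_eq_zero_iff _).2 hsin), if_pos hsin, ← deriv_comp_add_const]
      obtain ⟨m, hm⟩ := Complex.sin_eq_zero_iff.1 hsin
      have hs_eq : s = a + m * Real.pi := by rw [← hm]; ring
      have hsim : s.im < 0 := by rw [hs_eq]; simpa using ha
      refine EventuallyEq.deriv_eq ?_
      filter_upwards [(isOpen_lt Complex.continuous_im continuous_const).mem_nhds hsim] with u hu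
      exact h.per u (le_of_lt hu)
    · rw [if_neg (mt (sin_add_pi_eq_zero_iff _).1 hsin), if_neg hsin, h.per s hs, cot_add_pi]
  lim := by
    have : Tendsto (fun s => (f s - f a) * Complex.cot (s - a)) (comap Complex.im atBot)
        (𝓝 ((l - f a) * I)) :=
      (h.lim.sub_const _).mul (tendsto_cot_atBot.comp (tendsto_im_sub a))
    refine this.congr' ?_
    filter_upwards [tendsto_comap.eventually (eventually_lt_atBot a.im)] with s hs
    rw [XXZ.subMulCot, if_neg]
    exact sin_ne_zero_of_im_ne_zero (by rw [Complex.sub_im]; linarith)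

lemma continuous_cot_ofReal_sub {a : ℂ} (ha : a.im ≠ 0) :
    Continuous fun s : ℝ => Complex.cot ((s : ℂ) - a) := by
  rw [continuous_iff_continuousAt]
  intro s
  have : Complex.sin ((s : ℂ) - a) ≠ 0 := sin_ne_zero_of_im_ne_zero (by simpa using ha)
  exact ContinuousAt.comp (f := fun s : ℝ => (s : ℂ) - a) (differentiableAt_cot this).continuousAt
    (by fun_prop)

lemma LowerPeriodic.continuous_ofReal {f : ℂ → ℂ} {l : ℂ} (h : LowerPeriodic f l) :
    Continuous fun s : ℝ => f s := by
  rw [continuous_iff_continuousAt]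
  intro s
  exact ContinuousAt.comp (f := fun s : ℝ => (s : ℂ)) (h.diff s (by simp)).continuousAt
    (by fun_prop)

/-- The regularised function contributes `π (l - f a) i`, and the subtracted part contributes `f a`
times the mean `-πi` of a cotangent with pole below the axis. The total differs from the pole-free
value by the residue term. -/
lemma LowerPeriodic.integral_mul_cot_of_neg {f : ℂ → ℂ} {l : ℂ} (h : LowerPeriodic f l) {a : ℂ}
    (ha : a.im < 0) :
    (∫ s in (-(Real.pi / 2))..(Real.pi / 2), f (s : ℝ) * Complex.cot ((s : ℝ) - a)) =
      Real.pi * (l * I) - 2 * Real.pi * I * f a := by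
  have h1 := (h.subMulCot ha).integral_eq
  have h2 : (∫ s in (-(Real.pi / 2))..(Real.pi / 2), XXZ.subMulCot f a (s : ℝ)) =
      (∫ s in (-(Real.pi / 2))..(Real.pi / 2), f (s : ℝ) * Complex.cot ((s : ℝ) - a)) -
      f a * ∫ s in (-(Real.pi / 2))..(Real.pi / 2), Complex.cot ((s : ℝ) - a) := by
    rw [← intervalIntegral.integral_const_mul, ← intervalIntegral.integral_sub]
    · refine intervalIntegral.integral_congr fun s _ => ?_
      have : Complex.sin ((s : ℂ) - a) ≠ 0 := sin_ne_zero_of_im_ne_zero (by simpa using ha.ne)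
      simp only [XXZ.subMulCot, if_neg this]
      ring
    · exact (h.continuous_ofReal.mul (continuous_cot_ofReal_sub ha.ne)).intervalIntegrable _ _
    · exact ((continuous_cot_ofReal_sub ha.ne).const_mul _).intervalIntegrable _ _
  rw [integral_cot_sub_of_neg ha] at h2
  linear_combination h1 - h2

lemma LowerPeriodic.integral_mul_cotDiff {f : ℂ → ℂ} {l : ℂ} (h : LowerPeriodic f l) {c : ℝ}
    {μ : ℂ} (h1 : μ.im + c ≠ 0) (h2 : μ.im - c ≠ 0) :
    (∫ s in (-(Real.pi / 2))..(Real.pi / 2), f (s : ℝ) * cotDiff c ((s : ℝ) - μ)) =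
      -I * ((∫ s in (-(Real.pi / 2))..(Real.pi / 2), f (s : ℝ) * Complex.cot ((s : ℝ) - (μ + I * c))) -
      ∫ s in (-(Real.pi / 2))..(Real.pi / 2), f (s : ℝ) * Complex.cot ((s : ℝ) - (μ - I * c))) := by
  have e1 : (μ + I * c).im ≠ 0 := by simpa using h1
  have e2 : (μ - I * c).im ≠ 0 := by simpa using h2
  rw [← intervalIntegral.integral_sub, ← intervalIntegral.integral_const_mul]
  · refine intervalIntegral.integral_congr fun s _ => ?_
    simp only [cotDiff]
    rw [show (s : ℂ) - μ - I * c = s - (μ + I * c) by ring,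
      show (s : ℂ) - μ + I * c = s - (μ - I * c) by ring]
    ring
  · exact (h.continuous_ofReal.mul (continuous_cot_ofReal_sub e1)).intervalIntegrable _ _
  · exact (h.continuous_ofReal.mul (continuous_cot_ofReal_sub e2)).intervalIntegrable _ _

/-- The poles are at `μ ± I * c` modulo `π`. Only the lower one lies below the axis here; neither
does in `LowerPeriodic.integral_mul_cotDiff_of_lt`, both do in
`LowerPeriodic.integral_mul_cotDiff_of_lt_neg`. For the kernel (`c = η`) it follows that `K` acts as
the shift `μ ↦ μ - I * η` on functions holomorphic below the axis. -/
lemma LowerPeriodic.integral_mul_cotDiff_of_abs_lt {f : ℂ → ℂ} {l : ℂ} (h : LowerPeriodic f l)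
    {c : ℝ} {μ : ℂ} (hμ : |μ.im| < c) :
    (∫ s in (-(Real.pi / 2))..(Real.pi / 2), f (s : ℝ) * cotDiff c ((s : ℝ) - μ)) =
      2 * Real.pi * f (μ - I * c) := by
  obtain ⟨h1, h2⟩ := abs_lt.1 hμ
  rw [h.integral_mul_cotDiff (by linarith) (by linarith),
    h.integral_mul_cot_of_pos (by simp; linarith), h.integral_mul_cot_of_neg (by simp; linarith)]
  linear_combination (-2 * Real.pi * f (μ - I * c)) * Complex.I_mul_I

lemma LowerPeriodic.integral_mul_cotDiff_of_lt {f : ℂ → ℂ} {l : ℂ} (h : LowerPeriodic f l)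
    {c : ℝ} (hc : 0 < c) {μ : ℂ} (hμ : c < μ.im) :
    (∫ s in (-(Real.pi / 2))..(Real.pi / 2), f (s : ℝ) * cotDiff c ((s : ℝ) - μ)) = 0 := by
  rw [h.integral_mul_cotDiff (by linarith) (by linarith),
    h.integral_mul_cot_of_pos (by simp; linarith), h.integral_mul_cot_of_pos (by simp; linarith)]
  ring

lemma LowerPeriodic.integral_mul_cotDiff_of_lt_neg {f : ℂ → ℂ} {l : ℂ} (h : LowerPeriodic f l)
    {c : ℝ} (hc : 0 < c) {μ : ℂ} (hμ : μ.im < -c) :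
    (∫ s in (-(Real.pi / 2))..(Real.pi / 2), f (s : ℝ) * cotDiff c ((s : ℝ) - μ)) =
      2 * Real.pi * (f (μ - I * c) - f (μ + I * c)) := by
  rw [h.integral_mul_cotDiff (by linarith) (by linarith),
    h.integral_mul_cot_of_neg (by simp; linarith), h.integral_mul_cot_of_neg (by simp; linarith)]
  linear_combination (-2 * Real.pi * (f (μ - I * c) - f (μ + I * c))) * Complex.I_mul_I

lemma kernel_eq_of_im {η : ℝ} {w : ℂ} (h : |w.im| ≠ |η|) :
    kernel η w = cotDiff η w / (2 * Real.pi) := by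
  apply kernel_eq_cotDiff <;> apply sin_ne_zero_of_im_ne_zero <;> intro h0 <;> apply h
  · have : w.im = -η := by simp at h0; linarith
    rw [this, abs_neg]
  · have : w.im = η := by simp at h0; linarith
    rw [this]

lemma bareMomentumDeriv_eq_of_im {η : ℝ} {w : ℂ} (h : |w.im| ≠ |η / 2|) :
    bareMomentumDeriv η w = cotDiff (η / 2) w := by
  apply bareMomentumDeriv_eq_cotDiff <;> apply sin_ne_zero_of_im_ne_zero <;> intro h0 <;> apply h
  · have : w.im = -(η / 2) := by simp at h0; linarith
    rw [this, abs_neg]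
  · have : w.im = η / 2 := by simp at h0; linarith
    rw [this]

lemma LowerPeriodic.integral_mul_kernel_eq {f : ℂ → ℂ} (η : ℝ)
    {μ : ℂ} (h1 : |μ.im| ≠ |η|) :
    (∫ s in (-(Real.pi / 2))..(Real.pi / 2), f (s : ℝ) * kernel η ((s : ℝ) - μ)) =
      (∫ s in (-(Real.pi / 2))..(Real.pi / 2), f (s : ℝ) * cotDiff η ((s : ℝ) - μ)) /
        (2 * Real.pi) := by
  rw [← intervalIntegral.integral_div]
  refine intervalIntegral.integral_congr fun s _ => ?_
  rw [kernel_eq_of_im (by simpa using h1), mul_div_assoc]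

lemma LowerPeriodic.integral_mul_kernel_of_abs_lt {f : ℂ → ℂ} {l : ℂ} (h : LowerPeriodic f l)
    {η : ℝ} {μ : ℂ} (hμ : |μ.im| < η) :
    (∫ s in (-(Real.pi / 2))..(Real.pi / 2), f (s : ℝ) * kernel η ((s : ℝ) - μ)) =
      f (μ - I * η) := by
  have : (2 * Real.pi : ℂ) ≠ 0 := by simp [Real.pi_ne_zero]
  rw [LowerPeriodic.integral_mul_kernel_eq η (by rw [abs_of_pos ((abs_nonneg _).trans_lt hμ)]; exact hμ.ne),
    h.integral_mul_cotDiff_of_abs_lt hμ, mul_div_cancel_left₀ _ this]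

lemma LowerPeriodic.integral_mul_kernel_of_lt {f : ℂ → ℂ} {l : ℂ} (h : LowerPeriodic f l)
    {η : ℝ} (hη : 0 < η) {μ : ℂ} (hμ : η < μ.im) :
    (∫ s in (-(Real.pi / 2))..(Real.pi / 2), f (s : ℝ) * kernel η ((s : ℝ) - μ)) = 0 := by
  rw [LowerPeriodic.integral_mul_kernel_eq η (by
    rw [abs_of_pos hη, abs_of_pos (hη.trans hμ)]; exact hμ.ne'),
    h.integral_mul_cotDiff_of_lt hη hμ, zero_div]

lemma LowerPeriodic.integral_mul_kernel_of_lt_neg {f : ℂ → ℂ} {l : ℂ} (h : LowerPeriodic f l)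
    {η : ℝ} (hη : 0 < η) {μ : ℂ} (hμ : μ.im < -η) :
    (∫ s in (-(Real.pi / 2))..(Real.pi / 2), f (s : ℝ) * kernel η ((s : ℝ) - μ)) =
      f (μ - I * η) - f (μ + I * η) := by
  have : (2 * Real.pi : ℂ) ≠ 0 := by simp [Real.pi_ne_zero]
  rw [LowerPeriodic.integral_mul_kernel_eq η (by
    rw [abs_of_pos hη, abs_of_neg (by linarith)]; linarith),
    h.integral_mul_cotDiff_of_lt_neg hη hμ, mul_div_cancel_left₀ _ this]

lemma LowerPeriodic.integral_mul_bareMomentumDeriv {f : ℂ → ℂ} {l : ℂ} (h : LowerPeriodic f l)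
    {η : ℝ} (hη : 0 < η) :
    (∫ s in (-(Real.pi / 2))..(Real.pi / 2), f (s : ℝ) * bareMomentumDeriv η (s : ℝ)) =
      2 * Real.pi * f (-(I * (η / 2 : ℝ))) := by
  have := h.integral_mul_cotDiff_of_abs_lt (c := η / 2) (μ := 0) (by simpa using hη)
  rw [zero_sub] at this
  rw [← this]
  refine intervalIntegral.integral_congr fun s _ => ?_
  rw [sub_zero, bareMomentumDeriv_eq_of_im (by
    rw [Complex.ofReal_im, abs_zero]; exact (abs_pos.2 (half_pos hη).ne').ne)]

lemma lowerPeriodic_const (a : ℂ) : LowerPeriodic (fun _ => a) a where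
  diff _ _ := differentiableAt_const _
  per _ _ := rfl
  lim := tendsto_const_nhds

/-! ### The bare momentum and the bare phase -/

/-- The complement of the poles of `cotDiff c`. -/
def regularSet (c : ℝ) : Set ℂ :=
  {w | Complex.sin (w + I * c) ≠ 0 ∧ Complex.sin (w - I * c) ≠ 0}

lemma isOpen_regularSet (c : ℝ) : IsOpen (regularSet c) :=
  (isOpen_ne_fun (by fun_prop) continuous_const).inter (isOpen_ne_fun (by fun_prop) continuous_const)

lemma vertical_mem_regularSet (c y : ℝ) : (-(Real.pi / 2 : ℝ) + y * I : ℂ) ∈ regularSet c := by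
  constructor <;> apply sin_ne_zero_of_re_eq <;> simp

lemma mem_regularSet_of_im {c : ℝ} {w : ℂ} (h : |w.im| ≠ |c|) : w ∈ regularSet c := by
  constructor <;> apply sin_ne_zero_of_im_ne_zero <;> intro h0 <;> apply h
  · have : w.im = -c := by simp at h0; linarith
    rw [this, abs_neg]
  · have : w.im = c := by simp at h0; linarith
    rw [this]

lemma mem_slit_regularSet_of_im {c : ℝ} {w : ℂ} (h : |w.im| ≠ |c|) : w ∈ slit (regularSet c) :=
  fun t _ => mem_regularSet_of_im (by simpa using h)

lemma differentiableOn_kernel (η : ℝ) : DifferentiableOn ℂ (kernel η) (regularSet η) := fun _ hw =>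
  (differentiableAt_kernel hw.1 hw.2).differentiableWithinAt

lemma differentiableOn_bareMomentumDeriv (η : ℝ) :
    DifferentiableOn ℂ (bareMomentumDeriv η) (regularSet (η / 2)) := fun _ hw =>
  (differentiableAt_bareMomentumDeriv (by simpa using hw.1) (by simpa using hw.2)).differentiableWithinAt

lemma hasDerivAt_bareMomentum {η : ℝ} {w : ℂ} (hw : w ∈ slit (regularSet (η / 2))) :
    HasDerivAt (bareMomentum η) (bareMomentumDeriv η w) w :=
  hasDerivAt_contourIntegral (isOpen_regularSet _) (differentiableOn_bareMomentumDeriv η)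
    (vertical_mem_regularSet _) hw

lemma hasDerivAt_barePhase {η : ℝ} {w : ℂ} (hw : w ∈ slit (regularSet η)) :
    HasDerivAt (barePhase η) (2 * I * Real.pi * kernel η w) w :=
  (hasDerivAt_contourIntegral (isOpen_regularSet _) (differentiableOn_kernel η)
    (vertical_mem_regularSet _) hw).const_mul _

lemma bareMomentum_conj (η : ℝ) (w : ℂ) :
    bareMomentum η (starRingEnd ℂ w) = starRingEnd ℂ (bareMomentum η w) :=
  contourIntegral_conj (bareMomentumDeriv_conj η) w

lemma hasDerivAt_sin_div_sin {c : ℝ} {w : ℂ} (hw : w ∈ regularSet c) :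
    HasDerivAt (fun u => Complex.sin (u - I * c) / Complex.sin (u + I * c))
      (Complex.sin (w - I * c) / Complex.sin (w + I * c) * (I * cotDiff c w)) w := by
  have h1 : HasDerivAt (fun u => Complex.sin (u - I * c)) (Complex.cos (w - I * c) * 1) w :=
    ((hasDerivAt_id w).sub_const _).csin
  have h2 : HasDerivAt (fun u => Complex.sin (u + I * c)) (Complex.cos (w + I * c) * 1) w :=
    ((hasDerivAt_id w).add_const _).csin
  refine (h1.div h2 hw.1).congr_deriv ?_
  have e1 := hw.1
  have e2 := hw.2
  rw [cotDiff, Complex.cot_eq_cos_div_sin, Complex.cot_eq_cos_div_sin, mul_one, mul_one]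
  field_simp
  rw [Complex.I_sq]
  ring

lemma sin_div_sin_neg_pi_div_two (c : ℝ) : Complex.sin (-(Real.pi / 2 : ℝ) - I * c) /
    Complex.sin (-(Real.pi / 2 : ℝ) + I * c) = 1 := by
  have h1 : Complex.sin (-(Real.pi / 2 : ℝ) + I * c) ≠ 0 := sin_ne_zero_of_re_eq (by simp)
  rw [div_eq_one_iff_eq h1]
  push_cast
  rw [show (-(Real.pi / 2) - I * c : ℂ) = -(I * c + Real.pi / 2) by ring,
    show (-(Real.pi / 2) + I * c : ℂ) = I * c - Real.pi / 2 by ring, Complex.sin_neg,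
    Complex.sin_add_pi_div_two, Complex.sin_sub_pi_div_two]

/-- Both sides have logarithmic derivative `I * cotDiff (η / 2)` and equal `1` at `-π/2`, so no
branch of the logarithm has to be chosen. Together with `exp_barePhase` this translates the Bethe
equations into values of the counting function. -/
lemma exp_bareMomentum {η : ℝ} {w : ℂ} (hw : w ∈ slit (regularSet (η / 2))) :
    Complex.exp (I * bareMomentum η w) =
      Complex.sin (w - I * (η / 2)) / Complex.sin (w + I * (η / 2)) := by
  have := exp_contourIntegral (f := fun u => I * bareMomentumDeriv η u)
    (R := fun u => Complex.sin (u - I * (η / 2 : ℝ)) / Complex.sin (u + I * (η / 2 : ℝ)))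
    (isOpen_regularSet (η / 2)) ((differentiableOn_bareMomentumDeriv η).const_mul I)
    (vertical_mem_regularSet _) (fun u hu => by
      rw [bareMomentumDeriv_eq_cotDiff (by simpa using hu.1) (by simpa using hu.2)]
      exact hasDerivAt_sin_div_sin hu) (sin_div_sin_neg_pi_div_two _) hw
  rw [contourIntegral_const_mul] at this
  rw [bareMomentum, this]
  push_cast
  rfl

lemma exp_barePhase {η : ℝ} {w : ℂ} (hw : w ∈ slit (regularSet η)) :
    Complex.exp (barePhase η w) = Complex.sin (w - I * η) / Complex.sin (w + I * η) := by
  have := exp_contourIntegral (f := fun u => 2 * I * Real.pi * kernel η u)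
    (R := fun u => Complex.sin (u - I * η) / Complex.sin (u + I * η))
    (isOpen_regularSet η) ((differentiableOn_kernel η).const_mul _)
    (vertical_mem_regularSet _) (fun u hu => by
      rw [kernel_eq_cotDiff hu.1 hu.2]
      refine (hasDerivAt_sin_div_sin hu).congr_deriv ?_
      have : (Real.pi : ℂ) ≠ 0 := by simp [Real.pi_ne_zero]
      field_simp) (sin_div_sin_neg_pi_div_two _) hw
  rw [contourIntegral_const_mul] at this
  rw [barePhase, this]

lemma cotDiff_add_cotDiff (c : ℝ) (w : ℂ) :
    cotDiff c (w + I * c) + cotDiff c (w - I * c) = cotDiff (2 * c) w := by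
  simp only [cotDiff]
  push_cast
  ring_nf

lemma vertical_add (y h : ℝ) : (-(Real.pi / 2 : ℝ) + y * I + I * h : ℂ) =
    -(Real.pi / 2 : ℝ) + ((y + h : ℝ) : ℂ) * I := by
  push_cast; ring

lemma vertical_sub (y h : ℝ) : (-(Real.pi / 2 : ℝ) + y * I - I * h : ℂ) =
    -(Real.pi / 2 : ℝ) + ((y - h : ℝ) : ℂ) * I := by
  push_cast; ring

lemma vertical_even {T : ℂ → ℂ} (hneg : ∀ w, T (-w) = T w) (hper : ∀ w, T (w + Real.pi) = T w)
    (y : ℝ) : T (-(Real.pi / 2 : ℝ) + (-y : ℝ) * I) = T (-(Real.pi / 2 : ℝ) + y * I) := by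
  rw [← hneg, ← hper (-(Real.pi / 2 : ℝ) + y * I)]
  congr 1; push_cast; ring

/-- The bare phase as a sum of two shifted bare momenta. -/
theorem barePhase_eq {η : ℝ} {w : ℂ} (h0 : w ∈ slit (regularSet η))
    (h1 : w + I * (η / 2 : ℝ) ∈ slit (regularSet (η / 2)))
    (h2 : w - I * (η / 2 : ℝ) ∈ slit (regularSet (η / 2))) :
    barePhase η w =
      I * (bareMomentum η (w + I * (η / 2 : ℝ)) + bareMomentum η (w - I * (η / 2 : ℝ))) := by
  have key : ∀ u : ℂ, u ∈ regularSet η → u + I * (η / 2 : ℝ) ∈ regularSet (η / 2) →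
      u - I * (η / 2 : ℝ) ∈ regularSet (η / 2) →
      bareMomentumDeriv η (u + I * (η / 2 : ℝ)) + bareMomentumDeriv η (u - I * (η / 2 : ℝ)) =
        2 * Real.pi * kernel η u := by
    intro u hu0 hu1 hu2
    have hp : (2 * Real.pi : ℂ) ≠ 0 := by simp [Real.pi_ne_zero]
    rw [bareMomentumDeriv_eq_cotDiff (by simpa using hu1.1) (by simpa using hu1.2),
      bareMomentumDeriv_eq_cotDiff (by simpa using hu2.1) (by simpa using hu2.2),
      cotDiff_add_cotDiff, kernel_eq_cotDiff hu0.1 hu0.2, mul_div_cancel₀ _ hp,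
      mul_div_cancel₀ _ two_ne_zero]
  have := contourIntegral_add_shift (e := fun u => 2 * Real.pi * kernel η u)
    (differentiableOn_bareMomentumDeriv η) (vertical_mem_regularSet _)
    (vertical_even (bareMomentumDeriv_neg η) (bareMomentumDeriv_add_pi η)) h1 h2
    (fun y => key _ (vertical_mem_regularSet _ _)
      (by rw [vertical_add]; exact vertical_mem_regularSet _ _)
      (by rw [vertical_sub]; exact vertical_mem_regularSet _ _))
    (fun t ht => key _ (h0 t ht) (by
        have := h1 t (by simpa using ht)
        convert this using 1
        simp; ring) (by
        have := h2 t (by simpa using ht)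
        convert this using 1
        simp; ring))
  rw [bareMomentum, bareMomentum, this, contourIntegral_const_mul, barePhase]
  ring

/-! ### The bare momentum on the half planes -/

/-- An explicit primitive of the bare momentum density on `Im w > η/2`. -/
def upperLog (c : ℝ) (w : ℂ) : ℂ :=
  -I * (Complex.log (1 - Complex.exp (2 * I * (w - I * c))) -
    Complex.log (1 - Complex.exp (2 * I * (w + I * c))))

lemma norm_exp_two_I_lt_one {w : ℂ} (h : 0 < w.im) : ‖Complex.exp (2 * I * w)‖ < 1 := by
  rw [Complex.norm_exp, Real.exp_lt_one_iff]
  simp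
  linarith

lemma cot_eq_of_im_pos {w : ℂ} (h : 0 < w.im) :
    Complex.cot w = I - 2 * I / (1 - Complex.exp (2 * I * w)) := by
  have h1 := cot_sub_I (sin_ne_zero_of_im_ne_zero h.ne')
  rw [← neg_sub 1, div_neg] at h1
  linear_combination h1

lemma one_sub_exp_ne_zero {w : ℂ} (h : 0 < w.im) : 1 - Complex.exp (2 * I * w) ≠ 0 := by
  intro h0
  have := norm_exp_two_I_lt_one h
  rw [← sub_eq_zero.1 h0, norm_one] at this
  exact lt_irrefl _ this

lemma hasDerivAt_log_one_sub_exp {w a : ℂ} (h : 0 < (w + a).im) :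
    HasDerivAt (fun u => Complex.log (1 - Complex.exp (2 * I * (u + a))))
      (2 * I - 2 * I / (1 - Complex.exp (2 * I * (w + a)))) w := by
  have h1 : HasDerivAt (fun u => 1 - Complex.exp (2 * I * (u + a)))
      (-(Complex.exp (2 * I * (w + a)) * (2 * I * 1))) w :=
    ((((hasDerivAt_id w).add_const a).const_mul (2 * I)).cexp).const_sub 1
  have h2 : 1 - Complex.exp (2 * I * (w + a)) ∈ Complex.slitPlane := by
    rw [sub_eq_add_neg]
    exact Complex.mem_slitPlane_of_norm_lt_one (by rw [norm_neg]; exact norm_exp_two_I_lt_one h)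
  refine (h1.clog h2).congr_deriv ?_
  have := one_sub_exp_ne_zero h
  field_simp
  ring

lemma hasDerivAt_upperLog {c : ℝ} (hc : 0 < c) {w : ℂ} (h : c < w.im) :
    HasDerivAt (upperLog c) (cotDiff c w) w := by
  have e1 : 0 < (w + -(I * c)).im := by simp; linarith
  have e2 : 0 < (w + I * c).im := by simp; linarith
  have := ((hasDerivAt_log_one_sub_exp e1).sub (hasDerivAt_log_one_sub_exp e2)).const_mul (-I)
  rw [← sub_eq_add_neg] at e1 this
  refine (this.congr_deriv ?_)
  rw [cotDiff, cot_eq_of_im_pos e1, cot_eq_of_im_pos e2]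
  ring

lemma upperLog_add_pi (c : ℝ) (w : ℂ) : upperLog c (w + Real.pi) = upperLog c w := by
  simp only [upperLog]
  rw [show 2 * I * (w + Real.pi - I * c) = 2 * I * (w - I * c) + 2 * Real.pi * I by ring,
    show 2 * I * (w + Real.pi + I * c) = 2 * I * (w + I * c) + 2 * Real.pi * I by ring,
    Complex.exp_add, Complex.exp_add, Complex.exp_two_pi_mul_I, mul_one, mul_one]

lemma tendsto_exp_two_I_mul_add (a : ℂ) :
    Tendsto (fun w => Complex.exp (2 * I * (w + a))) (comap Complex.im atTop) (𝓝 0) := by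
  rw [tendsto_zero_iff_norm_tendsto_zero]
  have : (fun w : ℂ => ‖Complex.exp (2 * I * (w + a))‖) =
      (fun y : ℝ => Real.exp (-2 * (y + a.im))) ∘ Complex.im := by
    funext w
    simp [Complex.norm_exp]
  rw [this]
  refine Tendsto.comp ?_ tendsto_comap
  refine Real.tendsto_exp_atBot.comp ?_
  exact (tendsto_atTop_add_const_right _ _ tendsto_id).const_mul_atTop_of_neg (by norm_num)

lemma tendsto_upperLog (c : ℝ) : Tendsto (upperLog c) (comap Complex.im atTop) (𝓝 0) := by
  have h : ∀ a : ℂ, Tendsto (fun w => Complex.log (1 - Complex.exp (2 * I * (w + a))))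
      (comap Complex.im atTop) (𝓝 0) := by
    intro a
    have h1 : Tendsto (fun w => 1 - Complex.exp (2 * I * (w + a))) (comap Complex.im atTop)
        (𝓝 1) := by
      simpa using (tendsto_exp_two_I_mul_add a).const_sub 1
    have h2 := h1.clog Complex.one_mem_slitPlane
    rwa [Complex.log_one] at h2
  have := ((h (-(I * c))).sub (h (I * c))).const_mul (-I)
  simp only [← sub_eq_add_neg, sub_zero, mul_zero] at this
  exact this

/-- Both functions have the same derivative on a connected half plane. The logarithmic form exhibits
what the contour integral hides: above its poles the bare momentum is `π`-periodic and has a limit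
at `+i∞`. -/
lemma exists_bareMomentum_eq_upperLog {η : ℝ} (hη : 0 < η) :
    ∃ a : ℂ, ∀ w : ℂ, η / 2 < w.im → bareMomentum η w = a + upperLog (η / 2) w := by
  set S : Set ℂ := {w | η / 2 < w.im}
  have hS : IsOpen S := isOpen_lt continuous_const Complex.continuous_im
  have hSp : IsPreconnected S := (convex_halfSpace_im_gt _).isPreconnected
  have hη2 : 0 < η / 2 := half_pos hη
  have hd : ∀ w ∈ S, HasDerivAt (fun u => bareMomentum η u - upperLog (η / 2) u) 0 w := by
    intro w hw
    have hw' : |w.im| ≠ |η / 2| := by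
      rw [abs_of_pos hη2, abs_of_pos (hη2.trans hw)]
      exact (ne_of_gt hw)
    have := (hasDerivAt_bareMomentum (mem_slit_regularSet_of_im hw')).sub
      (hasDerivAt_upperLog hη2 hw)
    rw [bareMomentumDeriv_eq_of_im hw', sub_self] at this
    exact this
  refine ⟨bareMomentum η (I * η) - upperLog (η / 2) (I * η), fun w hw => ?_⟩
  have := hS.is_const_of_deriv_eq_zero hSp
    (fun u hu => (hd u hu).differentiableAt.differentiableWithinAt)
    (fun u hu => (hd u hu).deriv) (show w ∈ S from hw)
    (show I * η ∈ S by simp only [S, mem_ofPred_eq]; simp; linarith)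
  linear_combination this

lemma bareMomentum_add_pi_of_lt {η : ℝ} (hη : 0 < η) {w : ℂ} (hw : η / 2 < w.im) :
    bareMomentum η (w + Real.pi) = bareMomentum η w := by
  obtain ⟨a, ha⟩ := exists_bareMomentum_eq_upperLog hη
  rw [ha w hw, ha (w + Real.pi) (by simpa using hw), upperLog_add_pi]

lemma exists_tendsto_bareMomentum_atTop {η : ℝ} (hη : 0 < η) :
    ∃ a : ℂ, Tendsto (bareMomentum η) (comap Complex.im atTop) (𝓝 a) := by
  obtain ⟨a, ha⟩ := exists_bareMomentum_eq_upperLog hη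
  refine ⟨a, ?_⟩
  have := (tendsto_upperLog (η / 2)).const_add a
  rw [add_zero] at this
  refine this.congr' ?_
  filter_upwards [tendsto_comap.eventually (eventually_gt_atTop (η / 2))] with w hw
  exact (ha w hw).symm

lemma differentiableAt_bareMomentum_of_lt {η : ℝ} (hη : 0 < η) {w : ℂ} (hw : η / 2 < |w.im|) :
    DifferentiableAt ℂ (bareMomentum η) w :=
  (hasDerivAt_bareMomentum (mem_slit_regularSet_of_im
    (by rw [abs_of_pos (half_pos hη)]; exact hw.ne'))).differentiableAt

/-- Reflection `s ↦ W - s` turns the upper half plane into the lower one. -/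
lemma exists_lowerPeriodic_bareMomentum_sub {η : ℝ} (hη : 0 < η) {W : ℂ} (hW : η / 2 < W.im) :
    ∃ l, LowerPeriodic (fun s => bareMomentum η (W - s)) l := by
  obtain ⟨a, ha⟩ := exists_tendsto_bareMomentum_atTop hη
  refine ⟨a, ?_, ?_, ?_⟩
  · intro s hs
    have h1 : η / 2 < (W - s).im := by rw [Complex.sub_im]; linarith
    exact DifferentiableAt.comp (f := fun s => W - s) s
      (differentiableAt_bareMomentum_of_lt hη (h1.trans_le (le_abs_self _))) (by fun_prop)
  · intro s hs
    rw [← bareMomentum_add_pi_of_lt hη (w := W - (s + Real.pi)) (by simp; linarith)]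
    congr 1; ring
  · refine ha.comp ?_
    rw [tendsto_comap_iff]
    have : (Complex.im ∘ fun s : ℂ => W - s) = fun s => W.im + (-s.im) := by
      funext s; simp [sub_eq_add_neg]
    rw [this]
    exact tendsto_atTop_add_const_left _ _ (tendsto_neg_atBot_atTop.comp tendsto_comap)

/-- Complex conjugation commutes with the bare momentum and exchanges the half planes, so the
statement is inherited from the upper one. -/
lemma exists_lowerPeriodic_bareMomentum_add {η : ℝ} (hη : 0 < η) {W : ℂ} (hW : W.im < -(η / 2)) :
    ∃ l, LowerPeriodic (fun s => bareMomentum η (s + W)) l := by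
  obtain ⟨a, ha⟩ := exists_tendsto_bareMomentum_atTop hη
  have hconj : ∀ s, bareMomentum η s = starRingEnd ℂ (bareMomentum η (starRingEnd ℂ s)) := by
    intro s; rw [bareMomentum_conj, Complex.conj_conj]
  refine ⟨starRingEnd ℂ a, ?_, ?_, ?_⟩
  · intro s hs
    have h1 : (s + W).im < -(η / 2) := by rw [Complex.add_im]; linarith
    exact DifferentiableAt.comp (f := fun s => s + W) s
      (differentiableAt_bareMomentum_of_lt hη (by rw [abs_of_neg (by linarith)]; linarith))
      (by fun_prop)
  · intro s hs
    rw [hconj, hconj (s + W), ← bareMomentum_add_pi_of_lt hη (w := starRingEnd ℂ (s + W))]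
    · congr 2
      simp only [map_add, Complex.conj_ofReal]
      ring
    · simp; linarith
  · have : (fun s => bareMomentum η (s + W)) = fun s =>
        starRingEnd ℂ (bareMomentum η (starRingEnd ℂ (s + W))) := by
      funext s; exact hconj _
    rw [this]
    refine (Complex.continuous_conj.tendsto a).comp (ha.comp ?_)
    rw [tendsto_comap_iff]
    have : (Complex.im ∘ fun s : ℂ => starRingEnd ℂ (s + W)) = fun s => -W.im + (-s.im) := by
      funext s; simp; ring
    rw [this]
    exact tendsto_atTop_add_const_left _ _ (tendsto_neg_atBot_atTop.comp tendsto_comap)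

/-! ### Quasi-periodicity -/

lemma contourIntegral_add_pi {f : ℂ → ℂ} {A : Set ℂ} (hf : DifferentiableOn ℂ f A)
    (hper : ∀ u, f (u + Real.pi) = f u) {w : ℂ} (hw : ∀ t : ℝ, (t + w.im * I : ℂ) ∈ A) :
    contourIntegral f (w + Real.pi) = contourIntegral f w +
      ∫ t in (-(Real.pi / 2))..(Real.pi / 2), f (t + w.im * I) := by
  have hint : ∀ a b : ℝ, IntervalIntegrable (fun t : ℝ => f (t + w.im * I)) volume a b := fun a b =>
    intervalIntegrable_horizontal hf fun t _ => hw t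
  have hp : Function.Periodic (fun t : ℝ => f (t + w.im * I)) Real.pi := by
    intro t
    have := hper (t + w.im * I)
    simp only [← this]
    congr 1; push_cast; ring
  rw [contourIntegral, contourIntegral]
  have e1 : (w + Real.pi).im = w.im := by simp
  have e2 : (w + Real.pi).re = w.re + Real.pi := by simp
  rw [e1, e2, ← intervalIntegral.integral_add_adjacent_intervals (hint _ w.re) (hint _ _),
    hp.intervalIntegral_add_eq w.re (-(Real.pi / 2))]
  rw [show -(Real.pi / 2) + Real.pi = Real.pi / 2 by ring]
  ring

lemma integral_kernel_of_abs_lt {η : ℝ} {μ : ℂ} (h : |μ.im| < η) :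
    (∫ s in (-(Real.pi / 2))..(Real.pi / 2), kernel η ((s : ℝ) - μ)) = 1 := by
  simpa using (lowerPeriodic_const 1).integral_mul_kernel_of_abs_lt h

/-- Against mean `1` inside the strip, the mean is `0` outside. Hence `θ(· - z)` gains `2πi` per
period on the real line when `z` is not wide and is periodic when `z` is wide; this is what
distinguishes the two kinds of roots in all counting arguments. -/
lemma integral_kernel_of_lt_abs {η : ℝ} (hη : 0 < η) {μ : ℂ} (h : η < |μ.im|) :
    (∫ s in (-(Real.pi / 2))..(Real.pi / 2), kernel η ((s : ℝ) - μ)) = 0 := by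
  rcases lt_abs.1 h with h | h
  · simpa using (lowerPeriodic_const 1).integral_mul_kernel_of_lt hη h
  · simpa using (lowerPeriodic_const 1).integral_mul_kernel_of_lt_neg hη (μ := μ) (by linarith)

lemma barePhase_add_pi_of_abs_lt {η : ℝ} {w : ℂ} (h : |w.im| < η) :
    barePhase η (w + Real.pi) = barePhase η w + 2 * I * Real.pi := by
  have hη : 0 < η := (abs_nonneg _).trans_lt h
  rw [barePhase, barePhase, contourIntegral_add_pi (differentiableOn_kernel η) (kernel_add_pi η)
    (fun t => mem_regularSet_of_im (by simpa [abs_of_pos hη] using h.ne))]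
  have := integral_kernel_of_abs_lt (η := η) (μ := -(w.im * I)) (by simpa using h)
  simp only [sub_neg_eq_add] at this
  rw [this]; ring

lemma barePhase_add_pi_of_lt_abs {η : ℝ} (hη : 0 < η) {w : ℂ} (h : η < |w.im|) :
    barePhase η (w + Real.pi) = barePhase η w := by
  rw [barePhase, barePhase, contourIntegral_add_pi (differentiableOn_kernel η) (kernel_add_pi η)
    (fun t => mem_regularSet_of_im (by simpa [abs_of_pos hη] using h.ne'))]
  have := integral_kernel_of_lt_abs hη (μ := -(w.im * I)) (by simpa using h)
  simp only [sub_neg_eq_add] at this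
  rw [this]; ring

lemma bareMomentum_add_pi_of_abs_lt {η : ℝ} {w : ℂ} (h : |w.im| < η / 2) :
    bareMomentum η (w + Real.pi) = bareMomentum η w + 2 * Real.pi := by
  have hη : 0 < η / 2 := (abs_nonneg _).trans_lt h
  rw [bareMomentum, bareMomentum, contourIntegral_add_pi (differentiableOn_bareMomentumDeriv η)
    (bareMomentumDeriv_add_pi η)
    (fun t => mem_regularSet_of_im (by simpa [abs_of_pos hη] using h.ne))]
  have := (lowerPeriodic_const 1).integral_mul_cotDiff_of_abs_lt (c := η / 2)
    (μ := -(w.im * I)) (by simpa using h)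
  simp only [sub_neg_eq_add, one_mul, mul_one] at this
  rw [← this]
  congr 1
  refine intervalIntegral.integral_congr fun t _ => ?_
  exact bareMomentumDeriv_eq_of_im (by simpa [abs_of_pos hη] using h.ne)

/-! ### The dressed densities -/

/-- The `k`-th term of the alternating sum of shifted cotangents. -/
def altCotTerm (η : ℝ) (w : ℂ) (k : ℕ) : ℂ :=
  (-1) ^ k * (Complex.cot (w - I * (k * η : ℝ)) - I)

/-- The alternating sum of shifted cotangents. -/
def altCot (η : ℝ) (w : ℂ) : ℂ := ∑' k : ℕ, altCotTerm η w k

lemma altCotTerm_add (η : ℝ) (w : ℂ) (k n : ℕ) :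
    altCotTerm η w (k + n) = (-1) ^ n * altCotTerm η (w - I * (n * η : ℝ)) k := by
  simp only [altCotTerm]
  rw [show w - I * (((k + n : ℕ) : ℝ) * η : ℝ) = w - I * (n * η : ℝ) - I * (k * η : ℝ) by
    push_cast; ring]
  ring

lemma norm_altCotTerm_le {η : ℝ} (hη : 0 < η) {w : ℂ} (hw : w.im < 0) (k : ℕ) :
    ‖altCotTerm η w k‖ ≤ 2 / (Real.exp (-2 * w.im) - 1) * Real.exp (-2 * η) ^ k := by
  have hk : (0 : ℝ) ≤ k * η := by positivity
  have him : (w - I * (k * η : ℝ)).im = w.im - k * η := by simp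
  have h1 := norm_cot_sub_I_le (w := w - I * (k * η : ℝ)) (by rw [him]; linarith)
  rw [him] at h1
  rw [altCotTerm, norm_mul, norm_pow, norm_neg, norm_one, one_pow, one_mul]
  refine h1.trans ?_
  have h2 : (1 : ℝ) < Real.exp (-2 * w.im) := by rw [Real.one_lt_exp_iff]; linarith
  have h3 : (1 : ℝ) ≤ Real.exp (2 * η) ^ k := one_le_pow₀ (Real.one_le_exp (by linarith))
  have h4 : Real.exp (-2 * η) ^ k = (Real.exp (2 * η) ^ k)⁻¹ := by
    rw [← inv_pow, ← Real.exp_neg]; ring_nf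
  have h5 : Real.exp (-2 * (w.im - k * η)) = Real.exp (-2 * w.im) * Real.exp (2 * η) ^ k := by
    rw [← Real.exp_nat_mul, ← Real.exp_add]; ring_nf
  rw [h4, h5, ← div_eq_mul_inv, div_div]
  refine div_le_div_of_nonneg_left (by norm_num) (mul_pos (by linarith) (by linarith)) ?_
  nlinarith

lemma exp_neg_lt_one {η : ℝ} (hη : 0 < η) : Real.exp (-2 * η) < 1 := by
  rw [Real.exp_lt_one_iff]; linarith

lemma summable_altCot_of_neg {η : ℝ} (hη : 0 < η) {w : ℂ} (hw : w.im < 0) :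
    Summable (altCotTerm η w) :=
  Summable.of_norm_bounded
    ((summable_geometric_of_lt_one (Real.exp_pos _).le (exp_neg_lt_one hη)).mul_left _)
    (norm_altCotTerm_le hη hw)

lemma exists_nat_im_sub_neg {η : ℝ} (hη : 0 < η) (y : ℝ) : ∃ n : ℕ, y - n * η < 0 := by
  obtain ⟨n, hn⟩ := exists_nat_gt (y / η)
  exact ⟨n, by rw [div_lt_iff₀ hη] at hn; linarith⟩

/-- Dropping finitely many terms moves the argument below the real axis. At a pole `Complex.cot` has
the default value `0`, so neither this nor the functional equation `altCot_add_altCot` has to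
exclude poles. -/
lemma summable_altCot {η : ℝ} (hη : 0 < η) (w : ℂ) : Summable (altCotTerm η w) := by
  obtain ⟨n, hn⟩ := exists_nat_im_sub_neg hη w.im
  rw [← summable_nat_add_iff n]
  simp only [altCotTerm_add]
  exact (summable_altCot_of_neg hη (by simpa using hn)).mul_left _

lemma norm_altCot_le {η : ℝ} (hη : 0 < η) {w : ℂ} (hw : w.im < 0) :
    ‖altCot η w‖ ≤ 2 / (Real.exp (-2 * w.im) - 1) * (1 - Real.exp (-2 * η))⁻¹ :=
  tsum_of_norm_bounded
    ((hasSum_geometric_of_lt_one (Real.exp_pos _).le (exp_neg_lt_one hη)).mul_left _)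
    (norm_altCotTerm_le hη hw)

/-- The signs alternate, so the shift by `I * η` cancels every term but the first. Since `I + K`
acts as `f ↦ f + f(· - I * η)` on functions holomorphic below the axis, this equation inverts it. -/
lemma altCot_add_altCot {η : ℝ} (hη : 0 < η) (w : ℂ) :
    altCot η w + altCot η (w - I * η) = Complex.cot w - I := by
  rw [altCot, (summable_altCot hη w).tsum_eq_zero_add]
  have : ∀ k, altCotTerm η w (k + 1) = -altCotTerm η (w - I * η) k := by
    intro k; rw [altCotTerm_add]; simp
  simp only [this, tsum_neg]
  rw [altCot]
  simp [altCotTerm]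

lemma altCot_add_pi (η : ℝ) (w : ℂ) : altCot η (w + Real.pi) = altCot η w := by
  refine tsum_congr fun k => ?_
  simp only [altCotTerm]
  rw [show w + Real.pi - I * (k * η : ℝ) = w - I * (k * η : ℝ) + Real.pi by ring, cot_add_pi]

lemma differentiableAt_altCot_of_neg {η : ℝ} (hη : 0 < η) {w : ℂ} (hw : w.im < 0) :
    DifferentiableAt ℂ (altCot η) w := by
  set S : Set ℂ := {u | u.im < w.im / 2}
  have hS : IsOpen S := isOpen_lt Complex.continuous_im continuous_const
  have hwS : w ∈ S := by simp only [S, mem_ofPred_eq]; linarith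
  refine DifferentiableOn.differentiableAt (s := S) ?_ (hS.mem_nhds hwS)
  refine Complex.differentiableOn_tsum_of_summable_norm
    (u := fun k => 2 / (Real.exp (-2 * (w.im / 2)) - 1) * Real.exp (-2 * η) ^ k)
    ((summable_geometric_of_lt_one (Real.exp_pos _).le (exp_neg_lt_one hη)).mul_left _) ?_ hS ?_
  · intro k u hu
    have hu' : u.im < w.im / 2 := hu
    have hk : (0 : ℝ) ≤ k * η := by positivity
    have : Complex.sin (u - I * (k * η : ℝ)) ≠ 0 := sin_ne_zero_of_im_ne_zero (by
      have : (u - I * (k * η : ℝ)).im = u.im - k * η := by simp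
      rw [this]; linarith)
    refine (DifferentiableAt.const_mul (DifferentiableAt.sub_const ?_ _) _).differentiableWithinAt
    exact DifferentiableAt.comp (f := fun u : ℂ => u - I * (k * η : ℝ)) u (differentiableAt_cot this)
      (by fun_prop)
  · intro k u hu
    have hu' : u.im < w.im / 2 := hu
    refine (norm_altCotTerm_le hη (by linarith) k).trans ?_
    refine mul_le_mul_of_nonneg_right ?_ (by positivity)
    have h2 : (1 : ℝ) < Real.exp (-2 * (w.im / 2)) := by rw [Real.one_lt_exp_iff]; linarith
    refine div_le_div_of_nonneg_left (by norm_num) (by linarith) ?_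
    have : Real.exp (-2 * (w.im / 2)) ≤ Real.exp (-2 * u.im) := Real.exp_le_exp.2 (by linarith)
    linarith

/-- Below the axis the series converges locally uniformly; the functional equation then carries
differentiability upwards one strip of height `η` at a time, picking up one explicit cotangent each
time. -/
lemma differentiableAt_altCot {η : ℝ} (hη : 0 < η) {w : ℂ}
    (hw : ∀ k : ℕ, Complex.sin (w - I * (k * η : ℝ)) ≠ 0) : DifferentiableAt ℂ (altCot η) w := by
  obtain ⟨n, hn⟩ := exists_nat_im_sub_neg hη w.im
  induction n generalizing w with
  | zero => exact differentiableAt_altCot_of_neg hη (by simpa using hn)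
  | succ n ih =>
    have h1 : DifferentiableAt ℂ (altCot η) (w - I * η) := by
      refine ih (fun k => ?_) ?_
      · have := hw (k + 1)
        convert this using 2
        push_cast; ring
      · push_cast at hn
        simp
        linarith
    have e : altCot η = fun u => Complex.cot u - I - altCot η (u - I * η) := by
      funext u; rw [← altCot_add_altCot hη u]; ring
    rw [e]
    have h0 : Complex.sin w ≠ 0 := by simpa using hw 0
    refine ((differentiableAt_cot h0).sub_const _).sub ?_
    exact DifferentiableAt.comp (f := fun u : ℂ => u - I * η) w h1 (by fun_prop)

lemma lowerPeriodic_altCot {η : ℝ} (hη : 0 < η) {b : ℂ} (hb : b.im < 0) :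
    LowerPeriodic (fun s => altCot η (s + b)) 0 where
  diff s hs := DifferentiableAt.comp (f := fun s : ℂ => s + b) s
    (differentiableAt_altCot_of_neg hη (by rw [Complex.add_im]; linarith)) (by fun_prop)
  per s _ := by rw [show s + Real.pi + b = s + b + Real.pi by ring, altCot_add_pi]
  lim := by
    have h0 : Tendsto (altCot η) (comap Complex.im atBot) (𝓝 0) := by
      rw [tendsto_zero_iff_norm_tendsto_zero]
      have h := (tendsto_two_div_exp_sub_one.comp (tendsto_comap (f := Complex.im))).mul_const
        (1 - Real.exp (-2 * η))⁻¹
      rw [zero_mul] at h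
      refine squeeze_zero' (Eventually.of_forall fun _ => norm_nonneg _) ?_ h
      filter_upwards [tendsto_comap.eventually (eventually_lt_atBot (0 : ℝ))] with w hw
      exact norm_altCot_le hη hw
    have := h0.comp (tendsto_im_sub (-b))
    simpa [Function.comp_def] using this

/-! ### The dressed density: its poles, its functional equation, its integral equation -/

/-- The solution of `f + K f = cotDiff c` on the circle, for `c > 0`. -/
def dressedDensity (η c : ℝ) (w : ℂ) : ℂ :=
  1 - I * (altCot η (w - I * c) + altCot η (-w - I * c))

/-- The complement of the poles of `dressedDensity`. -/
def dressedRegularSet (η c : ℝ) : Set ℂ :=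
  {w | ∀ k : ℕ, w ∈ regularSet (c + k * η)}

lemma dressedDensity_neg (η c : ℝ) (w : ℂ) : dressedDensity η c (-w) = dressedDensity η c w := by
  simp only [dressedDensity, neg_neg]
  ring

lemma dressedDensity_add_pi (η c : ℝ) (w : ℂ) :
    dressedDensity η c (w + Real.pi) = dressedDensity η c w := by
  simp only [dressedDensity]
  rw [show w + Real.pi - I * c = w - I * c + Real.pi by ring, altCot_add_pi,
    ← altCot_add_pi η (-(w + Real.pi) - I * c)]
  congr 4
  ring

lemma vertical_mem_dressedRegularSet (η c y : ℝ) :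
    (-(Real.pi / 2 : ℝ) + y * I : ℂ) ∈ dressedRegularSet η c :=
  fun _ => vertical_mem_regularSet _ _

lemma differentiableOn_dressedDensity {η : ℝ} (hη : 0 < η) (c : ℝ) :
    DifferentiableOn ℂ (dressedDensity η c) (dressedRegularSet η c) := by
  intro w hw
  refine DifferentiableAt.differentiableWithinAt ?_
  have h1 : DifferentiableAt ℂ (altCot η) (w - I * c) := differentiableAt_altCot hη fun k => by
    have := (hw k).2
    convert this using 2
    push_cast; ring
  have h2 : DifferentiableAt ℂ (altCot η) (-w - I * c) := differentiableAt_altCot hη fun k => by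
    have := (hw k).1
    rw [← neg_ne_zero, ← Complex.sin_neg] at this
    convert this using 2
    push_cast; ring
  refine DifferentiableAt.const_sub (DifferentiableAt.const_mul (DifferentiableAt.add ?_ ?_) _) _
  · exact DifferentiableAt.comp (f := fun u : ℂ => u - I * c) w h1 (by fun_prop)
  · exact DifferentiableAt.comp (f := fun u : ℂ => -u - I * c) w h2 (by fun_prop)

lemma mem_dressedRegularSet_of_abs_lt {η c : ℝ} (hη : 0 < η) {w : ℂ} (hw : |w.im| < c) :
    w ∈ dressedRegularSet η c := by
  intro k
  refine mem_regularSet_of_im (ne_of_lt ?_)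
  refine lt_of_lt_of_le hw ((le_abs_self _).trans' ?_)
  have : (0 : ℝ) ≤ k * η := by positivity
  linarith

/-- There are infinitely many conditions, but the poles recede to infinite height, so near a given
point only finitely many of them can fail. -/
lemma isOpen_dressedRegularSet {η : ℝ} (hη : 0 < η) (c : ℝ) :
    IsOpen (dressedRegularSet η c) := by
  rw [isOpen_iff_mem_nhds]
  intro w hw
  obtain ⟨n, hn⟩ := exists_nat_im_sub_neg hη (|w.im| + 1 + |c|)
  have h1 : {u : ℂ | |u.im| < |w.im| + 1} ∈ 𝓝 w :=
    (isOpen_lt (continuous_abs.comp Complex.continuous_im) continuous_const).mem_nhds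
      (by simp)
  have h2 : ∀ k ∈ Finset.range n, regularSet (c + k * η) ∈ 𝓝 w := fun k _ =>
    (isOpen_regularSet _).mem_nhds (hw k)
  filter_upwards [h1, (Filter.biInter_finset_mem (Finset.range n)).2 h2] with u hu1 hu2 k
  by_cases hk : k < n
  · exact mem_iInter₂.1 hu2 k (Finset.mem_range.2 hk)
  · refine mem_regularSet_of_im (ne_of_lt ?_)
    have hkn : (n : ℝ) * η ≤ k * η := by
      have : (n : ℝ) ≤ k := by exact_mod_cast not_lt.1 hk
      gcongr
    have hu1' : |u.im| < |w.im| + 1 := hu1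
    have := neg_abs_le c
    exact lt_of_lt_of_le (by linarith) (le_abs_self (c + k * η))

/-- The two relevant cases are `c = η / 2`, where the right-hand side vanishes, and `c = η`, where
it is the bare momentum density. They yield the functional equations of the momentum and of the
phase of a non-wide root. -/
lemma dressedDensity_shift {η : ℝ} (hη : 0 < η) (c : ℝ) (w : ℂ) :
    dressedDensity η c (w + I * (η / 2 : ℝ)) + dressedDensity η c (w - I * (η / 2 : ℝ)) =
      cotDiff (c - η / 2) w := by
  have h1 := altCot_add_altCot hη (w + I * (η / 2 : ℝ) - I * c)
  have h2 := altCot_add_altCot hη (-w + I * (η / 2 : ℝ) - I * c)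
  have e1 : w + I * (η / 2 : ℝ) - I * c - I * η = w - I * (η / 2 : ℝ) - I * c := by
    push_cast; ring
  have e2 : -w + I * (η / 2 : ℝ) - I * c - I * η = -(w + I * (η / 2 : ℝ)) - I * c := by
    push_cast; ring
  have e3 : -w + I * (η / 2 : ℝ) - I * c = -(w - I * (η / 2 : ℝ)) - I * c := by ring
  have e4 : Complex.cot (-w + I * (η / 2 : ℝ) - I * c) =
      -Complex.cot (w + I * ((c - η / 2 : ℝ) : ℂ)) := by
    rw [← cot_neg]; congr 1; push_cast; ring
  have e5 : w + I * (η / 2 : ℝ) - I * c = w - I * ((c - η / 2 : ℝ) : ℂ) := by push_cast; ring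
  rw [e4, e2, e3] at h2
  rw [e1] at h1
  have e6 : Complex.cot (w + I * (η / 2 : ℝ) - I * c) = Complex.cot (w - I * ((c - η / 2 : ℝ) : ℂ)) := by
    rw [e5]
  rw [e6] at h1
  simp only [dressedDensity, cotDiff]
  linear_combination -I * h1 - I * h2 + 2 * Complex.I_mul_I

/-- The alternating sums tend to `0` at `-i∞` and so have mean zero; only the constant `1`
contributes. -/
lemma integral_dressedDensity {η c : ℝ} (hη : 0 < η) {z : ℂ} (hz : |z.im| < c) :
    (∫ s in (-(Real.pi / 2))..(Real.pi / 2), dressedDensity η c ((s : ℝ) - z)) = Real.pi := by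
  obtain ⟨hz1, hz2⟩ := abs_lt.1 hz
  have f1 := lowerPeriodic_altCot hη (b := -z - I * c) (by simp; linarith)
  have f2 := lowerPeriodic_altCot hη (b := z - I * c) (by simp; linarith)
  have e2 := f2.integral_eq
  rw [← integral_comp_neg_symm (fun s : ℝ => altCot η (s + (z - I * c)))] at e2
  have c2 : Continuous fun s : ℝ => altCot η ((-s : ℝ) + (z - I * c)) :=
    f2.continuous_ofReal.comp continuous_neg
  have : ∀ s : ℝ, dressedDensity η c ((s : ℝ) - z) =
      1 - I * (altCot η (s + (-z - I * c)) + altCot η ((-s : ℝ) + (z - I * c))) := by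
    intro s
    simp only [dressedDensity]
    congr 4 <;> push_cast <;> ring
  simp only [this]
  have c1 := f1.continuous_ofReal
  rw [intervalIntegral.integral_sub intervalIntegrable_const
    (Continuous.intervalIntegrable (by fun_prop) _ _),
    intervalIntegral.integral_const_mul, intervalIntegral.integral_add
    (c1.intervalIntegrable _ _) (c2.intervalIntegrable _ _), f1.integral_eq, e2,
    intervalIntegral.integral_const, Complex.real_smul]
  push_cast; ring

lemma continuous_kernel_sub {η : ℝ} {x : ℂ} (hx : |x.im| ≠ |η|) :
    Continuous fun s : ℝ => kernel η (x - s) := by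
  rw [continuous_iff_continuousAt]
  intro s
  have := mem_regularSet_of_im (c := η) (w := x - s) (by simpa using hx)
  exact ContinuousAt.comp (f := fun s : ℝ => x - s)
    (differentiableAt_kernel this.1 this.2).continuousAt (by fun_prop)

/-- The kernel is applied to three pieces. The constant is fixed; the alternating sum in `s - z - I
* c` is holomorphic below the axis and is shifted by `-I * η`; the reflected sum is treated likewise
after `s ↦ -s`. Adding the unshifted pieces collapses each alternating sum to one cotangent. -/
theorem dressedDensity_add_integral {η c : ℝ} (hη : 0 < η) {x z : ℂ} (hx : |x.im| < η)
    (hz : |z.im| < c) :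
    dressedDensity η c (x - z) +
      (∫ s in (-(Real.pi / 2))..(Real.pi / 2), kernel η (x - s) * dressedDensity η c ((s : ℝ) - z)) =
      cotDiff c (x - z) := by
  obtain ⟨hz1, hz2⟩ := abs_lt.1 hz
  have hx' : |x.im| ≠ |η| := by rw [abs_of_pos hη]; exact hx.ne
  have f1 := lowerPeriodic_altCot hη (b := -z - I * c) (by simp; linarith)
  have f2 := lowerPeriodic_altCot hη (b := z - I * c) (by simp; linarith)
  have i0 := (lowerPeriodic_const 1).integral_mul_kernel_of_abs_lt hx
  have i1 := f1.integral_mul_kernel_of_abs_lt hx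
  have i2 := f2.integral_mul_kernel_of_abs_lt (η := η) (μ := -x) (by simpa using hx)
  rw [← integral_comp_neg_symm] at i2
  have hk := continuous_kernel_sub hx'
  have c2 : Continuous fun s : ℝ => altCot η ((-s : ℝ) + (z - I * c)) :=
    f2.continuous_ofReal.comp continuous_neg
  have : ∀ s : ℝ, kernel η (x - s) * dressedDensity η c ((s : ℝ) - z) =
      1 * kernel η (x - s) - I * (altCot η (s + (-z - I * c)) * kernel η (x - s) +
        altCot η ((-s : ℝ) + (z - I * c)) * kernel η (x - s)) := by
    intro s
    simp only [dressedDensity]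
    rw [show (s : ℂ) - z - I * c = s + (-z - I * c) by ring,
      show -((s : ℂ) - z) - I * c = ((-s : ℝ) : ℂ) + (z - I * c) by push_cast; ring]
    ring
  simp only [this]
  have k1 : ∀ s : ℝ, kernel η (x - s) = kernel η (s - x) := fun s => by
    rw [← kernel_neg]; congr 1; ring
  have k2 : ∀ s : ℝ, kernel η (x - s) = kernel η (((-s : ℝ) : ℂ) - -x) := fun s => by
    congr 1; push_cast; ring
  have c1 := f1.continuous_ofReal
  rw [intervalIntegral.integral_sub (Continuous.intervalIntegrable (by fun_prop) _ _)
    (Continuous.intervalIntegrable (by fun_prop) _ _),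
    intervalIntegral.integral_const_mul (r := I), intervalIntegral.integral_add
    (Continuous.intervalIntegrable (by fun_prop) _ _)
    (Continuous.intervalIntegrable (by fun_prop) _ _)]
  have j0 : (∫ s in (-(Real.pi / 2))..(Real.pi / 2), 1 * kernel η (x - s)) = 1 :=
    (intervalIntegral.integral_congr fun s _ => by simp only [k1]).trans i0
  have j1 : (∫ s in (-(Real.pi / 2))..(Real.pi / 2),
      altCot η ((s : ℝ) + (-z - I * c)) * kernel η (x - s)) = altCot η (x - I * η + (-z - I * c)) := by
    rw [← i1]; exact intervalIntegral.integral_congr fun s _ => by simp only [k1]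
  have j2 : (∫ s in (-(Real.pi / 2))..(Real.pi / 2),
      altCot η ((-s : ℝ) + (z - I * c)) * kernel η (x - s)) =
      altCot η (-x - I * η + (z - I * c)) := by
    rw [← i2]; exact intervalIntegral.integral_congr fun s _ => by simp only [k2]
  rw [j0, j1, j2]
  have r1 := altCot_add_altCot hη (x - z - I * c)
  have r2 := altCot_add_altCot hη (-(x - z) - I * c)
  have e1 : x - z - I * c - I * η = x - I * η + (-z - I * c) := by ring
  have e2 : -(x - z) - I * c - I * η = -x - I * η + (z - I * c) := by ring
  have e3 : Complex.cot (-(x - z) - I * c) = -Complex.cot (x - z + I * c) := by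
    rw [← cot_neg]; congr 1; ring
  rw [e1] at r1
  rw [e2, e3] at r2
  simp only [dressedDensity, cotDiff]
  linear_combination -I * r1 - I * r2 + 2 * Complex.I_mul_I

/-! ### Stability of the linear integral equation -/

/-- The kernel on the real line. -/
def realKernel (η x : ℝ) : ℝ :=
  Real.sinh (2 * η) / (2 * Real.pi * (Real.sin x ^ 2 + Real.sinh η ^ 2))

lemma kernel_ofReal (η x : ℝ) : kernel η (x : ℂ) = (realKernel η x : ℝ) := by
  have e : Complex.sin (x + I * η) * Complex.sin (x - I * η) =
      Complex.sin x ^ 2 + Complex.sinh η ^ 2 := by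
    rw [Complex.sin_add, Complex.sin_sub, mul_comm I, Complex.sin_mul_I, Complex.cos_mul_I]
    have h1 := Complex.cosh_sq (η : ℂ)
    have h2 := Complex.sin_sq_add_cos_sq (x : ℂ)
    linear_combination Complex.sin x ^ 2 * h1 + Complex.sinh η ^ 2 * h2 -
      (Complex.cos x ^ 2 * Complex.sinh η ^ 2) * Complex.I_sq
  rw [kernel, realKernel, mul_assoc, e]
  push_cast
  rfl

/-- The minimum of the kernel on the real line. -/
def kernelMin (η : ℝ) : ℝ := Real.sinh (2 * η) / (2 * Real.pi * Real.cosh η ^ 2)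

lemma kernelMin_pos {η : ℝ} (hη : 0 < η) : 0 < kernelMin η := by
  have := Real.sinh_pos_iff.2 (show 0 < 2 * η by linarith)
  have := Real.cosh_pos η
  have := Real.pi_pos
  unfold kernelMin
  positivity

lemma kernelMin_le {η : ℝ} (hη : 0 < η) (x : ℝ) : kernelMin η ≤ realKernel η x := by
  have h1 := Real.sinh_pos_iff.2 (show 0 < 2 * η by linarith)
  have h2 := Real.sinh_pos_iff.2 hη
  have hp := Real.pi_pos
  unfold kernelMin realKernel
  refine div_le_div_of_nonneg_left h1.le (by positivity) ?_
  have h3 := Real.cosh_sq η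
  have h4 := Real.sin_sq_le_one x
  have : Real.sin x ^ 2 + Real.sinh η ^ 2 ≤ Real.cosh η ^ 2 := by linarith
  gcongr

lemma continuous_realKernel {η : ℝ} (hη : 0 < η) : Continuous (realKernel η) := by
  have h2 := Real.sinh_pos_iff.2 hη
  have hp := Real.pi_pos
  unfold realKernel
  refine Continuous.div continuous_const (by fun_prop) fun x => ?_
  positivity

lemma integral_realKernel {η : ℝ} (hη : 0 < η) (x : ℝ) :
    (∫ s in (-(Real.pi / 2))..(Real.pi / 2), realKernel η (x - s)) = 1 := by
  have := integral_kernel_of_abs_lt (η := η) (μ := x) (by simpa using hη)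
  have h2 : (∫ s in (-(Real.pi / 2))..(Real.pi / 2), ((realKernel η (x - s) : ℝ) : ℂ)) = 1 := by
    rw [← this]
    refine intervalIntegral.integral_congr fun s _ => ?_
    rw [← kernel_ofReal, ← kernel_neg]
    congr 1
    push_cast; ring
  rw [intervalIntegral.integral_ofReal] at h2
  exact_mod_cast h2

lemma integral_realKernel' {η : ℝ} (hη : 0 < η) (s : ℝ) :
    (∫ x in (-(Real.pi / 2))..(Real.pi / 2), realKernel η (x - s)) = 1 := by
  rw [← integral_realKernel hη s]
  refine intervalIntegral.integral_congr fun x _ => ?_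
  simp only [realKernel]
  rw [show x - s = -(s - x) by ring, Real.sin_neg, neg_sq]

lemma kernelOp_ofReal (η : ℝ) (f : ℝ → ℂ) (x : ℝ) : kernelOp η f (x : ℂ) =
    ∫ s in (-(Real.pi / 2))..(Real.pi / 2), (realKernel η (x - s) : ℂ) * f s := by
  refine intervalIntegral.integral_congr fun s _ => ?_
  rw [← kernel_ofReal]
  push_cast; rfl

lemma neg_pi_le_pi : -(Real.pi / 2) ≤ Real.pi / 2 := by linarith [Real.pi_pos]

/-- The kernel has mass one in each variable, so `K` preserves the mean. A bound on `f + K f`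
therefore bounds the mean of `f` at once. -/
lemma integral_add_kernelOp {η : ℝ} (hη : 0 < η) {f : ℝ → ℂ} (hf : Continuous f) :
    (∫ x in (-(Real.pi / 2))..(Real.pi / 2), (f x + kernelOp η f (x : ℝ))) =
      2 * ∫ x in (-(Real.pi / 2))..(Real.pi / 2), f x := by
  have hk := continuous_realKernel hη
  have hc : Continuous fun p : ℝ × ℝ => (realKernel η (p.1 - p.2) : ℂ) * f p.2 := by fun_prop
  simp only [kernelOp_ofReal]
  have hint : (∫ x in (-(Real.pi / 2))..(Real.pi / 2),
      ∫ s in (-(Real.pi / 2))..(Real.pi / 2), (realKernel η (x - s) : ℂ) * f s) =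
      ∫ s in (-(Real.pi / 2))..(Real.pi / 2), f s := by
    rw [intervalIntegral_intervalIntegral_swap]
    · refine intervalIntegral.integral_congr fun s _ => ?_
      rw [intervalIntegral.integral_mul_const, intervalIntegral.integral_ofReal,
        integral_realKernel' hη, Complex.ofReal_one, one_mul]
    · refine IntegrableOn.mono_set
        (hc.continuousOn.integrableOn_compact (K := Icc (-(Real.pi / 2)) (Real.pi / 2) ×ˢ
          Icc (-(Real.pi / 2)) (Real.pi / 2)) (isCompact_Icc.prod isCompact_Icc)) ?_
      rw [uIoc_of_le neg_pi_le_pi]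
      exact prod_mono Ioc_subset_Icc_self Ioc_subset_Icc_self
  rw [intervalIntegral.integral_add (hf.intervalIntegrable _ _), hint]
  · ring
  · exact (intervalIntegral.continuous_parametric_intervalIntegral_of_continuous'
      (f := fun x s : ℝ => (realKernel η (x - s) : ℂ) * f s) hc _ _).intervalIntegrable _ _

/-- The constant in the stability estimate for `I + K`. -/
def stabilityConst (η : ℝ) : ℝ := (1 + kernelMin η * Real.pi) / (kernelMin η * Real.pi)

lemma stabilityConst_pos {η : ℝ} (hη : 0 < η) : 0 < stabilityConst η := by
  have := kernelMin_pos hη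
  have := Real.pi_pos
  unfold stabilityConst; positivity

/-- `K` has norm one in the supremum norm (constants are fixed), so a Neumann series is not
available. Instead the constant `kernelMin η` is split off the kernel: the remainder is nonnegative
of mass `1 - kernelMin η * π < 1`, and the constant part sees only the mean of `f`, controlled by
`integral_add_kernelOp`. The inequality is evaluated at a maximum of `‖f‖`. -/
lemma norm_le_of_norm_add_kernelOp_le_aux {η : ℝ} (hη : 0 < η) {f : ℝ → ℂ} (hf : Continuous f)
    {ε : ℝ} (h : ∀ x ∈ Icc (-(Real.pi / 2)) (Real.pi / 2), ‖f x + kernelOp η f (x : ℝ)‖ ≤ ε) :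
    ∀ x ∈ Icc (-(Real.pi / 2)) (Real.pi / 2), ‖f x‖ ≤ stabilityConst η * ε := by
  have hp := Real.pi_pos
  have hc := kernelMin_pos hη
  have hk := continuous_realKernel hη
  obtain ⟨x₀, hx₀, hmax⟩ := isCompact_Icc.exists_isMaxOn (nonempty_Icc.2 neg_pi_le_pi)
    hf.norm.continuousOn
  have hmax' : ∀ x ∈ Icc (-(Real.pi / 2)) (Real.pi / 2), ‖f x‖ ≤ ‖f x₀‖ := fun x hx => hmax hx
  have h1 : ‖∫ x in (-(Real.pi / 2))..(Real.pi / 2), f x‖ ≤ ε * Real.pi / 2 := by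
    have := intervalIntegral.norm_integral_le_of_norm_le_const (a := -(Real.pi / 2))
      (b := Real.pi / 2) (f := fun x : ℝ => f x + kernelOp η f (x : ℝ)) (C := ε) (fun x hx => by
        rw [uIoc_of_le neg_pi_le_pi] at hx
        exact h x (Ioc_subset_Icc_self hx))
    rw [integral_add_kernelOp hη hf, norm_mul, Complex.norm_ofNat,
      show Real.pi / 2 - -(Real.pi / 2) = Real.pi by ring, abs_of_pos hp] at this
    linarith
  have h2 : ‖∫ s in (-(Real.pi / 2))..(Real.pi / 2),
      ((realKernel η (x₀ - s) - kernelMin η : ℝ) : ℂ) * f s‖ ≤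
      (1 - kernelMin η * Real.pi) * ‖f x₀‖ := by
    have e : (∫ s in (-(Real.pi / 2))..(Real.pi / 2),
        (realKernel η (x₀ - s) - kernelMin η) * ‖f x₀‖) = (1 - kernelMin η * Real.pi) * ‖f x₀‖ := by
      rw [intervalIntegral.integral_mul_const, intervalIntegral.integral_sub
        (Continuous.intervalIntegrable (by fun_prop) _ _) intervalIntegrable_const,
        integral_realKernel hη, intervalIntegral.integral_const, smul_eq_mul]
      ring
    rw [← e]
    refine intervalIntegral.norm_integral_le_of_norm_le neg_pi_le_pi ?_
      (Continuous.intervalIntegrable (by fun_prop) _ _)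
    refine Eventually.of_forall fun s hs => ?_
    have h3 := kernelMin_le hη (x₀ - s)
    rw [norm_mul, Complex.norm_real, Real.norm_of_nonneg (by linarith)]
    exact mul_le_mul_of_nonneg_left (hmax' s (Ioc_subset_Icc_self hs)) (by linarith)
  have h3 : f x₀ = (f x₀ + kernelOp η f (x₀ : ℝ)) -
      (∫ s in (-(Real.pi / 2))..(Real.pi / 2),
        ((realKernel η (x₀ - s) - kernelMin η : ℝ) : ℂ) * f s) -
      kernelMin η * ∫ x in (-(Real.pi / 2))..(Real.pi / 2), f x := by
    rw [kernelOp_ofReal, ← intervalIntegral.integral_const_mul, sub_sub,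
      ← intervalIntegral.integral_add (Continuous.intervalIntegrable (by fun_prop) _ _)
      (Continuous.intervalIntegrable (by fun_prop) _ _), eq_comm, add_sub_assoc, add_eq_left,
      sub_eq_zero]
    refine intervalIntegral.integral_congr fun s _ => ?_
    push_cast; ring
  have h4 : ‖f x₀‖ ≤ ε + (1 - kernelMin η * Real.pi) * ‖f x₀‖ +
      kernelMin η * (ε * Real.pi / 2) := by
    conv_lhs => rw [h3]
    refine (norm_sub_le _ _).trans (add_le_add ((norm_sub_le _ _).trans
      (add_le_add (h x₀ hx₀) h2)) ?_)
    rw [norm_mul, Complex.norm_real, Real.norm_of_nonneg hc.le]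
    exact mul_le_mul_of_nonneg_left h1 hc.le
  have hε : 0 ≤ ε := (norm_nonneg _).trans (h x₀ hx₀)
  intro x hx
  refine (hmax' x hx).trans ?_
  have hcp : 0 < kernelMin η * Real.pi := mul_pos hc hp
  rw [stabilityConst, div_mul_eq_mul_div, le_div_iff₀ hcp]
  -- `h4` gives `1 + kernelMin η * π / 2` in the numerator; `stabilityConst` rounds it up.
  nlinarith [mul_nonneg hcp.le hε]

lemma kernelOp_congr {η : ℝ} {f g : ℝ → ℂ}
    (h : ∀ x ∈ Icc (-(Real.pi / 2)) (Real.pi / 2), f x = g x) (w : ℂ) :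
    kernelOp η f w = kernelOp η g w := by
  refine intervalIntegral.integral_congr fun s hs => ?_
  rw [uIcc_of_le neg_pi_le_pi] at hs
  rw [h s hs]

theorem norm_le_of_norm_add_kernelOp_le {η : ℝ} (hη : 0 < η) {f : ℝ → ℂ}
    (hf : ContinuousOn f (Icc (-(Real.pi / 2)) (Real.pi / 2)))
    {ε : ℝ} (h : ∀ x ∈ Icc (-(Real.pi / 2)) (Real.pi / 2), ‖f x + kernelOp η f (x : ℝ)‖ ≤ ε) :
    ∀ x ∈ Icc (-(Real.pi / 2)) (Real.pi / 2), ‖f x‖ ≤ stabilityConst η * ε := by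
  set g := IccExtend neg_pi_le_pi ((Icc (-(Real.pi / 2)) (Real.pi / 2)).domRestrict f) with hg
  have hgc : Continuous g := continuous_IccExtend_iff.2 (continuousOn_iff_continuous_domRestrict.1 hf)
  have hgf : ∀ x ∈ Icc (-(Real.pi / 2)) (Real.pi / 2), f x = g x := fun x hx => by
    rw [hg, IccExtend_of_mem _ _ hx]; rfl
  intro x hx
  rw [hgf x hx]
  refine norm_le_of_norm_add_kernelOp_le_aux hη hgc (fun y hy => ?_) x hx
  rw [← hgf y hy, ← kernelOp_congr hgf]
  exact h y hy

/-! ### Linearity of `K` and uniqueness for `I + K` -/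

lemma continuousOn_kernel_sub {η : ℝ} {w : ℂ} (hw : |w.im| < η) (S : Set ℝ) :
    ContinuousOn (fun s : ℝ => kernel η (w - s)) S :=
  (continuous_kernel_sub (by
    rw [abs_of_pos ((abs_nonneg _).trans_lt hw)]; exact hw.ne)).continuousOn

lemma kernelOp_integrable {η : ℝ} {f : ℝ → ℂ}
    (hf : ContinuousOn f (Icc (-(Real.pi / 2)) (Real.pi / 2))) {w : ℂ} (hw : |w.im| < η) :
    IntervalIntegrable (fun s => kernel η (w - s) * f s) volume (-(Real.pi / 2)) (Real.pi / 2) := by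
  apply ContinuousOn.intervalIntegrable
  rw [uIcc_of_le neg_pi_le_pi]
  exact (continuousOn_kernel_sub hw _).mul hf

lemma kernelOp_sub {η : ℝ} {f g : ℝ → ℂ}
    (hf : ContinuousOn f (Icc (-(Real.pi / 2)) (Real.pi / 2)))
    (hg : ContinuousOn g (Icc (-(Real.pi / 2)) (Real.pi / 2))) {w : ℂ} (hw : |w.im| < η) :
    kernelOp η (fun s => f s - g s) w = kernelOp η f w - kernelOp η g w := by
  simp only [kernelOp, mul_sub]
  exact intervalIntegral.integral_sub (kernelOp_integrable hf hw) (kernelOp_integrable hg hw)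

lemma kernelOp_add {η : ℝ} {f g : ℝ → ℂ}
    (hf : ContinuousOn f (Icc (-(Real.pi / 2)) (Real.pi / 2)))
    (hg : ContinuousOn g (Icc (-(Real.pi / 2)) (Real.pi / 2))) {w : ℂ} (hw : |w.im| < η) :
    kernelOp η (fun s => f s + g s) w = kernelOp η f w + kernelOp η g w := by
  simp only [kernelOp, mul_add]
  exact intervalIntegral.integral_add (kernelOp_integrable hf hw) (kernelOp_integrable hg hw)

lemma kernelOp_const_mul (η : ℝ) (a : ℂ) (f : ℝ → ℂ) (w : ℂ) :
    kernelOp η (fun s => a * f s) w = a * kernelOp η f w := by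
  simp only [kernelOp, mul_left_comm _ a, intervalIntegral.integral_const_mul]

lemma kernelOp_const {η : ℝ} (a : ℂ) {w : ℂ} (hw : |w.im| < η) :
    kernelOp η (fun _ => a) w = a := by
  have h := integral_kernel_of_abs_lt hw
  rw [kernelOp, intervalIntegral.integral_mul_const]
  have : (∫ s in (-(Real.pi / 2))..(Real.pi / 2), kernel η (w - s)) = 1 := by
    rw [← h]
    refine intervalIntegral.integral_congr fun s _ => ?_
    rw [← kernel_neg]; congr 1; ring
  rw [this, one_mul]

/-- Uniqueness for `(I + K) f = g`. -/
lemma eq_of_add_kernelOp_eq {η : ℝ} (hη : 0 < η) {f g : ℝ → ℂ}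
    (hf : ContinuousOn f (Icc (-(Real.pi / 2)) (Real.pi / 2)))
    (hg : ContinuousOn g (Icc (-(Real.pi / 2)) (Real.pi / 2)))
    (h : ∀ x ∈ Icc (-(Real.pi / 2)) (Real.pi / 2),
      f x + kernelOp η f (x : ℝ) = g x + kernelOp η g (x : ℝ)) :
    ∀ x ∈ Icc (-(Real.pi / 2)) (Real.pi / 2), f x = g x := by
  intro x hx
  have := norm_le_of_norm_add_kernelOp_le hη (f := fun s => f s - g s) (hf.sub hg) (ε := 0)
    (fun y hy => by
      rw [kernelOp_sub hf hg (by simpa using hη)]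
      have := h y hy
      rw [show f y - g y + (kernelOp η f y - kernelOp η g y) =
        (f y + kernelOp η f y) - (g y + kernelOp η g y) by ring, this, sub_self, norm_zero]) x hx
  rw [mul_zero] at this
  exact sub_eq_zero.1 (norm_le_zero_iff.1 this)

/-! ### Parametric integrals -/

lemma hasDerivAt_integral_sub {F F' : ℂ → ℂ} {f : ℝ → ℂ} {S : Set ℂ} (hS : IsOpen S)
    (hF : ∀ u ∈ S, HasDerivAt F (F' u) u) (hF' : ContinuousOn F' S) {a b : ℝ}
    (hf : ContinuousOn f [[a, b]]) {x₀ : ℂ} (hx₀ : ∀ s ∈ [[a, b]], x₀ - ((s : ℝ) : ℂ) ∈ S) :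
    HasDerivAt (fun x => ∫ s in a..b, F (x - (s : ℝ)) * f s)
      (∫ s in a..b, F' (x₀ - (s : ℝ)) * f s) x₀ := by
  have hev : ∀ᶠ x : ℂ in 𝓝 x₀, ∀ s ∈ [[a, b]], x - ((s : ℝ) : ℂ) ∈ S := by
    refine isCompact_uIcc.eventually_forall_of_forall_eventually fun s hs => ?_
    have hc : Continuous fun p : ℂ × ℝ => p.1 - (p.2 : ℂ) := by fun_prop
    exact hc.continuousAt.preimage_mem_nhds (hS.mem_nhds (hx₀ s hs))
  obtain ⟨ε, hε, hball⟩ := Metric.nhds_basis_closedBall.mem_iff.1 hev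
  have hmem : ∀ x ∈ Metric.closedBall x₀ ε, ∀ s ∈ [[a, b]], x - ((s : ℝ) : ℂ) ∈ S := fun x hx => hball hx
  have hcomp : IsCompact (Metric.closedBall x₀ ε ×ˢ [[a, b]]) :=
    (isCompact_closedBall _ _).prod isCompact_uIcc
  have hcont : ContinuousOn (fun p : ℂ × ℝ => F' (p.1 - (p.2 : ℂ)) * f p.2)
      (Metric.closedBall x₀ ε ×ˢ [[a, b]]) := by
    refine ContinuousOn.mul ?_ ?_
    · exact hF'.comp (by fun_prop) fun p hp => hmem p.1 hp.1 p.2 hp.2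
    · exact hf.comp (by fun_prop) fun p hp => hp.2
  obtain ⟨C, hC⟩ := hcomp.exists_bound_of_continuousOn hcont
  have hFc : ContinuousOn F S := fun u hu => (hF u hu).continuousAt.continuousWithinAt
  have hint : ∀ x ∈ Metric.closedBall x₀ ε,
      IntervalIntegrable (fun s : ℝ => F (x - (s : ℝ)) * f s) volume a b := fun x hx =>
    ContinuousOn.intervalIntegrable
      ((hFc.comp (by fun_prop) fun s hs => hmem x hx s hs).mul hf)
  have hmeas : ∀ {g : ℝ → ℂ}, IntervalIntegrable g volume a b →
      AEStronglyMeasurable g (volume.restrict (Ι a b)) := fun h => h.def'.aestronglyMeasurable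
  refine (intervalIntegral.hasDerivAt_integral_of_dominated_loc_of_deriv_le
    (F := fun x s => F (x - (s : ℝ)) * f s) (F' := fun x s => F' (x - (s : ℝ)) * f s)
    (bound := fun _ => C) (Metric.closedBall_mem_nhds x₀ hε) ?_ (hint x₀ ?_) ?_ ?_ ?_ ?_).2
  · filter_upwards [Metric.closedBall_mem_nhds x₀ hε] with x hx using hmeas (hint x hx)
  · exact Metric.mem_closedBall_self hε.le
  · refine hmeas (ContinuousOn.intervalIntegrable ((hF'.comp (by fun_prop) fun s hs => ?_).mul hf))
    exact hx₀ s hs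
  · exact Eventually.of_forall fun s hs x hx => hC (x, s) ⟨hx, uIoc_subset_uIcc hs⟩
  · exact intervalIntegrable_const
  · refine Eventually.of_forall fun s hs x hx => ?_
    have h1 := hF _ (hmem x hx s (uIoc_subset_uIcc hs))
    have h2 : HasDerivAt (fun x : ℂ => x - (s : ℂ)) 1 x := (hasDerivAt_id x).sub_const _
    have h3 := (h1.comp x h2).mul_const (f s)
    rw [mul_one] at h3
    exact h3

lemma isOpen_strip (r : ℝ) : IsOpen {w : ℂ | |w.im| < r} :=
  isOpen_lt (continuous_abs.comp Complex.continuous_im) continuous_const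

lemma isPreconnected_strip (r : ℝ) : IsPreconnected {w : ℂ | |w.im| < r} := by
  have : {w : ℂ | |w.im| < r} = {w : ℂ | -r < w.im} ∩ {w | w.im < r} := by
    ext w; simp [abs_lt]
  rw [this]
  exact ((convex_halfSpace_im_gt _).inter (convex_halfSpace_im_lt _)).isPreconnected

lemma mem_regularSet_of_abs_lt {c : ℝ} {w : ℂ} (h : |w.im| < c) : w ∈ regularSet c :=
  mem_regularSet_of_im (by rw [abs_of_pos ((abs_nonneg _).trans_lt h)]; exact h.ne)

lemma mem_slit_regularSet_of_abs_lt {c : ℝ} {w : ℂ} (h : |w.im| < c) : w ∈ slit (regularSet c) :=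
  fun _ _ => mem_regularSet_of_abs_lt (by simpa using h)

lemma differentiableAt_kernelOp {η : ℝ} {f : ℝ → ℂ}
    (hf : ContinuousOn f (Icc (-(Real.pi / 2)) (Real.pi / 2))) {w : ℂ} (hw : |w.im| < η) :
    DifferentiableAt ℂ (kernelOp η f) w := by
  have hd : DifferentiableOn ℂ (kernel η) {w : ℂ | |w.im| < η} :=
    (differentiableOn_kernel η).mono fun u hu => mem_regularSet_of_abs_lt hu
  refine (hasDerivAt_integral_sub (F := kernel η) (F' := deriv (kernel η)) (isOpen_strip η)
    (fun u hu => (hd.differentiableAt ((isOpen_strip η).mem_nhds hu)).hasDerivAt)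
    (hd.deriv (isOpen_strip η)).continuousOn (by rwa [uIcc_of_le neg_pi_le_pi])
    (x₀ := w) (fun s _ => ?_)).differentiableAt
  simpa using hw

/-- Integration by parts for the kernel. -/
lemma integral_kernel_mul {η : ℝ} {w : ℂ} (hw : |w.im| < η) {g g' : ℝ → ℂ} {a b : ℝ}
    (hg : ∀ s ∈ [[a, b]], HasDerivAt g (g' s) s) (hg' : ContinuousOn g' [[a, b]]) :
    2 * I * Real.pi * (∫ s in a..b, kernel η (w - s) * g s) =
      barePhase η (w - a) * g a - barePhase η (w - b) * g b +
      ∫ s in a..b, barePhase η (w - s) * g' s := by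
  have hθ : ∀ s : ℝ, HasDerivAt (fun s : ℝ => barePhase η (w - s))
      (-(2 * I * Real.pi * kernel η (w - s))) s := by
    intro s
    have h1 := hasDerivAt_barePhase (η := η) (w := w - s)
      (mem_slit_regularSet_of_abs_lt (by simpa using hw))
    have h2 : HasDerivAt (fun s : ℝ => w - (s : ℂ)) (-1) s :=
      (Complex.ofRealCLM.hasDerivAt).const_sub w
    have h3 := h1.comp s h2
    rw [mul_neg_one] at h3
    exact h3
  have hki : ContinuousOn (fun s : ℝ => -(2 * I * Real.pi * kernel η (w - s))) [[a, b]] :=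
    (continuousOn_const.mul (continuousOn_kernel_sub hw _)).neg
  have := intervalIntegral.integral_mul_deriv_eq_deriv_mul (fun s _ => hθ s) hg
    hki.intervalIntegrable hg'.intervalIntegrable
  rw [this, ← intervalIntegral.integral_const_mul]
  have e : (∫ s in a..b, -(2 * I * Real.pi * kernel η (w - s)) * g s) =
      -∫ s in a..b, 2 * I * Real.pi * (kernel η (w - s) * g s) := by
    rw [← intervalIntegral.integral_neg]
    refine intervalIntegral.integral_congr fun s _ => ?_
    ring
  rw [e]
  ring

/-! ### Contour integrals at real points -/

lemma contourIntegral_ofReal (f : ℂ → ℂ) (x : ℝ) :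
    contourIntegral f (x : ℂ) = ∫ t in (-(Real.pi / 2))..x, f (t : ℝ) := by
  simp [contourIntegral]

lemma contourIntegral_neg_add {T : ℂ → ℂ} (hneg : ∀ w, T (-w) = T w)
    (hc : Continuous fun t : ℝ => T t) (x : ℝ) :
    contourIntegral T ((-x : ℝ) : ℂ) + contourIntegral T (x : ℂ) =
      ∫ t in (-(Real.pi / 2))..(Real.pi / 2), T (t : ℝ) := by
  rw [contourIntegral_ofReal, contourIntegral_ofReal]
  have e : (∫ t in (-(Real.pi / 2))..(-x), T (t : ℝ)) = ∫ t in x..(Real.pi / 2), T (t : ℝ) := by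
    rw [← intervalIntegral.integral_comp_neg]
    refine intervalIntegral.integral_congr fun t _ => ?_
    rw [Complex.ofReal_neg, hneg]
  rw [e, add_comm]
  exact intervalIntegral.integral_add_adjacent_intervals (hc.intervalIntegrable _ _)
    (hc.intervalIntegrable _ _)

/-- An even `π`-periodic integrand is symmetric about `-π/2`, so the primitive vanishing there is
odd about that point. -/
lemma contourIntegral_reflect {T : ℂ → ℂ} (hneg : ∀ w, T (-w) = T w)
    (hper : ∀ w, T (w + Real.pi) = T w) (s : ℝ) :
    contourIntegral T ((-(Real.pi / 2) - s : ℝ) : ℂ) =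
      -contourIntegral T ((-(Real.pi / 2) + s : ℝ) : ℂ) := by
  rw [contourIntegral_ofReal, contourIntegral_ofReal, intervalIntegral.integral_symm]
  congr 1
  have := intervalIntegral.integral_comp_sub_left (a := -(Real.pi / 2)) (b := -(Real.pi / 2) + s)
    (fun t : ℝ => T t) (-Real.pi)
  rw [show -Real.pi - (-(Real.pi / 2) + s) = -(Real.pi / 2) - s by ring,
    show -Real.pi - -(Real.pi / 2) = -(Real.pi / 2) by ring] at this
  rw [← this]
  refine intervalIntegral.integral_congr fun t _ => ?_
  rw [← hneg, ← hper (t : ℂ)]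
  congr 1
  push_cast; ring

lemma barePhase_reflect (η s : ℝ) :
    barePhase η ((-(Real.pi / 2) - s : ℝ) : ℂ) = -barePhase η ((-(Real.pi / 2) + s : ℝ) : ℂ) := by
  rw [barePhase, barePhase, contourIntegral_reflect (kernel_neg η) (kernel_add_pi η)]
  ring

lemma integral_eq_zero_of_odd {g : ℝ → ℂ} (h : ∀ s, g (-s) = -g s) :
    (∫ s in (-(Real.pi / 2))..(Real.pi / 2), g s) = 0 := by
  have := integral_comp_neg_symm g
  simp only [h, intervalIntegral.integral_neg] at this
  linear_combination (-(1 : ℂ) / 2) * this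

/-! ### The dressed momentum -/

/-- The dressed momentum, as a contour integral. -/
def momentumFun (η : ℝ) (w : ℂ) : ℂ :=
  contourIntegral (dressedDensity η (η / 2)) w / (2 * Real.pi)

/-- The homogenised dressed phase of a non-wide root, as a contour integral. -/
def phaseFun (η : ℝ) (w : ℂ) : ℂ := I * contourIntegral (dressedDensity η η) w

lemma hasDerivAt_contourIntegral_dressedDensity {η : ℝ} (hη : 0 < η) {c : ℝ} {w : ℂ}
    (hw : w ∈ slit (dressedRegularSet η c)) :
    HasDerivAt (contourIntegral (dressedDensity η c)) (dressedDensity η c w) w :=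
  hasDerivAt_contourIntegral (isOpen_dressedRegularSet hη c) (differentiableOn_dressedDensity hη c)
    (vertical_mem_dressedRegularSet η c) hw

lemma mem_slit_dressedRegularSet_of_abs_lt {η c : ℝ} (hη : 0 < η) {w : ℂ} (hw : |w.im| < c) :
    w ∈ slit (dressedRegularSet η c) := fun _ _ =>
  mem_dressedRegularSet_of_abs_lt hη (by simpa using hw)

lemma continuous_dressedDensity_ofReal_sub {η c : ℝ} (hη : 0 < η) {z : ℂ} (hz : |z.im| < c) :
    Continuous fun t : ℝ => dressedDensity η c (t - z) := by
  rw [continuous_iff_continuousAt]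
  intro t
  have h : |((t : ℂ) - z).im| < c := by simpa using hz
  exact ContinuousAt.comp (f := fun t : ℝ => (t : ℂ) - z)
    ((differentiableOn_dressedDensity hη c).differentiableAt
      ((isOpen_dressedRegularSet hη c).mem_nhds
        (mem_dressedRegularSet_of_abs_lt hη h))).continuousAt (by fun_prop)

lemma continuous_dressedDensity_ofReal {η c : ℝ} (hη : 0 < η) (hc : 0 < c) :
    Continuous fun t : ℝ => dressedDensity η c t := by
  simpa using continuous_dressedDensity_ofReal_sub hη (z := 0) (by simpa using hc)

lemma hasDerivAt_momentumFun {η : ℝ} (hη : 0 < η) {w : ℂ}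
    (hw : w ∈ slit (dressedRegularSet η (η / 2))) :
    HasDerivAt (momentumFun η) (dressedDensity η (η / 2) w / (2 * Real.pi)) w :=
  (hasDerivAt_contourIntegral_dressedDensity hη hw).div_const _

lemma hasDerivAt_phaseFun {η : ℝ} (hη : 0 < η) {w : ℂ} (hw : w ∈ slit (dressedRegularSet η η)) :
    HasDerivAt (phaseFun η) (I * dressedDensity η η w) w :=
  (hasDerivAt_contourIntegral_dressedDensity hη hw).const_mul _

/-- In the strip both sides have the same derivative, by `dressedDensity_add_integral` with `z = 0`,
and both vanish at `-π/2`. It is the momentum equation before integration by parts. -/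
lemma momentumFun_add_integral {η : ℝ} (hη : 0 < η) {x : ℂ} (hx : |x.im| < η / 2) :
    2 * Real.pi * momentumFun η x + 1 / (2 * I * Real.pi) *
      (∫ s in (-(Real.pi / 2))..(Real.pi / 2), barePhase η (x - s) *
        dressedDensity η (η / 2) (s : ℝ)) = bareMomentum η x := by
  have hpi : (Real.pi : ℂ) ≠ 0 := by simp [Real.pi_ne_zero]
  have hη2 : 0 < η / 2 := half_pos hη
  have hTc : Continuous fun t : ℝ => dressedDensity η (η / 2) t :=
    continuous_dressedDensity_ofReal hη hη2
  set Z : ℂ → ℂ := fun x => 2 * Real.pi * momentumFun η x + 1 / (2 * I * Real.pi) *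
      (∫ s in (-(Real.pi / 2))..(Real.pi / 2), barePhase η (x - (s : ℝ)) *
        dressedDensity η (η / 2) (s : ℝ)) - bareMomentum η x with hZ
  have hd : ∀ x ∈ {x : ℂ | |x.im| < η / 2}, HasDerivAt Z 0 x := by
    intro x hx
    have hx' : |x.im| < η / 2 := hx
    have hxη : |x.im| < η := by linarith
    have h1 := hasDerivAt_integral_sub (F := barePhase η) (F' := fun u => 2 * I * Real.pi * kernel η u)
      (isOpen_strip η) (fun u hu => hasDerivAt_barePhase (mem_slit_regularSet_of_abs_lt hu))
      (continuousOn_const.mul ((differentiableOn_kernel η).mono fun u hu =>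
        mem_regularSet_of_abs_lt hu).continuousOn) (a := -(Real.pi / 2)) (b := Real.pi / 2)
      hTc.continuousOn (x₀ := x) (fun s _ => by simpa using hxη)
    have h2 := (((hasDerivAt_momentumFun hη (mem_slit_dressedRegularSet_of_abs_lt hη hx')).const_mul
      (2 * Real.pi : ℂ)).add (h1.const_mul (1 / (2 * I * Real.pi)))).sub
      (hasDerivAt_bareMomentum (mem_slit_regularSet_of_abs_lt hx'))
    refine h2.congr_deriv ?_
    have h3 := dressedDensity_add_integral hη hxη (c := η / 2) (z := 0) (by simpa using hη2)
    simp only [sub_zero] at h3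
    have hr := mem_regularSet_of_abs_lt hx'
    rw [bareMomentumDeriv_eq_cotDiff (by simpa using hr.1) (by simpa using hr.2), ← h3]
    simp only [mul_assoc, intervalIntegral.integral_const_mul]
    have : I ≠ 0 := Complex.I_ne_zero
    field_simp
    ring
  have hconst := (isOpen_strip (η / 2)).is_const_of_deriv_eq_zero (isPreconnected_strip _)
    (fun u hu => (hd u hu).differentiableAt.differentiableWithinAt)
    (fun u hu => (hd u hu).deriv) (show x ∈ {x : ℂ | |x.im| < η / 2} from hx)
    (show (-(Real.pi / 2 : ℝ) : ℂ) ∈ {x : ℂ | |x.im| < η / 2} by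
      simp only [mem_ofPred_eq, Complex.neg_im, Complex.ofReal_im, neg_zero, abs_zero]
      exact hη2)
  -- At `-π/2` the integrand is odd in `s`: the bare phase is odd about `-π/2` and the dressed
  -- density is even.
  have h0 : Z (-(Real.pi / 2 : ℝ) : ℂ) = 0 := by
    simp only [hZ]
    rw [momentumFun, contourIntegral_neg_pi_div_two, bareMomentum, contourIntegral_neg_pi_div_two,
      integral_eq_zero_of_odd]
    · simp
    · intro s
      have e1 : (-(Real.pi / 2 : ℝ) - ((-s : ℝ) : ℂ) : ℂ) = ((-(Real.pi / 2) + s : ℝ) : ℂ) := by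
        push_cast; ring
      have e2 : (-(Real.pi / 2 : ℝ) - ((s : ℝ) : ℂ) : ℂ) = ((-(Real.pi / 2) - s : ℝ) : ℂ) := by
        push_cast; ring
      rw [e1, e2, barePhase_reflect, Complex.ofReal_neg, dressedDensity_neg]
      ring
  rw [h0] at hconst
  exact sub_eq_zero.1 hconst

lemma momentumFun_neg_pi_div_two (η : ℝ) : momentumFun η ((-(Real.pi / 2) : ℝ) : ℂ) = 0 := by
  have := contourIntegral_neg_pi_div_two (dressedDensity η (η / 2))
  rw [momentumFun, Complex.ofReal_neg, this, zero_div]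

lemma momentumFun_pi_div_two {η : ℝ} (hη : 0 < η) :
    momentumFun η ((Real.pi / 2 : ℝ) : ℂ) = 1 / 2 := by
  have hpi : (Real.pi : ℂ) ≠ 0 := by simp [Real.pi_ne_zero]
  have := integral_dressedDensity hη (c := η / 2) (z := 0) (by simpa using hη)
  simp only [sub_zero] at this
  rw [momentumFun, contourIntegral_ofReal, this]
  field_simp

lemma hasDerivAt_momentumFun_ofReal {η : ℝ} (hη : 0 < η) (s : ℝ) :
    HasDerivAt (fun s : ℝ => momentumFun η s) (dressedDensity η (η / 2) s / (2 * Real.pi)) s :=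
  (hasDerivAt_momentumFun hη (mem_slit_dressedRegularSet_of_abs_lt hη
    (by simpa using hη))).comp_ofReal

lemma continuous_momentumFun_ofReal {η : ℝ} (hη : 0 < η) :
    Continuous fun s : ℝ => momentumFun η s :=
  continuous_iff_continuousAt.2 fun s => (hasDerivAt_momentumFun_ofReal hη s).continuousAt

/-- Integrating by parts in `momentumFun_add_integral` moves the derivative from the momentum to the
phase. The boundary terms are exactly the inhomogeneous terms with the end-point values of the
unknown. -/
theorem solvesMomentumEquation_momentumFun {η : ℝ} (hη : 0 < η) :
    SolvesMomentumEquation η fun s => momentumFun η s := by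
  have hpi : (Real.pi : ℂ) ≠ 0 := by simp [Real.pi_ne_zero]
  refine ⟨(continuous_momentumFun_ofReal hη).continuousOn, fun x _ => ?_⟩
  have h1 := momentumFun_add_integral hη (x := x) (by simpa using hη)
  have h2 := integral_kernel_mul (η := η) (w := x) (by simpa using hη)
    (a := -(Real.pi / 2)) (b := Real.pi / 2) (fun s _ => hasDerivAt_momentumFun_ofReal hη s)
    ((continuous_dressedDensity_ofReal hη (half_pos hη)).div_const _).continuousOn
  have h3 : (∫ s in (-(Real.pi / 2))..(Real.pi / 2), barePhase η (x - s) *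
      (dressedDensity η (η / 2) s / (2 * Real.pi))) =
      (∫ s in (-(Real.pi / 2))..(Real.pi / 2), barePhase η (x - s) *
      dressedDensity η (η / 2) s) / (2 * Real.pi) := by
    rw [← intervalIntegral.integral_div]
    simp only [mul_div_assoc]
  rw [h3] at h2
  rw [← h1]
  have h4 : kernelOp η (fun s => momentumFun η s) (x : ℂ) = 1 / (2 * I * Real.pi) *
      (2 * I * Real.pi * ∫ s in (-(Real.pi / 2))..(Real.pi / 2),
        kernel η (x - s) * momentumFun η s) := by
    have := Complex.I_ne_zero
    rw [kernelOp]; field_simp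
  rw [h4, h2]
  have e1 : ((x + Real.pi / 2 : ℝ) : ℂ) = x - ((-(Real.pi / 2) : ℝ) : ℂ) := by push_cast; ring
  have e2 : ((x - Real.pi / 2 : ℝ) : ℂ) = x - ((Real.pi / 2 : ℝ) : ℂ) := by push_cast; ring
  rw [e1, e2]
  have := Complex.I_ne_zero
  field_simp
  ring

lemma barePhase_sub_neg_pi {η : ℝ} (hη : 0 < η) (x : ℝ) :
    barePhase η ((x + Real.pi / 2 : ℝ) : ℂ) =
      barePhase η ((x - Real.pi / 2 : ℝ) : ℂ) + 2 * I * Real.pi := by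
  rw [← barePhase_add_pi_of_abs_lt (by simpa using hη)]
  congr 1; push_cast; ring

lemma kernelOp_add_pi (η : ℝ) (f : ℝ → ℂ) (w : ℂ) :
    kernelOp η f (w + Real.pi) = kernelOp η f w := by
  refine intervalIntegral.integral_congr fun s _ => ?_
  rw [← kernel_add_pi η (w - s)]
  congr 2; ring

/-- The source contains the unknown end-point values, so uniqueness for `I + K` alone does not
suffice. The difference `d` of two solutions, with end values `a` and `b`, satisfies `d + K d = (a -
b) θ(x - π/2)/(2πi) + a`. Comparing the two end points, where `K d` agrees and `θ` differs by `2πi`,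
gives `b - a = a - b`. Then `d` is the constant `a / 2`, and its value at `-π/2` forces `a = 0`. -/
lemma SolvesMomentumEquation.unique {η : ℝ} (hη : 0 < η) {f g : ℝ → ℂ}
    (hf : SolvesMomentumEquation η f) (hg : SolvesMomentumEquation η g) :
    ∀ x ∈ Icc (-(Real.pi / 2)) (Real.pi / 2), f x = g x := by
  have hpi : (Real.pi : ℂ) ≠ 0 := by simp [Real.pi_ne_zero]
  have hI := Complex.I_ne_zero
  obtain ⟨hfc, hf⟩ := hf
  obtain ⟨hgc, hg⟩ := hg
  set d : ℝ → ℂ := fun s => f s - g s with hd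
  have hdc : ContinuousOn d (Icc (-(Real.pi / 2)) (Real.pi / 2)) := hfc.sub hgc
  set a := d (-(Real.pi / 2)) with ha
  set b := d (Real.pi / 2) with hb
  have hde : ∀ x ∈ Icc (-(Real.pi / 2)) (Real.pi / 2), d x + kernelOp η d (x : ℝ) =
      1 / (2 * I * Real.pi) * ((a - b) * barePhase η ((x - Real.pi / 2 : ℝ) : ℂ)) + a := by
    intro x hx
    have h1 := hf x hx
    have h2 := hg x hx
    rw [barePhase_sub_neg_pi hη] at h1 h2
    have h3 := kernelOp_sub hfc hgc (w := (x : ℂ)) (η := η) (by simpa using hη)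
    rw [h3, ha, hb]
    simp only [hd]
    have e : f x - g x + (kernelOp η f x - kernelOp η g x) =
      (f x + kernelOp η f x) - (g x + kernelOp η g x) := by ring
    rw [e, h1, h2]
    field_simp
    ring
  have hab : a = b := by
    have h1 := hde _ (left_mem_Icc.2 neg_pi_le_pi)
    have h2 := hde _ (right_mem_Icc.2 neg_pi_le_pi)
    have e1 : ((Real.pi / 2 : ℝ) : ℂ) = ((-(Real.pi / 2) : ℝ) : ℂ) + Real.pi := by push_cast; ring
    have e2 : ((Real.pi / 2 - Real.pi / 2 : ℝ) : ℂ) =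
        ((-(Real.pi / 2) - Real.pi / 2 : ℝ) : ℂ) + Real.pi := by push_cast; ring
    rw [e1, kernelOp_add_pi, e2, barePhase_add_pi_of_abs_lt (by simpa using hη)] at h2
    rw [← ha] at h1
    rw [← hb] at h2
    have h3 : b - a = a - b := by
      have : 1 / (2 * I * Real.pi) * (2 * I * Real.pi) = 1 := by field_simp
      linear_combination h2 - h1 + (a - b) * this
    linear_combination (-(1 : ℂ) / 2) * h3
  have hconst := eq_of_add_kernelOp_eq hη (g := fun _ => a / 2) hdc continuousOn_const
    (fun x hx => by
      rw [hde x hx, kernelOp_const _ (by simpa using hη), hab]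
      ring)
  have ha0 : a = 0 := by
    have := hconst _ (left_mem_Icc.2 neg_pi_le_pi)
    rw [← ha] at this
    linear_combination 2 * this
  intro x hx
  have := hconst x hx
  rw [ha0, zero_div] at this
  exact sub_eq_zero.1 this

theorem solvesMomentumEquation_dressedMomentum {η : ℝ} (hη : 0 < η) :
    SolvesMomentumEquation η (dressedMomentum η) :=
  Classical.epsilon_spec (p := SolvesMomentumEquation η) ⟨_, solvesMomentumEquation_momentumFun hη⟩

theorem dressedMomentum_eq {η : ℝ} (hη : 0 < η) :
    ∀ x ∈ Icc (-(Real.pi / 2)) (Real.pi / 2), dressedMomentum η x = momentumFun η x :=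
  (solvesMomentumEquation_dressedMomentum hη).unique hη (solvesMomentumEquation_momentumFun hη)

/-! ### The dressed phase -/

/-- The increment is half that of `barePhase`, because `I + K` doubles the integral of a density
over a period. -/
lemma phaseFun_add_pi {η : ℝ} (hη : 0 < η) {w : ℂ} (hw : |w.im| < η) :
    phaseFun η (w + Real.pi) = phaseFun η w + I * Real.pi := by
  rw [phaseFun, phaseFun, contourIntegral_add_pi (differentiableOn_dressedDensity hη η)
    (dressedDensity_add_pi η η)
    (fun t => mem_dressedRegularSet_of_abs_lt hη (by simpa using hw))]
  have := integral_dressedDensity hη (c := η) (z := -(w.im * I)) (by simpa using hw)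
  simp only [sub_neg_eq_add] at this
  rw [this]; ring

lemma continuous_kernel_ofReal {η : ℝ} (hη : 0 < η) : Continuous fun t : ℝ => kernel η t := by
  simp only [kernel_ofReal]
  exact Complex.continuous_ofReal.comp (continuous_realKernel hη)

lemma phaseFun_neg_add {η : ℝ} (hη : 0 < η) (x : ℝ) :
    phaseFun η ((-x : ℝ) : ℂ) + phaseFun η x = I * Real.pi := by
  have h := integral_dressedDensity hη (c := η) (z := 0) (by simpa using hη)
  simp only [sub_zero] at h
  rw [← h, ← contourIntegral_neg_add (dressedDensity_neg η η)
    (continuous_dressedDensity_ofReal hη hη) x, phaseFun, phaseFun]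
  ring

lemma barePhase_zero {η : ℝ} (hη : 0 < η) : barePhase η 0 = I * Real.pi := by
  have h := integral_kernel_of_abs_lt (η := η) (μ := 0) (by simpa using hη)
  simp only [sub_zero] at h
  have := contourIntegral_neg_add (kernel_neg η) (continuous_kernel_ofReal hη) 0
  rw [h, neg_zero, Complex.ofReal_zero] at this
  rw [barePhase]
  linear_combination (I * Real.pi) * this

lemma phaseFun_zero {η : ℝ} (hη : 0 < η) : phaseFun η 0 = I * Real.pi / 2 := by
  have := phaseFun_neg_add hη 0
  rw [neg_zero, Complex.ofReal_zero] at this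
  linear_combination this / 2

lemma hasDerivAt_phaseFun_ofReal_sub {η : ℝ} (hη : 0 < η) {z : ℂ} (hz : |z.im| < η) (s : ℝ) :
    HasDerivAt (fun s : ℝ => phaseFun η (s - z)) (I * dressedDensity η η (s - z)) s := by
  have h1 := hasDerivAt_phaseFun hη (w := s - z) (mem_slit_dressedRegularSet_of_abs_lt hη
    (by simpa using hz))
  have h2 : HasDerivAt (fun s : ℝ => (s : ℂ) - z) 1 s :=
    (Complex.ofRealCLM.hasDerivAt).sub_const z
  have h3 := h1.comp s h2
  rw [mul_one] at h3
  exact h3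

lemma continuous_phaseFun_ofReal_sub {η : ℝ} (hη : 0 < η) {z : ℂ} (hz : |z.im| < η) :
    Continuous fun s : ℝ => phaseFun η (s - z) :=
  continuous_iff_continuousAt.2 fun s => (hasDerivAt_phaseFun_ofReal_sub hη hz s).continuousAt

lemma continuous_phaseFun_ofReal {η : ℝ} (hη : 0 < η) : Continuous fun s : ℝ => phaseFun η s := by
  simpa using continuous_phaseFun_ofReal_sub hη (z := 0) (by simpa using hη)

/-- The window of integration is moved back to `[-π/2, π/2]` by quasi-periodicity, which costs a
partial integral of the kernel, that is, the term with `θ(x - π/2)`. Over the symmetric window,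
reflection and `phaseFun_neg_add` replace the phase by its mean value `iπ/2`. -/
lemma integral_kernel_mul_phaseFun_self {η : ℝ} (hη : 0 < η) (x : ℝ) :
    (∫ s in (-(Real.pi / 2))..(Real.pi / 2), kernel η (x - s) * phaseFun η (s - x)) =
      I * Real.pi / 2 - barePhase η ((x - Real.pi / 2 : ℝ) : ℂ) / 2 := by
  have hkc := continuous_kernel_ofReal hη
  have hGc := continuous_phaseFun_ofReal hη
  set g : ℝ → ℂ := fun v => kernel η v * phaseFun η v with hg
  have hgc : Continuous g := hkc.mul hGc
  have h1 : (∫ s in (-(Real.pi / 2))..(Real.pi / 2), kernel η (x - s) * phaseFun η (s - x)) =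
      ∫ v in (-(Real.pi / 2) - x)..(Real.pi / 2 - x), g v := by
    rw [← intervalIntegral.integral_comp_sub_right]
    refine intervalIntegral.integral_congr fun s _ => ?_
    simp only [hg]
    rw [← kernel_neg]
    push_cast
    ring_nf
  have h2 : (∫ v in (Real.pi / 2)..(Real.pi / 2 - x), g v) =
      (∫ v in (-(Real.pi / 2))..(-(Real.pi / 2) - x), g v) +
      I * Real.pi * ∫ v in (-(Real.pi / 2))..(-(Real.pi / 2) - x), kernel η (v : ℝ) := by
    rw [← intervalIntegral.integral_const_mul, ← intervalIntegral.integral_add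
      (hgc.intervalIntegrable _ _) (Continuous.intervalIntegrable (by fun_prop) _ _)]
    have := intervalIntegral.integral_comp_add_right (a := -(Real.pi / 2))
      (b := -(Real.pi / 2) - x) g Real.pi
    rw [show -(Real.pi / 2) + Real.pi = Real.pi / 2 by ring,
      show -(Real.pi / 2) - x + Real.pi = Real.pi / 2 - x by ring] at this
    rw [← this]
    refine intervalIntegral.integral_congr fun v _ => ?_
    simp only [hg]
    push_cast
    rw [kernel_add_pi, phaseFun_add_pi hη (by simpa using hη)]
    ring
  have h3 : (∫ v in (-(Real.pi / 2))..(Real.pi / 2), g v) = I * Real.pi / 2 := by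
    have e1 := integral_comp_neg_symm g
    have e2 : (∫ v in (-(Real.pi / 2))..(Real.pi / 2), g (-v)) +
        (∫ v in (-(Real.pi / 2))..(Real.pi / 2), g v) =
        I * Real.pi * ∫ v in (-(Real.pi / 2))..(Real.pi / 2), kernel η (v : ℝ) := by
      have hgn : Continuous fun v => g (-v) := hgc.comp continuous_neg
      rw [← intervalIntegral.integral_add (hgn.intervalIntegrable _ _)
        (hgc.intervalIntegrable _ _), ← intervalIntegral.integral_const_mul]
      refine intervalIntegral.integral_congr fun v _ => ?_
      simp only [hg]
      rw [← phaseFun_neg_add hη v]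
      push_cast
      rw [kernel_neg]
      ring
    have e3 := integral_kernel_of_abs_lt (η := η) (μ := 0) (by simpa using hη)
    simp only [sub_zero] at e3
    rw [e3, e1] at e2
    linear_combination e2 / 2
  have h4 : barePhase η ((x - Real.pi / 2 : ℝ) : ℂ) = -(2 * I * Real.pi *
      ∫ v in (-(Real.pi / 2))..(-(Real.pi / 2) - x), kernel η (v : ℝ)) := by
    rw [← contourIntegral_ofReal (kernel η), show x - Real.pi / 2 = -(Real.pi / 2) + x by ring,
      ← neg_eq_iff_eq_neg, ← barePhase_reflect, barePhase]
  have i1 := intervalIntegral.integral_add_adjacent_intervals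
    (hgc.intervalIntegrable (μ := volume) (-(Real.pi / 2)) (-(Real.pi / 2) - x))
    (hgc.intervalIntegrable (-(Real.pi / 2) - x) (Real.pi / 2 - x))
  have i2 := intervalIntegral.integral_add_adjacent_intervals
    (hgc.intervalIntegrable (μ := volume) (-(Real.pi / 2)) (Real.pi / 2))
    (hgc.intervalIntegrable (Real.pi / 2) (Real.pi / 2 - x))
  rw [h1, h4]
  linear_combination i1 - i2 + h2 + h3

/-- The defect is differentiated in `z`, not in `x`: it is constant on the strip by
`dressedDensity_add_integral`, and the constant is read off at `z = x`. The remaining `-θ(x -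
π/2)/2` is the reason for the homogenisation of `φ` by half of `φ(·, π/2)`. -/
theorem phaseFun_add_integral {η : ℝ} (hη : 0 < η) {z : ℂ} (hz : |z.im| < η) (x : ℝ) :
    phaseFun η (x - z) +
      (∫ s in (-(Real.pi / 2))..(Real.pi / 2), kernel η (x - s) * phaseFun η (s - z)) =
      barePhase η (x - z) - barePhase η ((x - Real.pi / 2 : ℝ) : ℂ) / 2 := by
  have hpi : (Real.pi : ℂ) ≠ 0 := by simp [Real.pi_ne_zero]
  set Z : ℂ → ℂ := fun z => phaseFun η (x - z) +
      (∫ s in (-(Real.pi / 2))..(Real.pi / 2), phaseFun η (-(z - (s : ℝ))) * kernel η (x - (s : ℝ))) -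
      barePhase η (x - z) with hZ
  have hd : ∀ z ∈ {z : ℂ | |z.im| < η}, HasDerivAt Z 0 z := by
    intro z hz
    have hz' : |z.im| < η := hz
    have hxz : |((x : ℂ) - z).im| < η := by simpa using hz'
    have hsub : HasDerivAt (fun z : ℂ => (x : ℂ) - z) (-1) z := (hasDerivAt_id z).const_sub _
    have h1 := (hasDerivAt_phaseFun hη (mem_slit_dressedRegularSet_of_abs_lt hη hxz)).comp z hsub
    have h2 := (hasDerivAt_barePhase (mem_slit_regularSet_of_abs_lt hxz)).comp z hsub
    have h3 := hasDerivAt_integral_sub (F := fun u => phaseFun η (-u))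
      (F' := fun u => I * dressedDensity η η (-u) * (-1)) (isOpen_strip η)
      (fun u hu => by
        have hu' : |(-u).im| < η := by rw [Complex.neg_im, abs_neg]; exact hu
        have := (hasDerivAt_phaseFun hη (mem_slit_dressedRegularSet_of_abs_lt hη hu')).comp u
          (hasDerivAt_neg u)
        exact this)
      (ContinuousOn.mul (ContinuousOn.mul continuousOn_const
        ((differentiableOn_dressedDensity hη η).continuousOn.comp (by fun_prop) fun u hu =>
          mem_dressedRegularSet_of_abs_lt hη (by rw [Complex.neg_im, abs_neg]; exact hu)))
        continuousOn_const)
      (a := -(Real.pi / 2)) (b := Real.pi / 2) (f := fun s : ℝ => kernel η (x - s))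
      (continuousOn_kernel_sub (by simpa using hη) _) (x₀ := z) (fun s _ => by simpa using hz')
    refine ((h1.add h3).sub h2).congr_deriv ?_
    have h4 := dressedDensity_add_integral hη (x := x) (c := η) (by simpa using hη) hz'
    have hr := mem_regularSet_of_abs_lt hxz
    rw [kernel_eq_cotDiff hr.1 hr.2, ← h4]
    have e : (∫ s in (-(Real.pi / 2))..(Real.pi / 2),
        I * dressedDensity η η (-(z - (s : ℝ))) * (-1) * kernel η (x - (s : ℝ))) =
        -I * ∫ s in (-(Real.pi / 2))..(Real.pi / 2),
          kernel η (x - (s : ℝ)) * dressedDensity η η ((s : ℝ) - z) := by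
      rw [← intervalIntegral.integral_const_mul]
      refine intervalIntegral.integral_congr fun s _ => ?_
      rw [neg_sub]; ring
    rw [e]
    field_simp
    ring
  have hconst := (isOpen_strip η).is_const_of_deriv_eq_zero (isPreconnected_strip _)
    (fun u hu => (hd u hu).differentiableAt.differentiableWithinAt)
    (fun u hu => (hd u hu).deriv) (show z ∈ {x : ℂ | |x.im| < η} from hz)
    (show (x : ℂ) ∈ {x : ℂ | |x.im| < η} by simpa using hη)
  have hcomm : ∀ z : ℂ, (∫ s in (-(Real.pi / 2))..(Real.pi / 2),
      phaseFun η (-(z - (s : ℝ))) * kernel η (x - (s : ℝ))) =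
      ∫ s in (-(Real.pi / 2))..(Real.pi / 2), kernel η (x - (s : ℝ)) * phaseFun η ((s : ℝ) - z) := by
    intro z
    refine intervalIntegral.integral_congr fun s _ => ?_
    rw [neg_sub]; ring
  simp only [hZ, hcomm] at hconst
  rw [integral_kernel_mul_phaseFun_self hη, sub_self, phaseFun_zero hη, barePhase_zero hη] at hconst
  linear_combination hconst

lemma SolvesPhaseEquation.unique {η : ℝ} (hη : 0 < η) {z : ℂ} {f g : ℝ → ℂ}
    (hf : SolvesPhaseEquation η z f) (hg : SolvesPhaseEquation η z g) :
    ∀ x ∈ Icc (-(Real.pi / 2)) (Real.pi / 2), f x = g x :=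
  eq_of_add_kernelOp_eq hη hf.1 hg.1 fun x hx => by rw [hf.2 x hx, hg.2 x hx]

lemma SolvesPhaseEquation.dressedPhase_eq {η : ℝ} (hη : 0 < η) {z : ℂ} {f : ℝ → ℂ}
    (hf : SolvesPhaseEquation η z f) :
    SolvesPhaseEquation η z (dressedPhase η z) ∧
    ∀ x ∈ Icc (-(Real.pi / 2)) (Real.pi / 2), dressedPhase η z x = f x := by
  have : SolvesPhaseEquation η z (dressedPhase η z) :=
    Classical.epsilon_spec (p := SolvesPhaseEquation η z) ⟨f, hf⟩
  exact ⟨this, this.unique hη hf⟩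

/-- For `z = π/2` the right-hand side of `phaseFun_add_integral` is `θ(x - π/2)/2`, so the second
summand compensates the defect of the first. -/
lemma solvesPhaseEquation_of_abs_lt {η : ℝ} (hη : 0 < η) {z : ℂ} (hz : |z.im| < η) :
    SolvesPhaseEquation η z fun x => phaseFun η (x - z) + phaseFun η (x - (Real.pi / 2 : ℝ)) := by
  have hp : |(((Real.pi / 2 : ℝ) : ℂ)).im| < η := by rw [Complex.ofReal_im, abs_zero]; exact hη
  have c1 := (continuous_phaseFun_ofReal_sub hη hz).continuousOn
    (s := Icc (-(Real.pi / 2)) (Real.pi / 2))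
  have c2 := (continuous_phaseFun_ofReal_sub hη hp).continuousOn
    (s := Icc (-(Real.pi / 2)) (Real.pi / 2))
  refine ⟨c1.add c2, fun x _ => ?_⟩
  rw [kernelOp_add c1 c2 (by simpa using hη)]
  have h1 := phaseFun_add_integral hη hz x
  have h2 := phaseFun_add_integral hη hp x
  have e : ((x - Real.pi / 2 : ℝ) : ℂ) = x - (Real.pi / 2 : ℝ) := by push_cast; ring
  rw [e] at h1 h2
  simp only [kernelOp]
  linear_combination h1 + h2

/-- The momentum shifted by `-z + iη/2` is holomorphic below the axis, so `K` shifts it further by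
`-iη`; by `barePhase_eq` the two momenta add up to the phase. For `z` below the strip,
`solvesPhaseEquation_of_lt_neg` uses the reflected argument. -/
lemma solvesPhaseEquation_of_lt {η : ℝ} (hη : 0 < η) {z : ℂ} (hz : η < z.im) :
    SolvesPhaseEquation η z fun x => I * bareMomentum η (x - z + I * (η / 2 : ℝ)) := by
  obtain ⟨l, hl⟩ := exists_lowerPeriodic_bareMomentum_add hη (W := -z + I * (η / 2 : ℝ))
    (by simp; linarith)
  have hc := hl.continuous_ofReal
  have e : ∀ x : ℝ, (x : ℂ) - z + I * (η / 2 : ℝ) = x + (-z + I * (η / 2 : ℝ)) := fun x => by ring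
  refine ⟨?_, fun x _ => ?_⟩
  · simp only [e]
    exact (hc.const_mul I).continuousOn
  · have h1 := hl.integral_mul_kernel_of_abs_lt (η := η) (μ := x) (by simpa using hη)
    have h2 : kernelOp η (fun x : ℝ => bareMomentum η (x - z + I * (η / 2 : ℝ))) x =
        bareMomentum η (x - z - I * (η / 2 : ℝ)) := by
      have e2 : (x : ℂ) - I * η + (-z + I * (η / 2 : ℝ)) = x - z - I * (η / 2 : ℝ) := by
        push_cast; ring
      rw [e2] at h1
      rw [← h1]
      refine intervalIntegral.integral_congr fun s _ => ?_
      simp only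
      rw [e, mul_comm, ← kernel_neg, neg_sub]
    have h3 := barePhase_eq (η := η) (w := x - z)
      (mem_slit_regularSet_of_im (by
        rw [abs_of_pos hη]
        have : ((x : ℂ) - z).im = -z.im := by simp
        rw [this, abs_neg, abs_of_pos (by linarith)]; exact hz.ne'))
      (mem_slit_regularSet_of_im (by
        rw [abs_of_pos (half_pos hη)]
        have : ((x : ℂ) - z + I * (η / 2 : ℝ)).im = -(z.im - η / 2) := by simp; ring
        rw [this, abs_neg, abs_of_pos (by linarith)]; linarith))
      (mem_slit_regularSet_of_im (by
        rw [abs_of_pos (half_pos hη)]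
        have : ((x : ℂ) - z - I * (η / 2 : ℝ)).im = -(z.im + η / 2) := by simp; ring
        rw [this, abs_neg, abs_of_pos (by linarith)]; linarith))
    rw [kernelOp_const_mul, h2, h3]
    ring

lemma solvesPhaseEquation_of_lt_neg {η : ℝ} (hη : 0 < η) {z : ℂ} (hz : z.im < -η) :
    SolvesPhaseEquation η z fun x => I * bareMomentum η (x - z - I * (η / 2 : ℝ)) := by
  obtain ⟨l, hl⟩ := exists_lowerPeriodic_bareMomentum_sub hη (W := -z - I * (η / 2 : ℝ))
    (by simp; linarith)
  have hc : Continuous fun s : ℝ => bareMomentum η (-z - I * (η / 2 : ℝ) - ((-s : ℝ) : ℂ)) :=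
    hl.continuous_ofReal.comp continuous_neg
  have e : ∀ x : ℝ, (x : ℂ) - z - I * (η / 2 : ℝ) = -z - I * (η / 2 : ℝ) - ((-x : ℝ) : ℂ) :=
    fun x => by push_cast; ring
  refine ⟨?_, fun x _ => ?_⟩
  · simp only [e]
    exact (hc.const_mul I).continuousOn
  · have h1 := hl.integral_mul_kernel_of_abs_lt (η := η) (μ := -x) (by simpa using hη)
    have h2 : kernelOp η (fun x : ℝ => bareMomentum η (x - z - I * (η / 2 : ℝ))) x =
        bareMomentum η (x - z + I * (η / 2 : ℝ)) := by
      have e2 : -z - I * (η / 2 : ℝ) - (-(x : ℂ) - I * η) = x - z + I * (η / 2 : ℝ) := by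
        push_cast; ring
      rw [e2, ← integral_comp_neg_symm] at h1
      rw [← h1]
      refine intervalIntegral.integral_congr fun s _ => ?_
      simp only
      rw [e, mul_comm]
      congr 2
      push_cast; ring
    have h3 := barePhase_eq (η := η) (w := x - z)
      (mem_slit_regularSet_of_im (by
        rw [abs_of_pos hη]
        have : ((x : ℂ) - z).im = -z.im := by simp
        rw [this, abs_of_pos (by linarith)]; linarith))
      (mem_slit_regularSet_of_im (by
        rw [abs_of_pos (half_pos hη)]
        have : ((x : ℂ) - z + I * (η / 2 : ℝ)).im = -z.im + η / 2 := by simp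
        rw [this, abs_of_pos (by linarith)]; linarith))
      (mem_slit_regularSet_of_im (by
        rw [abs_of_pos (half_pos hη)]
        have : ((x : ℂ) - z - I * (η / 2 : ℝ)).im = -z.im - η / 2 := by simp
        rw [this, abs_of_pos (by linarith)]; linarith))
    rw [kernelOp_const_mul, h2, h3]
    ring

lemma homDressedPhase_eq_of_abs_lt {η : ℝ} (hη : 0 < η) {z : ℂ} (hz : |z.im| < η) :
    ∀ x ∈ Icc (-(Real.pi / 2)) (Real.pi / 2), homDressedPhase η z x = phaseFun η (x - z) := by
  intro x hx
  have h1 := ((solvesPhaseEquation_of_abs_lt hη hz).dressedPhase_eq hη).2 x hx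
  have h2 := ((solvesPhaseEquation_of_abs_lt hη (z := ((Real.pi / 2 : ℝ) : ℂ))
    (by rw [Complex.ofReal_im, abs_zero]; exact hη)).dressedPhase_eq hη).2 x hx
  rw [homDressedPhase, if_pos hz, h1, h2]
  ring

lemma homDressedPhase_eq_of_lt {η : ℝ} (hη : 0 < η) {z : ℂ} (hz : η < z.im) :
    ∀ x ∈ Icc (-(Real.pi / 2)) (Real.pi / 2), homDressedPhase η z x =
      I * bareMomentum η (x - z + I * (η / 2 : ℝ)) := by
  intro x hx
  rw [homDressedPhase, if_neg (by rw [abs_of_pos (hη.trans hz)]; exact hz.le.not_gt),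
    ((solvesPhaseEquation_of_lt hη hz).dressedPhase_eq hη).2 x hx]
  ring

lemma homDressedPhase_eq_of_lt_neg {η : ℝ} (hη : 0 < η) {z : ℂ} (hz : z.im < -η) :
    ∀ x ∈ Icc (-(Real.pi / 2)) (Real.pi / 2), homDressedPhase η z x =
      I * bareMomentum η (x - z - I * (η / 2 : ℝ)) := by
  intro x hx
  rw [homDressedPhase, if_neg (by rw [abs_of_neg (by linarith)]; linarith),
    ((solvesPhaseEquation_of_lt_neg hη hz).dressedPhase_eq hη).2 x hx]
  ring

open Classical in
/-- The integral equation satisfied by the homogenised dressed phase. -/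
theorem homDressedPhase_equation {η : ℝ} (hη : 0 < η) {z : ℂ} (hz : |z.im| ≠ η) :
    ContinuousOn (homDressedPhase η z) (Icc (-(Real.pi / 2)) (Real.pi / 2)) ∧
    ∀ x ∈ Icc (-(Real.pi / 2)) (Real.pi / 2),
      homDressedPhase η z x + kernelOp η (homDressedPhase η z) (x : ℝ) = barePhase η (x - z) -
        1 / 2 * (if |z.im| < η then 1 else 0) * barePhase η (x - (Real.pi / 2 : ℝ)) := by
  have hp := ((solvesPhaseEquation_of_abs_lt hη (z := ((Real.pi / 2 : ℝ) : ℂ))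
    (by rw [Complex.ofReal_im, abs_zero]; exact hη)).dressedPhase_eq hη).1
  have hs : SolvesPhaseEquation η z (dressedPhase η z) := by
    rcases lt_or_gt_of_ne hz with h | h
    · exact ((solvesPhaseEquation_of_abs_lt hη h).dressedPhase_eq hη).1
    · rcases lt_abs.1 h with h | h
      · exact ((solvesPhaseEquation_of_lt hη h).dressedPhase_eq hη).1
      · exact ((solvesPhaseEquation_of_lt_neg hη (by linarith)).dressedPhase_eq hη).1
  have hc : ContinuousOn (fun s => (1 / 2 * (if |z.im| < η then 1 else 0) : ℂ) *
      dressedPhase η ((Real.pi / 2 : ℝ) : ℂ) s) (Icc (-(Real.pi / 2)) (Real.pi / 2)) :=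
    continuousOn_const.mul hp.1
  refine ⟨hs.1.sub hc, fun x hx => ?_⟩
  have e : kernelOp η (homDressedPhase η z) (x : ℂ) = kernelOp η (dressedPhase η z) x -
      1 / 2 * (if |z.im| < η then 1 else 0) * kernelOp η (dressedPhase η (Real.pi / 2 : ℝ)) x := by
    rw [← kernelOp_const_mul, ← kernelOp_sub (η := η) (w := (x : ℂ)) hs.1 hc (by simpa using hη)]
    rfl
  rw [e, homDressedPhase, ← hs.2 x hx, ← hp.2 x hx]
  ring

/-! ### Analytic continuation -/

/-- The identity theorem is applied on the connected set formed by the real axis and the contour.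
Neither `U`, nor `U'`, nor their intersection has to be connected. -/
lemma IsContinuationValue.unique {f : ℝ → ℂ} {a : ℝ} {ω v v' : ℂ}
    (h : IsContinuationValue f a ω v) (h' : IsContinuationValue f a ω v') : v = v' := by
  obtain ⟨U, g, hU, hr, hc, hg, hf, rfl⟩ := h
  obtain ⟨U', g', hU', hr', hc', hg', hf', rfl⟩ := h'
  set S : Set ℂ := range ((↑) : ℝ → ℂ) ∪ contour a ω
  have hS : IsPreconnected S :=
    (isPreconnected_range Complex.continuous_ofReal).union (a : ℂ) ⟨a, rfl⟩
      (ofReal_mem_contour a ω) (isPreconnected_contour a ω)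
  have hSU : S ⊆ U := union_subset (range_subset_iff.2 hr) hc
  have hSU' : S ⊆ U' := union_subset (range_subset_iff.2 hr') hc'
  have h0 : (0 : ℂ) ∈ S := Or.inl ⟨0, by simp⟩
  have hfreq : ∃ᶠ w in 𝓝[≠] (0 : ℂ), g w = g' w := by
    have ht : Tendsto ((↑) : ℝ → ℂ) (𝓝[≠] 0) (𝓝[≠] (0 : ℂ)) := by
      refine tendsto_nhdsWithin_iff.2 ⟨?_, ?_⟩
      · exact (Complex.continuous_ofReal.tendsto' 0 0 (by simp)).mono_left nhdsWithin_le_nhds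
      · filter_upwards [self_mem_nhdsWithin] with x hx
        simpa using hx
    have hI : Icc (-(Real.pi / 2)) (Real.pi / 2) ∈ 𝓝 (0 : ℝ) :=
      Icc_mem_nhds (by linarith [Real.pi_pos]) (by linarith [Real.pi_pos])
    have hev : ∀ᶠ x : ℝ in 𝓝[≠] (0 : ℝ), g (x : ℂ) = g' (x : ℂ) := by
      filter_upwards [nhdsWithin_le_nhds hI] with x hx
      rw [hf x hx, hf' x hx]
    exact ht.frequently hev.frequently
  exact AnalyticOnNhd.eqOn_of_preconnected_of_frequently_eq
    ((hg.analyticOnNhd hU).mono hSU) ((hg'.analyticOnNhd hU').mono hSU') hS h0 hfreq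
    (Or.inr (mem_contour_self a ω))

lemma IsContinuationValue.continuation_eq {f : ℝ → ℂ} {a : ℝ} {ω v : ℂ}
    (h : IsContinuationValue f a ω v) : continuation f a ω = v :=
  IsContinuationValue.unique (Classical.epsilon_spec (p := IsContinuationValue f a ω) ⟨v, h⟩) h

lemma sub_mem_slit_of_mem_contour {A : Set ℂ}
    (hv : ∀ y : ℝ, (-(Real.pi / 2 : ℝ) + y * I : ℂ) ∈ A) {z ω : ℂ} (hω : ω - z ∈ slit A) {p : ℂ}
    (hp : p ∈ contour (z.re - Real.pi / 2) ω) : p - z ∈ slit A := by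
  intro t ht
  rcases mem_contour.1 hp with ⟨h1, -⟩ | ⟨h1, h2⟩
  · rw [Complex.sub_re, h1, show z.re - Real.pi / 2 - z.re = -(Real.pi / 2) by ring, uIcc_self,
      mem_singleton_iff] at ht
    rw [ht]
    simpa using hv (p - z).im
  · have := hω t ?_
    · rwa [Complex.sub_im, h1, ← Complex.sub_im]
    · have h3 : p.re - z.re ∈ [[-(Real.pi / 2), ω.re - z.re]] := by
        rw [mem_uIcc] at h2 ⊢
        rcases h2 with ⟨a, b⟩ | ⟨a, b⟩
        · left; constructor <;> linarith
        · right; constructor <;> linarith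
      exact uIcc_subset_uIcc left_mem_uIcc h3 ht

/-- The slit condition for a translate, read off from the contour avoiding a set of points. -/
lemma sub_mem_slit_of_disjoint {A B : Set ℂ} {z ω : ℂ}
    (hd : Disjoint (contour (z.re - Real.pi / 2) ω) B)
    (h : ∀ w : ℂ, w.im = ω.im - z.im → w ∉ A → w + z ∈ B) : ω - z ∈ slit A := by
  intro t ht
  by_contra hA
  set w : ℂ := t + (ω - z).im * I
  have hre : w.re = t := by simp [w]
  have him : w.im = ω.im - z.im := by simp [w]
  refine disjoint_left.1 hd (mem_contour.2 (Or.inr ⟨?_, ?_⟩)) (h w him hA)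
  · rw [Complex.add_im, him]; ring
  · rw [Complex.add_re, hre]
    rw [Complex.sub_re] at ht
    rw [mem_uIcc] at ht ⊢
    rcases ht with ⟨a, b⟩ | ⟨a, b⟩
    · left; constructor <;> linarith
    · right; constructor <;> linarith

lemma isContinuationValue_translate {A : Set ℂ} (hA : IsOpen A)
    (hv : ∀ y : ℝ, (-(Real.pi / 2 : ℝ) + y * I : ℂ) ∈ A) {F : ℂ → ℂ}
    (hF : DifferentiableOn ℂ F (slit A)) {f : ℝ → ℂ} {z ω : ℂ}
    (hr : ∀ x : ℝ, (x : ℂ) - z ∈ slit A) (hω : ω - z ∈ slit A)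
    (hf : ∀ x ∈ Icc (-(Real.pi / 2)) (Real.pi / 2), f x = F (x - z)) :
    IsContinuationValue f (z.re - Real.pi / 2) ω (F (ω - z)) :=
  ⟨(fun w => w - z) ⁻¹' slit A, fun w => F (w - z), (isOpen_slit hA).preimage (by fun_prop), hr,
    fun _ hp => sub_mem_slit_of_mem_contour hv hω hp,
    hF.comp (by fun_prop) fun _ hw => hw, fun x hx => (hf x hx).symm, rfl⟩

lemma abs_im_lt_of_mem_contour {a r : ℝ} {ω p : ℂ} (hω : |ω.im| < r) (hp : p ∈ contour a ω) :
    |p.im| < r := by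
  rcases mem_contour.1 hp with ⟨-, h⟩ | ⟨h, -⟩
  · rw [abs_lt] at hω ⊢
    rw [mem_uIcc] at h
    rcases h with ⟨h1, h2⟩ | ⟨h1, h2⟩ <;> constructor <;> linarith
  · rwa [h]

/-- Continuation of a solution of the integral equation by means of the equation itself. -/
lemma isContinuationValue_of_add_kernelOp {η : ℝ} (hη : 0 < η) {f : ℝ → ℂ} {R : ℂ → ℂ} {V : Set ℂ}
    {a : ℝ} {ω : ℂ} (hω : |ω.im| < η)
    (hf : ContinuousOn f (Icc (-(Real.pi / 2)) (Real.pi / 2)))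
    (heq : ∀ x ∈ Icc (-(Real.pi / 2)) (Real.pi / 2), f x + kernelOp η f (x : ℝ) = R (x : ℝ))
    (hV : IsOpen V) (hr : ∀ x : ℝ, (x : ℂ) ∈ V) (hc : contour a ω ⊆ V)
    (hR : ∀ w ∈ V, |w.im| < η → DifferentiableAt ℂ R w) :
    IsContinuationValue f a ω (R ω - kernelOp η f ω) :=
  ⟨V ∩ {w : ℂ | |w.im| < η}, fun w => R w - kernelOp η f w, hV.inter (isOpen_strip η),
    fun x => ⟨hr x, show |(x : ℂ).im| < η by simpa using hη⟩,
    fun _ hp => ⟨hc hp, abs_im_lt_of_mem_contour hω hp⟩,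
    fun w hw => ((hR w hw.1 hw.2).sub (differentiableAt_kernelOp hf hw.2)).differentiableWithinAt,
    fun x hx => sub_eq_of_eq_add (heq x hx).symm, rfl⟩

/-! ### Branch points -/

lemma exists_int_of_not_mem_regularSet {c : ℝ} {w : ℂ} (h : w ∉ regularSet c) :
    ∃ m : ℤ, w = m * Real.pi - I * c ∨ w = m * Real.pi + I * c := by
  have h' : Complex.sin (w + I * c) = 0 ∨ Complex.sin (w - I * c) = 0 := by
    by_contra hcon
    push Not at hcon
    exact h hcon
  rcases h' with h' | h'
  · obtain ⟨m, hm⟩ := Complex.sin_eq_zero_iff.1 h'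
    exact ⟨m, Or.inl (by rw [← hm]; ring)⟩
  · obtain ⟨m, hm⟩ := Complex.sin_eq_zero_iff.1 h'
    exact ⟨m, Or.inr (by rw [← hm]; ring)⟩

lemma exists_int_of_not_mem_dressedRegularSet {η c : ℝ} {w : ℂ} (h : w ∉ dressedRegularSet η c) :
    ∃ (k : ℕ) (m : ℤ), w = m * Real.pi - I * (c + k * η : ℝ) ∨
      w = m * Real.pi + I * (c + k * η : ℝ) := by
  have h' : ∃ k : ℕ, w ∉ regularSet (c + k * η) := by
    by_contra hcon
    push Not at hcon
    exact h hcon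
  obtain ⟨k, hk⟩ := h'
  exact ⟨k, exists_int_of_not_mem_regularSet hk⟩

lemma dressedRegularSet_subset_regularSet (η c : ℝ) : dressedRegularSet η c ⊆ regularSet c := by
  intro w hw
  have := hw 0
  simpa using this

lemma mem_slit_of_disjoint_momentumBranchPoints {η : ℝ} {ω : ℂ}
    (h : Disjoint (contour (-(Real.pi / 2)) ω) (momentumBranchPoints η)) :
    ω ∈ slit (dressedRegularSet η (η / 2)) := by
  rw [← sub_zero ω]
  refine sub_mem_slit_of_disjoint (B := momentumBranchPoints η) (by simpa using h)
    fun w _ hw => ?_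
  obtain ⟨k, m, e | e⟩ := exists_int_of_not_mem_dressedRegularSet hw
  -- The pole at height `-(k + 1/2) η` is the branch point of index `-k - 1`.
  · exact ⟨-k - 1, m, by rw [e]; push_cast; ring⟩
  · exact ⟨k, m, by rw [e]; push_cast; ring⟩

lemma sub_mem_slit_of_disjoint_phaseBranchPoints {η : ℝ} {z ω : ℂ} (hz : |z.im| < η)
    (h : Disjoint (contour (z.re - Real.pi / 2) ω) (phaseBranchPoints η z)) :
    ω - z ∈ slit (dressedRegularSet η η) := by
  refine sub_mem_slit_of_disjoint h fun w _ hw => ?_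
  obtain ⟨k, m, e | e⟩ := exists_int_of_not_mem_dressedRegularSet hw
  · exact ⟨-k - 1, m, Or.inl ⟨hz, by omega⟩, by rw [e]; push_cast; ring⟩
  · exact ⟨k + 1, m, Or.inl ⟨hz, by omega⟩, by rw [e]; push_cast; ring⟩

lemma sub_add_mem_slit_of_disjoint_phaseBranchPoints {η : ℝ} {z ω : ℂ} (hz : η < z.im)
    (h : Disjoint (contour (z.re - Real.pi / 2) ω) (phaseBranchPoints η z)) :
    ω - (z - I * (η / 2 : ℝ)) ∈ slit (regularSet (η / 2)) := by
  refine sub_mem_slit_of_disjoint (B := phaseBranchPoints η z) (by simpa using h)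
    fun w _ hw => ?_
  obtain ⟨m, e | e⟩ := exists_int_of_not_mem_regularSet hw
  · exact ⟨-1, m, Or.inr (Or.inl ⟨hz, Or.inr rfl⟩), by rw [e]; push_cast; ring⟩
  · exact ⟨0, m, Or.inr (Or.inl ⟨hz, Or.inl rfl⟩), by rw [e]; push_cast; ring⟩

lemma sub_sub_mem_slit_of_disjoint_phaseBranchPoints {η : ℝ} {z ω : ℂ} (hz : z.im < -η)
    (h : Disjoint (contour (z.re - Real.pi / 2) ω) (phaseBranchPoints η z)) :
    ω - (z + I * (η / 2 : ℝ)) ∈ slit (regularSet (η / 2)) := by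
  refine sub_mem_slit_of_disjoint (B := phaseBranchPoints η z) (by simpa using h)
    fun w _ hw => ?_
  obtain ⟨m, e | e⟩ := exists_int_of_not_mem_regularSet hw
  · exact ⟨0, m, Or.inr (Or.inr ⟨hz, Or.inl rfl⟩), by rw [e]; push_cast; ring⟩
  · exact ⟨1, m, Or.inr (Or.inr ⟨hz, Or.inr rfl⟩), by rw [e]; push_cast; ring⟩

/-- For a wide `z` the phase `θ(· - z)` is singular at `z ± iη` modulo `π`. One of the two heights
lies outside the strip of `ω`, and the other singularity is a branch point of `φ̃`. For the
remaining `z` both are branch points. -/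
lemma sub_mem_slit_regularSet_of_disjoint {η : ℝ} {z ω : ℂ} (hz : |z.im| ≠ η) (hω : |ω.im| < η)
    (h : Disjoint (contour (z.re - Real.pi / 2) ω) (phaseBranchPoints η z)) :
    ω - z ∈ slit (regularSet η) := by
  have hω' := abs_lt.1 hω
  rcases lt_or_gt_of_ne hz with hz | hz
  · exact slit_mono (dressedRegularSet_subset_regularSet η η)
      (sub_mem_slit_of_disjoint_phaseBranchPoints hz h)
  refine sub_mem_slit_of_disjoint h fun w hw hw' => ?_
  obtain ⟨m, e | e⟩ := exists_int_of_not_mem_regularSet hw'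
  · rcases lt_abs.1 hz with hz | hz
    · exact ⟨-1, m, Or.inr (Or.inl ⟨hz, Or.inr rfl⟩), by rw [e]; push_cast; ring⟩
    · exfalso
      rw [e] at hw
      simp at hw
      linarith
  · rcases lt_abs.1 hz with hz | hz
    · exfalso
      rw [e] at hw
      simp at hw
      linarith
    · exact ⟨1, m, Or.inr (Or.inr ⟨by linarith, Or.inr rfl⟩), by rw [e]; push_cast; ring⟩

/-! ### Values of the continued functions -/

lemma momentum_eq {η : ℝ} (hη : 0 < η) {ω : ℂ}
    (h : Disjoint (contour (-(Real.pi / 2)) ω) (momentumBranchPoints η)) :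
    momentum η ω = momentumFun η ω := by
  have := isContinuationValue_translate (isOpen_dressedRegularSet hη (η / 2))
    (vertical_mem_dressedRegularSet η (η / 2)) (F := momentumFun η)
    (fun w hw => (hasDerivAt_momentumFun hη hw).differentiableAt.differentiableWithinAt)
    (f := dressedMomentum η) (z := 0) (ω := ω)
    (fun x => mem_slit_dressedRegularSet_of_abs_lt hη (by simpa using half_pos hη))
    (by rw [sub_zero]; exact mem_slit_of_disjoint_momentumBranchPoints h)
    (fun x hx => by rw [dressedMomentum_eq hη x hx, sub_zero])
  rw [sub_zero, Complex.zero_re, zero_sub] at this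
  exact this.continuation_eq

lemma phase_eq_of_abs_lt {η : ℝ} (hη : 0 < η) {z ω : ℂ} (hz : |z.im| < η)
    (h : Disjoint (contour (z.re - Real.pi / 2) ω) (phaseBranchPoints η z)) :
    phase η ω z = phaseFun η (ω - z) :=
  (isContinuationValue_translate (isOpen_dressedRegularSet hη η)
    (vertical_mem_dressedRegularSet η η)
    (fun _ hw => (hasDerivAt_phaseFun hη hw).differentiableAt.differentiableWithinAt)
    (fun x => mem_slit_dressedRegularSet_of_abs_lt hη (by simpa using hz))
    (sub_mem_slit_of_disjoint_phaseBranchPoints hz h)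
    (homDressedPhase_eq_of_abs_lt hη hz)).continuation_eq

lemma phase_eq_of_lt {η : ℝ} (hη : 0 < η) {z ω : ℂ} (hz : η < z.im)
    (h : Disjoint (contour (z.re - Real.pi / 2) ω) (phaseBranchPoints η z)) :
    phase η ω z = I * bareMomentum η (ω - z + I * (η / 2 : ℝ)) := by
  have := isContinuationValue_translate (isOpen_regularSet (η / 2))
    (vertical_mem_regularSet (η / 2)) (F := fun w => I * bareMomentum η w)
    (fun _ hw => ((hasDerivAt_bareMomentum hw).const_mul I).differentiableAt.differentiableWithinAt)
    (f := homDressedPhase η z) (z := z - I * (η / 2 : ℝ))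
    (fun x => mem_slit_regularSet_of_im (by
      have e : ((x : ℂ) - (z - I * (η / 2 : ℝ))).im = -(z.im - η / 2) := by simp
      rw [e, abs_neg, abs_of_pos (by linarith), abs_of_pos (half_pos hη)]; linarith))
    (sub_add_mem_slit_of_disjoint_phaseBranchPoints hz h)
    (fun x hx => by rw [homDressedPhase_eq_of_lt hη hz x hx, sub_add])
  have e : (z - I * (η / 2 : ℝ)).re = z.re := by simp
  rw [e] at this
  rw [sub_add]
  exact this.continuation_eq

lemma phase_eq_of_lt_neg {η : ℝ} (hη : 0 < η) {z ω : ℂ} (hz : z.im < -η)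
    (h : Disjoint (contour (z.re - Real.pi / 2) ω) (phaseBranchPoints η z)) :
    phase η ω z = I * bareMomentum η (ω - z - I * (η / 2 : ℝ)) := by
  have := isContinuationValue_translate (isOpen_regularSet (η / 2))
    (vertical_mem_regularSet (η / 2)) (F := fun w => I * bareMomentum η w)
    (fun _ hw => ((hasDerivAt_bareMomentum hw).const_mul I).differentiableAt.differentiableWithinAt)
    (f := homDressedPhase η z) (z := z + I * (η / 2 : ℝ))
    (fun x => mem_slit_regularSet_of_im (by
      have e : ((x : ℂ) - (z + I * (η / 2 : ℝ))).im = -z.im - η / 2 := by simp; ring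
      rw [e, abs_of_pos (by linarith), abs_of_pos (half_pos hη)]; linarith))
    (sub_sub_mem_slit_of_disjoint_phaseBranchPoints hz h)
    (fun x hx => by rw [homDressedPhase_eq_of_lt_neg hη hz x hx, sub_sub])
  have e : (z + I * (η / 2 : ℝ)).re = z.re := by simp
  rw [e] at this
  rw [sub_sub]
  exact this.continuation_eq

/-- The momentum in the strip `|Im ω| < η`, from the integral equation. -/
lemma momentum_eq_sub_kernelOp {η : ℝ} (hη : 0 < η) {ω : ℂ} (hω : |ω.im| < η)
    (h : Disjoint (contour (-(Real.pi / 2)) ω) (momentumBranchPoints η)) :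
    momentum η ω = bareMomentum η ω / (2 * Real.pi) -
      1 / (2 * I * Real.pi) * (1 / 2 * barePhase η (ω - (Real.pi / 2 : ℝ))) -
      kernelOp η (dressedMomentum η) ω := by
  have hs := solvesMomentumEquation_dressedMomentum hη
  have hm : -(Real.pi / 2) ∈ Icc (-(Real.pi / 2)) (Real.pi / 2) := left_mem_Icc.2 neg_pi_le_pi
  have hp : Real.pi / 2 ∈ Icc (-(Real.pi / 2)) (Real.pi / 2) := right_mem_Icc.2 neg_pi_le_pi
  refine (isContinuationValue_of_add_kernelOp hη (R := fun ω => bareMomentum η ω / (2 * Real.pi) -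
      1 / (2 * I * Real.pi) * (1 / 2 * barePhase η (ω - (Real.pi / 2 : ℝ))))
    (V := slit (regularSet (η / 2))) hω hs.1 (fun x hx => ?_)
    (isOpen_slit (isOpen_regularSet _))
    (fun x => mem_slit_regularSet_of_abs_lt (by simpa using half_pos hη))
    (contour_subset_slit (vertical_mem_regularSet _) (slit_mono
      (dressedRegularSet_subset_regularSet _ _) (mem_slit_of_disjoint_momentumBranchPoints h)))
    (fun w hw hw' => ?_)).continuation_eq
  · rw [hs.2 x hx, dressedMomentum_eq hη _ hm, dressedMomentum_eq hη _ hp,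
      momentumFun_neg_pi_div_two, momentumFun_pi_div_two hη]
    push_cast
    ring
  · have h1 : HasDerivAt (fun w : ℂ => barePhase η (w - (Real.pi / 2 : ℝ))) _ w :=
      (hasDerivAt_barePhase (mem_slit_regularSet_of_abs_lt (c := η)
        (w := w - (Real.pi / 2 : ℝ)) (by simpa using hw'))).comp_sub_const w _
    exact ((hasDerivAt_bareMomentum hw).differentiableAt.div_const _).sub
      ((h1.differentiableAt.const_mul _).const_mul _)

open Classical in
/-- The homogenised phase in the strip `|Im ω| < η`, from the integral equation. -/
lemma phase_eq_sub_kernelOp {η : ℝ} (hη : 0 < η) {z ω : ℂ} (hz : |z.im| ≠ η) (hω : |ω.im| < η)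
    (h : Disjoint (contour (z.re - Real.pi / 2) ω) (phaseBranchPoints η z)) :
    phase η ω z = barePhase η (ω - z) -
      1 / 2 * (if |z.im| < η then 1 else 0) * barePhase η (ω - (Real.pi / 2 : ℝ)) -
      kernelOp η (homDressedPhase η z) ω := by
  have hs := homDressedPhase_equation hη hz
  refine (isContinuationValue_of_add_kernelOp hη (R := fun ω => barePhase η (ω - z) -
      1 / 2 * (if |z.im| < η then 1 else 0) * barePhase η (ω - (Real.pi / 2 : ℝ)))
    (V := (fun w => w - z) ⁻¹' slit (regularSet η)) hω hs.1 hs.2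
    ((isOpen_slit (isOpen_regularSet _)).preimage (by fun_prop))
    (fun x => mem_slit_regularSet_of_im (by simpa [abs_of_pos hη] using hz))
    (fun p hp => sub_mem_slit_of_mem_contour (vertical_mem_regularSet _)
      (sub_mem_slit_regularSet_of_disjoint hz hω h) hp)
    (fun w hw hw' => ?_)).continuation_eq
  have h1 : HasDerivAt (fun w : ℂ => barePhase η (w - (Real.pi / 2 : ℝ))) _ w :=
    (hasDerivAt_barePhase (mem_slit_regularSet_of_abs_lt (c := η)
      (w := w - (Real.pi / 2 : ℝ)) (by simpa using hw'))).comp_sub_const w _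
  have h2 : HasDerivAt (fun w : ℂ => barePhase η (w - z)) _ w :=
    (hasDerivAt_barePhase hw).comp_sub_const w _
  exact h2.differentiableAt.sub (h1.differentiableAt.const_mul _)

/-! ### Functional equations -/

/-- The shifted densities add up to `cotDiff 0 = 0`, so the momentum drops out of the formulas away
from the strip. -/
lemma momentum_add_momentum {η : ℝ} (hη : 0 < η) {v : ℂ}
    (h1 : Disjoint (contour (-(Real.pi / 2)) (v + I * (η / 2 : ℝ))) (momentumBranchPoints η))
    (h2 : Disjoint (contour (-(Real.pi / 2)) (v - I * (η / 2 : ℝ))) (momentumBranchPoints η)) :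
    momentum η (v + I * (η / 2 : ℝ)) + momentum η (v - I * (η / 2 : ℝ)) = 0 := by
  have hs : ∀ w : ℂ, dressedDensity η (η / 2) (w + I * (η / 2 : ℝ)) +
      dressedDensity η (η / 2) (w - I * (η / 2 : ℝ)) = (fun _ => (0 : ℂ)) w := by
    intro w
    rw [dressedDensity_shift hη, sub_self]
    simp [cotDiff]
  have h := contourIntegral_add_shift (e := fun _ => 0) (differentiableOn_dressedDensity hη (η / 2))
    (vertical_mem_dressedRegularSet η (η / 2))
    (vertical_even (dressedDensity_neg η _) (dressedDensity_add_pi η _))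
    (mem_slit_of_disjoint_momentumBranchPoints h1) (mem_slit_of_disjoint_momentumBranchPoints h2)
    (fun _ => hs _) (fun _ _ => hs _)
  have h0 : contourIntegral (fun _ => (0 : ℂ)) v = 0 := by simp [contourIntegral]
  rw [momentum_eq hη h1, momentum_eq hη h2, momentumFun, momentumFun, ← add_div, h, h0, zero_div]

lemma regularSet_half_of_shift {η : ℝ} {w : ℂ} (h1 : w + I * (η / 2 : ℝ) ∈ dressedRegularSet η η)
    (h2 : w - I * (η / 2 : ℝ) ∈ dressedRegularSet η η) : w ∈ regularSet (η / 2) := by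
  have h1 := (dressedRegularSet_subset_regularSet _ _ h1).2
  have h2 := (dressedRegularSet_subset_regularSet _ _ h2).1
  refine ⟨?_, ?_⟩
  · convert h2 using 2; push_cast; ring
  · convert h1 using 2; push_cast; ring

lemma phase_add_phase_of_abs_lt {η : ℝ} (hη : 0 < η) {z v : ℂ} (hz : |z.im| < η)
    (h1 : Disjoint (contour (z.re - Real.pi / 2) (v + I * (η / 2 : ℝ))) (phaseBranchPoints η z))
    (h2 : Disjoint (contour (z.re - Real.pi / 2) (v - I * (η / 2 : ℝ))) (phaseBranchPoints η z)) :
    phase η (v + I * (η / 2 : ℝ)) z + phase η (v - I * (η / 2 : ℝ)) z =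
      I * bareMomentum η (v - z) := by
  have s1 := sub_mem_slit_of_disjoint_phaseBranchPoints hz h1
  have s2 := sub_mem_slit_of_disjoint_phaseBranchPoints hz h2
  rw [phase_eq_of_abs_lt hη hz h1, phase_eq_of_abs_lt hη hz h2]
  rw [show v + I * (η / 2 : ℝ) - z = v - z + I * (η / 2 : ℝ) by ring] at s1 ⊢
  rw [show v - I * (η / 2 : ℝ) - z = v - z - I * (η / 2 : ℝ) by ring] at s2 ⊢
  have hs : ∀ w : ℂ, w ∈ regularSet (η / 2) → dressedDensity η η (w + I * (η / 2 : ℝ)) +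
      dressedDensity η η (w - I * (η / 2 : ℝ)) = bareMomentumDeriv η w := by
    intro w hw
    have hw1 := hw.1
    have hw2 := hw.2
    push_cast at hw1 hw2
    rw [dressedDensity_shift hη, bareMomentumDeriv_eq_cotDiff hw1 hw2, sub_half]
  have h := contourIntegral_add_shift (e := bareMomentumDeriv η)
    (differentiableOn_dressedDensity hη η) (vertical_mem_dressedRegularSet η η)
    (vertical_even (dressedDensity_neg η _) (dressedDensity_add_pi η _)) s1 s2
    (fun y => hs _ (vertical_mem_regularSet _ y)) (fun t ht => hs _ (regularSet_half_of_shift ?_ ?_))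
  · rw [phaseFun, phaseFun, ← mul_add, h]
    rfl
  · have := s1 t (by simpa using ht)
    convert this using 1
    simp
    ring
  · have := s2 t (by simpa using ht)
    convert this using 1
    simp
    ring

/-! ### The trapezoidal rule on the preimage of a uniform grid -/

/-- The points `t 0 ≤ … ≤ t T = t 0 + π` are the preimages of `0, …, T` under an increasing
function `u` with derivative `L ρ`, where the density `ρ` is holomorphic, `π`-periodic and bounded
away from zero on the strip `|Im w| < r`. -/
structure IsGrid (L κ r : ℝ) (ρ : ℂ → ℂ) (u : ℝ → ℝ) (t : ℕ → ℝ) (T : ℕ) : Prop where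
  one_le : 1 ≤ L
  diff : DifferentiableOn ℂ ρ {w | |w.im| < r}
  per : ∀ w, ρ (w + Real.pi) = ρ w
  le_norm : ∀ w : ℂ, |w.im| < r → κ ≤ ‖ρ w‖
  deriv : ∀ s : ℝ, HasDerivAt (fun s => (u s : ℂ)) (L * ρ s) s
  mono : Monotone u
  le : ∀ a < T, t a ≤ t (a + 1)
  node : ∀ a ≤ T, u (t a) = a
  period : t T = t 0 + Real.pi

/-- The Bernoulli function `B_m` of the local grid coordinate, integrated against `g`. -/
def bernoulliSum (m : ℕ) (u : ℝ → ℝ) (t : ℕ → ℝ) (T : ℕ) (g : ℝ → ℂ) : ℂ :=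
  ∑ a ∈ Finset.range T, ∫ s in (t a)..(t (a + 1)), (bernoulliFun m (u s - a) : ℂ) * g s

lemma continuous_ofReal_of_differentiableOn {ρ : ℂ → ℂ} {r : ℝ} (hr : 0 < r)
    (h : DifferentiableOn ℂ ρ {w | |w.im| < r}) : Continuous fun s : ℝ => ρ s :=
  continuous_iff_continuousAt.2 fun s =>
    ((h.differentiableAt ((isOpen_strip r).mem_nhds (show |(s : ℂ).im| < r by simpa using hr))
      ).continuousAt).comp (f := fun s : ℝ => (s : ℂ)) Complex.continuous_ofReal.continuousAt

namespace IsGrid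

variable {L κ r : ℝ} {ρ : ℂ → ℂ} {u : ℝ → ℝ} {t : ℕ → ℝ} {T : ℕ}

lemma mono_radius (h : IsGrid L κ r ρ u t T) {r' : ℝ} (hr : r' ≤ r) :
    IsGrid L κ r' ρ u t T where
  __ := h
  diff := h.diff.mono fun _ hw => lt_of_lt_of_le hw hr
  le_norm w hw := h.le_norm w (hw.trans_le hr)

lemma continuous_u (h : IsGrid L κ r ρ u t T) : Continuous u := by
  have : Continuous fun s => (u s : ℂ) :=
    continuous_iff_continuousAt.2 fun s => (h.deriv s).continuousAt
  exact Complex.continuous_re.comp this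

lemma hasDerivAt_bernoulli (h : IsGrid L κ r ρ u t T) (m : ℕ) (a s : ℝ) :
    HasDerivAt (fun s => (bernoulliFun (m + 1) (u s - a) : ℂ))
      ((m + 1) * bernoulliFun m (u s - a) * (L * ρ s)) s := by
  have hu : HasDerivAt u (L * ρ s).re s := by
    have := Complex.reCLM.hasFDerivAt.comp_hasDerivAt s (h.deriv s)
    exact this
  -- `u` is real, hence so is its derivative `L * ρ s` on the real axis.
  have him : ((L * ρ s).re : ℂ) = L * ρ s := hu.ofReal_comp.unique (h.deriv s)
  have h1 := ((hasDerivAt_bernoulliFun (m + 1) (u s - a)).comp s (hu.sub_const a)).ofReal_comp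
  rw [← him]
  refine h1.congr_deriv ?_
  push_cast
  ring_nf

lemma sub_mem (h : IsGrid L κ r ρ u t T) {a : ℕ} (ha : a < T) {s : ℝ}
    (hs : s ∈ Icc (t a) (t (a + 1))) : u s - a ∈ Icc (0 : ℝ) 1 := by
  have h1 := h.mono hs.1
  have h2 := h.mono hs.2
  rw [h.node a ha.le] at h1
  rw [h.node (a + 1) ha] at h2
  push_cast at h2
  constructor <;> linarith

/-- Integration by parts on one cell. -/
lemma integral_cell (h : IsGrid L κ r ρ u t T) (hr : 0 < r) (m : ℕ) {a : ℕ} (ha : a < T)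
    {f f' : ℝ → ℂ} (hf : ∀ s, HasDerivAt f (f' s) s) (hf' : Continuous f') :
    (∫ s in (t a)..(t (a + 1)), (bernoulliFun m (u s - a) : ℂ) * (f s * ρ s)) =
      1 / (L * (m + 1)) * (bernoulliFun (m + 1) 1 * f (t (a + 1)) -
        bernoulliFun (m + 1) 0 * f (t a) -
        ∫ s in (t a)..(t (a + 1)), (bernoulliFun (m + 1) (u s - a) : ℂ) * f' s) := by
  have hρ := continuous_ofReal_of_differentiableOn hr h.diff
  have hu := h.continuous_u
  have hL : (L : ℂ) ≠ 0 := by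
    have := h.one_le
    exact_mod_cast (by linarith : L ≠ 0)
  have hm : (m + 1 : ℂ) ≠ 0 := Nat.cast_add_one_ne_zero m
  have hB : Continuous fun s => (bernoulliFun m (u s - a) : ℂ) :=
    Complex.continuous_ofReal.comp ((continuous_bernoulliFun m).comp (by fun_prop))
  have key := intervalIntegral.integral_mul_deriv_eq_deriv_mul (a := t a) (b := t (a + 1))
    (u := f) (u' := f') (v := fun s => (bernoulliFun (m + 1) (u s - a) : ℂ))
    (fun s _ => hf s) (fun s _ => h.hasDerivAt_bernoulli m a s) (hf'.intervalIntegrable _ _)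
    (((continuous_const.mul hB).mul (continuous_const.mul hρ)).intervalIntegrable _ _)
  have e1 : u (t (a + 1)) - a = 1 := by
    rw [h.node (a + 1) ha]; push_cast; ring
  rw [e1, h.node a ha.le, sub_self] at key
  have e2 : (∫ s in (t a)..(t (a + 1)),
      f s * ((m + 1) * bernoulliFun m (u s - a) * (L * ρ s))) =
      (L * (m + 1)) *
        ∫ s in (t a)..(t (a + 1)), (bernoulliFun m (u s - a) : ℂ) * (f s * ρ s) := by
    rw [← intervalIntegral.integral_const_mul]
    refine intervalIntegral.integral_congr fun s _ => ?_
    ring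
  have e3 : (∫ s in (t a)..(t (a + 1)), f' s * (bernoulliFun (m + 1) (u s - a) : ℂ)) =
      ∫ s in (t a)..(t (a + 1)), (bernoulliFun (m + 1) (u s - a) : ℂ) * f' s := by
    refine intervalIntegral.integral_congr fun s _ => ?_
    ring
  rw [e2, e3] at key
  rw [eq_comm, one_div, inv_mul_eq_iff_eq_mul₀ (mul_ne_zero hL hm), key]
  ring

/-- For `m ≥ 1` the Bernoulli function `B_{m+1}` takes equal values at `0` and `1`, so the boundary
terms of the cells telescope and vanish by periodicity. Each integration by parts thus gains a
factor `1 / L` at no cost. -/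
lemma bernoulliSum_mul (h : IsGrid L κ r ρ u t T) (hr : 0 < r) {m : ℕ} (hm : m ≠ 0)
    {f f' : ℝ → ℂ} (hf : ∀ s, HasDerivAt f (f' s) s) (hf' : Continuous f')
    (hper : ∀ s, f (s + Real.pi) = f s) :
    bernoulliSum m u t T (fun s => f s * ρ s) =
      -(1 / (L * (m + 1))) * bernoulliSum (m + 1) u t T f' := by
  rw [bernoulliSum, bernoulliSum]
  rw [Finset.sum_congr rfl fun a ha =>
    h.integral_cell hr m (Finset.mem_range.1 ha) hf hf']
  rw [← Finset.mul_sum, Finset.sum_sub_distrib]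
  have e : bernoulliFun (m + 1) 1 = bernoulliFun (m + 1) 0 :=
    bernoulliFun_endpoints_eq_of_ne_one (by omega)
  have e2 : ∑ a ∈ Finset.range T, ((bernoulliFun (m + 1) 1 : ℂ) * f (t (a + 1)) -
      bernoulliFun (m + 1) 0 * f (t a)) = 0 := by
    rw [e]
    rw [Finset.sum_range_sub fun a => (bernoulliFun (m + 1) 0 : ℂ) * f (t a), h.period, hper,
      sub_self]
  rw [e2]
  ring

/-- In the first integration by parts `B_1(1) = -B_1(0) = 1/2`, and the boundary terms form the
trapezoidal sum. Here `f` need not be periodic; from the next step on only `f'` matters. This allows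
quasi-periodic test functions such as the bare phase. -/
lemma bernoulliSum_one (h : IsGrid L κ r ρ u t T) (hr : 0 < r)
    {f f' : ℝ → ℂ} (hf : ∀ s, HasDerivAt f (f' s) s) (hf' : Continuous f') :
    1 / L * ∑ a ∈ Finset.range T, (f (t a) + f (t (a + 1))) / 2 -
      (∫ s in (t 0)..(t 0 + Real.pi), f s * ρ s) = 1 / L * bernoulliSum 1 u t T f' := by
  have hρ := continuous_ofReal_of_differentiableOn hr h.diff
  have hfc : Continuous f := continuous_iff_continuousAt.2 fun s => (hf s).continuousAt
  have hc : Continuous fun s : ℝ => f s * ρ s := hfc.mul hρ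
  rw [← h.period, ← intervalIntegral.sum_integral_adjacent_intervals
    (fun k _ => hc.intervalIntegrable _ _), bernoulliSum, Finset.mul_sum, Finset.mul_sum,
    ← Finset.sum_sub_distrib]
  refine Finset.sum_congr rfl fun a ha => ?_
  have := h.integral_cell hr 0 (Finset.mem_range.1 ha) hf hf'
  simp only [bernoulliFun_zero, Complex.ofReal_one, one_mul, zero_add, Nat.cast_zero, mul_one] at this
  rw [this, bernoulliFun_one, bernoulliFun_one]
  push_cast
  ring

lemma norm_bernoulliSum_le (h : IsGrid L κ r ρ u t T) {m : ℕ} {b B : ℝ} (hb : 0 ≤ b)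
    (hbm : ∀ x ∈ Icc (0 : ℝ) 1, |bernoulliFun m x| ≤ b) {g : ℝ → ℂ}
    (hg : ∀ s, ‖g s‖ ≤ B) : ‖bernoulliSum m u t T g‖ ≤ Real.pi * b * B := by
  have h1 : ∀ a ∈ Finset.range T,
      ‖∫ s in (t a)..(t (a + 1)), (bernoulliFun m (u s - a) : ℂ) * g s‖ ≤
        b * B * (t (a + 1) - t a) := by
    intro a ha
    have ha := Finset.mem_range.1 ha
    have hle := h.le a ha
    have := intervalIntegral.norm_integral_le_of_norm_le_const (a := t a) (b := t (a + 1))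
      (f := fun s => (bernoulliFun m (u s - a) : ℂ) * g s) (C := b * B) fun s hs => by
        rw [uIoc_of_le hle] at hs
        rw [norm_mul, Complex.norm_real, Real.norm_eq_abs]
        exact mul_le_mul (hbm _ (h.sub_mem ha (Ioc_subset_Icc_self hs))) (hg s) (norm_nonneg _) hb
    rwa [abs_of_nonneg (sub_nonneg.2 hle)] at this
  calc _ ≤ ∑ a ∈ Finset.range T, b * B * (t (a + 1) - t a) := norm_sum_le_of_le _ h1
    _ = Real.pi * b * B := by
      rw [← Finset.mul_sum, Finset.sum_range_sub, h.period]; ring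

end IsGrid

lemma exists_bernoulliFun_bound (m : ℕ) :
    ∃ b, 0 ≤ b ∧ ∀ x ∈ Icc (0 : ℝ) 1, |bernoulliFun m x| ≤ b := by
  obtain ⟨b, hb⟩ := isCompact_Icc.exists_bound_of_continuousOn (s := Icc (0 : ℝ) 1)
    (continuous_bernoulliFun m).continuousOn
  exact ⟨b, (norm_nonneg _).trans (hb 0 (by simp)), hb⟩

/-- Cauchy's estimate in a strip. -/
lemma norm_deriv_le_of_strip {g : ℂ → ℂ} {r B : ℝ} (hr : 0 < r)
    (hg : DifferentiableOn ℂ g {w | |w.im| < r}) (hB : ∀ w : ℂ, |w.im| < r → ‖g w‖ ≤ B)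
    {w : ℂ} (hw : |w.im| < r / 2) : ‖deriv g w‖ ≤ B / (r / 2) := by
  have hsub : ∀ z : ℂ, dist z w ≤ r / 2 → |z.im| < r := by
    intro z hz
    have h1 : |(z - w).im| ≤ r / 2 := (Complex.abs_im_le_norm _).trans (by rwa [← dist_eq_norm])
    have h2 : |z.im| ≤ |(z - w).im| + |w.im| := by
      have := abs_add_le (z - w).im w.im
      rwa [← Complex.add_im, sub_add_cancel] at this
    linarith
  refine Complex.norm_deriv_le_of_forall_mem_sphere_norm_le (half_pos hr) ?_ fun z hz =>
    hB z (hsub z hz.le)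
  refine DifferentiableOn.diffContOnCl (hg.mono ?_)
  exact (Metric.closure_ball_subset_closedBall).trans fun z hz => hsub z hz

lemma deriv_add_pi {g : ℂ → ℂ} (h : ∀ w, g (w + Real.pi) = g w) (w : ℂ) :
    deriv g (w + Real.pi) = deriv g w := by
  rw [← deriv_comp_add_const]
  congr 1
  funext w
  exact h w

/-- Dividing `g` by `ρ` brings it to the form required by `bernoulliSum_mul`. The new test function
is the derivative of `g / ρ`, bounded by Cauchy's estimate in the strip of half the width. The
constant involves only `κ`, `r`, `m` and `M`, so the estimate is uniform over all grids. -/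
lemma exists_bernoulliSum_bound {κ : ℝ} (hκ : 0 < κ) (M : ℕ) : ∀ (m : ℕ), m ≠ 0 → ∀ r : ℝ, 0 < r →
    ∃ C, 0 ≤ C ∧ ∀ (L : ℝ) (ρ : ℂ → ℂ) (u : ℝ → ℝ) (t : ℕ → ℝ) (T : ℕ), IsGrid L κ r ρ u t T →
      ∀ (g : ℂ → ℂ) (B : ℝ), DifferentiableOn ℂ g {w | |w.im| < r} →
        (∀ w, g (w + Real.pi) = g w) → (∀ w : ℂ, |w.im| < r → ‖g w‖ ≤ B) →
        ‖bernoulliSum m u t T fun s => g s‖ ≤ C * B / L ^ M := by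
  induction M with
  | zero =>
    intro m _ r hr
    obtain ⟨b, hb, hbm⟩ := exists_bernoulliFun_bound m
    refine ⟨Real.pi * b, by positivity, fun L ρ u t T h g B _ _ hB => ?_⟩
    rw [pow_zero, div_one]
    exact h.norm_bernoulliSum_le hb hbm fun s => hB s (by simpa using hr)
  | succ M ih =>
    intro m hm r hr
    obtain ⟨C, hC, hCb⟩ := ih (m + 1) m.succ_ne_zero (r / 2) (half_pos hr)
    refine ⟨C / (κ * (r / 2)), by positivity, fun L ρ u t T h g B hg hper hB => ?_⟩
    have hL : 0 < L := by linarith [h.one_le]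
    have hne : ∀ w : ℂ, |w.im| < r → ρ w ≠ 0 := fun w hw =>
      norm_pos_iff.1 (hκ.trans_le (h.le_norm w hw))
    set q : ℂ → ℂ := fun w => g w / ρ w
    have hq : DifferentiableOn ℂ q {w | |w.im| < r} := hg.div h.diff hne
    have hqper : ∀ w, q (w + Real.pi) = q w := fun w => by simp only [q, hper, h.per]
    have hqB : ∀ w : ℂ, |w.im| < r → ‖q w‖ ≤ B / κ := fun w hw => by
      rw [norm_div]
      exact div_le_div₀ ((norm_nonneg _).trans (hB w hw)) (hB w hw) hκ (h.le_norm w hw)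
    have hq' : DifferentiableOn ℂ (deriv q) {w | |w.im| < r} := hq.deriv (isOpen_strip r)
    have hmem : ∀ s : ℝ, |(s : ℂ).im| < r := fun s => by simpa using hr
    have e := h.bernoulliSum_mul hr hm (f := fun s : ℝ => q s) (f' := fun s : ℝ => deriv q s)
      (fun s => ((hq.differentiableAt ((isOpen_strip r).mem_nhds (hmem s))).hasDerivAt).comp_ofReal)
      (continuous_ofReal_of_differentiableOn hr hq')
      (fun s => by rw [Complex.ofReal_add]; exact hqper s)
    have e2 : (fun s : ℝ => q s * ρ s) = fun s : ℝ => g s :=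
      funext fun s => div_mul_cancel₀ _ (hne s (hmem s))
    have key := hCb L ρ u t T (h.mono_radius (by linarith)) (deriv q) (B / κ / (r / 2))
      (hq'.mono fun w (hw : |w.im| < r / 2) => show |w.im| < r by linarith) (deriv_add_pi hqper)
      (fun w hw => norm_deriv_le_of_strip hr hq hqB hw)
    rw [e2] at e
    rw [e, norm_mul]
    have hn : ‖-(1 / ((L : ℂ) * (m + 1)))‖ ≤ 1 / L := by
      rw [norm_neg, norm_div, norm_one, norm_mul, Complex.norm_real, Real.norm_of_nonneg hL.le]
      refine one_div_le_one_div_of_le hL ?_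
      have : (1 : ℝ) ≤ ‖(m + 1 : ℂ)‖ := by
        rw [show (m + 1 : ℂ) = ((m + 1 : ℕ) : ℂ) by push_cast; rfl, Complex.norm_natCast]
        exact_mod_cast Nat.succ_pos m
      nlinarith
    calc _ ≤ 1 / L * (C * (B / κ / (r / 2)) / L ^ M) :=
          mul_le_mul hn key (norm_nonneg _) (by positivity)
      _ = C / (κ * (r / 2)) * B / L ^ (M + 1) := by
          field_simp
          ring

/-- The trapezoidal rule on a grid is accurate to all orders in `1 / L`. -/
theorem exists_trapezoidal_bound {κ r : ℝ} (hκ : 0 < κ) (hr : 0 < r) (M : ℕ) :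
    ∃ C, 0 ≤ C ∧ ∀ (L : ℝ) (ρ : ℂ → ℂ) (u : ℝ → ℝ) (t : ℕ → ℝ) (T : ℕ), IsGrid L κ r ρ u t T →
      ∀ (f : ℝ → ℂ) (g : ℂ → ℂ) (B : ℝ), (∀ s : ℝ, HasDerivAt f (g s) s) →
        DifferentiableOn ℂ g {w | |w.im| < r} →
        (∀ w, g (w + Real.pi) = g w) → (∀ w : ℂ, |w.im| < r → ‖g w‖ ≤ B) →
        ‖1 / L * ∑ a ∈ Finset.range T, (f (t a) + f (t (a + 1))) / 2 -
          ∫ s in (t 0)..(t 0 + Real.pi), f s * ρ s‖ ≤ C * B / L ^ M := by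
  obtain ⟨C, hC, h⟩ := exists_bernoulliSum_bound hκ M 1 one_ne_zero r hr
  refine ⟨C, hC, fun L ρ u t T hgrid f g B hf hg hper hB => ?_⟩
  rw [hgrid.bernoulliSum_one hr hf (continuous_ofReal_of_differentiableOn hr hg), norm_mul]
  have hL := hgrid.one_le
  have h1 : ‖(1 / L : ℂ)‖ ≤ 1 := by
    rw [norm_div, norm_one, Complex.norm_real, Real.norm_of_nonneg (by linarith)]
    exact div_le_one_of_le₀ hL (by linarith)
  exact (mul_le_of_le_one_left (norm_nonneg _) h1).trans (h L ρ u t T hgrid g B hg hper hB)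

/-! ### The counting function on the real axis -/

/-- The hypotheses on the Bethe roots. -/
structure IsAdmissible (η α ϰ τ : ℝ) (L N : ℕ) (μ : Fin N → ℂ) (ι : ℤ) (x : ℝ) (ν : ℕ → ℝ) :
    Prop where
  bethe : IsBetheSolution η α L N μ
  gap : ∀ a ∈ complexRoots μ, τ ≤ |(|(μ a).im| - η)|
  incr : IsUniformlyIncreasing ϰ η α L N μ
  par : IsRealParametrisation η α L N μ ι x ν

/-- The density of the Bethe roots, the derivative of the counting function. -/
def density (η : ℝ) (L : ℕ) {N : ℕ} (μ : Fin N → ℂ) (w : ℂ) : ℂ :=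
  bareMomentumDeriv η w / (2 * Real.pi) - 1 / L * ∑ k, kernel η (w - μ k)

lemma hasDerivAt_countingFunction {η α : ℝ} {L N : ℕ} {μ : Fin N → ℂ} {w : ℂ}
    (h1 : w ∈ slit (regularSet (η / 2))) (h2 : ∀ k, w - μ k ∈ slit (regularSet η)) :
    HasDerivAt (countingFunction η α L N μ) (density η L μ w) w := by
  have hs : HasDerivAt (fun w => ∑ k, barePhase η (w - μ k))
      (∑ k, 2 * I * Real.pi * kernel η (w - μ k)) w :=
    HasDerivAt.fun_sum fun k _ => (hasDerivAt_barePhase (h2 k)).comp_sub_const w (μ k)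
  refine ((((hasDerivAt_bareMomentum h1).div_const (2 * Real.pi : ℂ)).sub
    (hs.const_mul (1 / (2 * I * Real.pi * L)))).add_const _).congr_deriv ?_
  rw [density, ← Finset.mul_sum]
  congr 1
  have hpi : (Real.pi : ℂ) ≠ 0 := by exact_mod_cast Real.pi_ne_zero
  rcases eq_or_ne (L : ℂ) 0 with h | h
  · simp [h]
  · field_simp

lemma density_add_pi (η : ℝ) (L : ℕ) {N : ℕ} (μ : Fin N → ℂ) (w : ℂ) :
    density η L μ (w + Real.pi) = density η L μ w := by
  rw [density, density, bareMomentumDeriv_add_pi]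
  congr 2
  refine Finset.sum_congr rfl fun k _ => ?_
  rw [show w + Real.pi - μ k = w - μ k + Real.pi by ring, kernel_add_pi]

/-- Half the distance between the imaginary parts of the roots and `±η`. -/
def stripRadius (η τ : ℝ) : ℝ := min τ η / 2

lemma stripRadius_pos {η τ : ℝ} (hη : 0 < η) (hτ : 0 < τ) : 0 < stripRadius η τ :=
  half_pos (lt_min hτ hη)

lemma stripRadius_le (η τ : ℝ) : stripRadius η τ ≤ η / 2 := by
  have := min_le_right τ η
  rw [stripRadius]; linarith

namespace IsAdmissible

variable {η α ϰ τ : ℝ} {L N : ℕ} {μ : Fin N → ℂ} {ι : ℤ} {x : ℝ} {ν : ℕ → ℝ}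

lemma le_abs_im_sub (h : IsAdmissible η α ϰ τ L N μ ι x ν) (hη : 0 < η) (k : Fin N) :
    2 * stripRadius η τ ≤ |(|(μ k).im| - η)| := by
  rw [stripRadius, mul_div_cancel₀ _ two_ne_zero]
  by_cases hk : (μ k).im = 0
  · rw [hk, abs_zero, zero_sub, abs_neg, abs_of_pos hη]
    exact min_le_right _ _
  · exact (min_le_left _ _).trans (h.gap k (by simp [complexRoots, hk]))

lemma abs_im_ne (h : IsAdmissible η α ϰ τ L N μ ι x ν) (hη : 0 < η) (hτ : 0 < τ) (k : Fin N) :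
    |(μ k).im| ≠ η := by
  intro e
  have := h.le_abs_im_sub hη k
  rw [e, sub_self, abs_zero] at this
  linarith [stripRadius_pos hη hτ]

lemma le_abs_im_sub_of_lt (h : IsAdmissible η α ϰ τ L N μ ι x ν) (hη : 0 < η) {w : ℂ}
    (hw : |w.im| < stripRadius η τ) (k : Fin N) :
    stripRadius η τ ≤ |(|(w - μ k).im| - |η|)| := by
  have h1 := h.le_abs_im_sub hη k
  have h2 : |(|(w - μ k).im| - |(μ k).im|)| ≤ |w.im| := by
    have := abs_abs_sub_abs_le (w - μ k).im (-(μ k).im)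
    rwa [abs_neg, sub_neg_eq_add, Complex.sub_im, sub_add_cancel] at this
  rw [abs_of_pos hη]
  have h3 := abs_sub_abs_le_abs_sub (|(μ k).im| - η) (|(μ k).im| - |(w - μ k).im|)
  rw [show |(μ k).im| - η - (|(μ k).im| - |(w - μ k).im|) = |(w - μ k).im| - η by ring,
    abs_sub_comm (|(μ k).im|) (|(w - μ k).im|)] at h3
  linarith

lemma sub_mem_slit (h : IsAdmissible η α ϰ τ L N μ ι x ν) (hη : 0 < η) (hτ : 0 < τ) {w : ℂ}
    (hw : |w.im| < stripRadius η τ) (k : Fin N) : w - μ k ∈ slit (regularSet η) := by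
  apply mem_slit_regularSet_of_im
  intro e
  have := h.le_abs_im_sub_of_lt hη hw k
  rw [e, sub_self, abs_zero] at this
  linarith [stripRadius_pos hη hτ]

lemma hasDerivAt (h : IsAdmissible η α ϰ τ L N μ ι x ν) (hη : 0 < η) (hτ : 0 < τ) {w : ℂ}
    (hw : |w.im| < stripRadius η τ) :
    HasDerivAt (countingFunction η α L N μ) (density η L μ w) w :=
  hasDerivAt_countingFunction
    (mem_slit_regularSet_of_abs_lt (hw.trans_le (stripRadius_le η τ)))
    (h.sub_mem_slit hη hτ hw)

lemma differentiableOn_density (h : IsAdmissible η α ϰ τ L N μ ι x ν) (hη : 0 < η) (hτ : 0 < τ) :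
    DifferentiableOn ℂ (density η L μ) {w | |w.im| < stripRadius η τ} := by
  have : ∀ w ∈ {w : ℂ | |w.im| < stripRadius η τ},
      deriv (countingFunction η α L N μ) w = density η L μ w :=
    fun w hw => (h.hasDerivAt hη hτ hw).deriv
  have hd : DifferentiableOn ℂ (countingFunction η α L N μ) {w | |w.im| < stripRadius η τ} :=
    fun w hw => (h.hasDerivAt hη hτ hw).differentiableAt.differentiableWithinAt
  exact (hd.deriv (isOpen_strip _)).congr fun w hw => (this w hw).symm

lemma L_pos (h : IsAdmissible η α ϰ τ L N μ ι x ν) : (0 : ℝ) < L := by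
  exact_mod_cast h.bethe.length_pos

lemma L_ne_zero (h : IsAdmissible η α ϰ τ L N μ ι x ν) : (L : ℂ) ≠ 0 := by
  exact_mod_cast h.bethe.length_pos.ne'

lemma N_le (h : IsAdmissible η α ϰ τ L N μ ι x ν) : (N : ℝ) ≤ L := by
  have := h.bethe.length_eq
  exact_mod_cast (by omega : N ≤ L)

/-- `N ≤ L`, so the normalised sum over the roots is bounded independently of `L`. This makes the
bounds on the density uniform. -/
lemma norm_sum_le (h : IsAdmissible η α ϰ τ L N μ ι x ν) {f : Fin N → ℂ} {B : ℝ} (hB : 0 ≤ B)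
    (hf : ∀ k, ‖f k‖ ≤ B) : ‖(1 / L : ℂ) * ∑ k, f k‖ ≤ B := by
  have h1 : ‖∑ k, f k‖ ≤ N * B := by
    refine (norm_sum_le_of_le _ fun k _ => hf k).trans ?_
    simp
  rw [norm_mul, norm_div, norm_one, Complex.norm_natCast, one_div, inv_mul_le_iff₀ h.L_pos]
  exact h1.trans (mul_le_mul_of_nonneg_right h.N_le hB)

end IsAdmissible

/-- A bound on the density in the strip `|Im w| < stripRadius η τ / 2`. -/
def densityBound (η τ : ℝ) : ℝ :=
  |Real.sinh η| / (η / 4 * (η / 4)) / (2 * Real.pi) +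
    |Real.sinh (2 * η)| / (2 * Real.pi * stripRadius η τ * stripRadius η τ)

lemma densityBound_pos {η τ : ℝ} (hη : 0 < η) (hτ : 0 < τ) : 0 < densityBound η τ := by
  have h1 := stripRadius_pos hη hτ
  have h2 : 0 < |Real.sinh η| := abs_pos.2 (Real.sinh_pos_iff.2 hη).ne'
  have := Real.pi_pos
  rw [densityBound]
  positivity

namespace IsAdmissible

variable {η α ϰ τ : ℝ} {L N : ℕ} {μ : Fin N → ℂ} {ι : ℤ} {x : ℝ} {ν : ℕ → ℝ}

lemma norm_density_le (h : IsAdmissible η α ϰ τ L N μ ι x ν) (hη : 0 < η) (hτ : 0 < τ) {w : ℂ}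
    (hw : |w.im| < stripRadius η τ / 2) : ‖density η L μ w‖ ≤ densityBound η τ := by
  have hr := stripRadius_pos hη hτ
  have hr' := stripRadius_le η τ
  refine (norm_sub_le _ _).trans (add_le_add ?_ ?_)
  · have : ‖bareMomentumDeriv η w‖ ≤ |Real.sinh η| / (η / 4 * (η / 4)) :=
      norm_bareMomentumDeriv_le η (by positivity : 0 < η / 4) (by
        rw [abs_of_pos (half_pos hη), abs_sub_comm]
        exact le_trans (by linarith) (le_abs_self _))
    rw [norm_div]
    have e : ‖(2 * Real.pi : ℂ)‖ = 2 * Real.pi := by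
      rw [norm_mul, Complex.norm_real, Real.norm_of_nonneg Real.pi_pos.le]; simp
    rw [e]
    gcongr
  · exact h.norm_sum_le (by positivity) fun k =>
      norm_kernel_le η hr (h.le_abs_im_sub_of_lt hη (by linarith) k)

open Classical in
lemma card_close (h : IsAdmissible η α ϰ τ L N μ ι x ν) (hη : 0 < η) (hτ : 0 < τ) :
    (Finset.univ.filter fun k => |(μ k).im| < η).card + wideCount η μ = N := by
  have h1 := Finset.card_filter_add_card_filter_not (s := (Finset.univ : Finset (Fin N)))
    (fun k => |(μ k).im| < η)
  rw [Finset.card_univ, Fintype.card_fin] at h1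
  have h2 : (Finset.univ.filter fun k => ¬|(μ k).im| < η) =
      Finset.univ.filter fun k => η < |(μ k).im| := by
    refine Finset.filter_congr fun k _ => ?_
    rw [not_lt]
    exact ⟨fun h' => lt_of_le_of_ne h' (h.abs_im_ne hη hτ k).symm, le_of_lt⟩
  rw [h2] at h1
  exact h1

/-- The bare momentum contributes `L / L`, and each of the `N - n_w` roots with `|Im μ_k| < η`
removes `1 / L`; with `L = 2N` there remain `N + n_w` units, which is the number of points `ν_a` in
a period. -/
lemma countingFunction_add_pi (h : IsAdmissible η α ϰ τ L N μ ι x ν) (hη : 0 < η) (hτ : 0 < τ)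
    (s : ℝ) : countingFunction η α L N μ ((s : ℂ) + Real.pi) =
      countingFunction η α L N μ s + (N + wideCount η μ : ℕ) / L := by
  classical
  have hL := h.L_ne_zero
  have hpi : (Real.pi : ℂ) ≠ 0 := by exact_mod_cast Real.pi_ne_zero
  have h1 : bareMomentum η ((s : ℂ) + Real.pi) = bareMomentum η s + 2 * Real.pi :=
    bareMomentum_add_pi_of_abs_lt (by simpa using half_pos hη)
  have h2 : ∑ k, barePhase η ((s : ℂ) + Real.pi - μ k) = ∑ k, barePhase η ((s : ℂ) - μ k) +
      (N - wideCount η μ) * (2 * I * Real.pi) := by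
    have hk : ∀ k, barePhase η ((s : ℂ) + Real.pi - μ k) = barePhase η ((s : ℂ) - μ k) +
        if |(μ k).im| < η then 2 * I * Real.pi else 0 := by
      intro k
      have him : |((s : ℂ) - μ k).im| = |(μ k).im| := by simp
      rw [show (s : ℂ) + Real.pi - μ k = s - μ k + Real.pi by ring]
      split_ifs with hk
      · exact barePhase_add_pi_of_abs_lt (by rwa [him])
      · rw [add_zero]
        exact barePhase_add_pi_of_lt_abs hη (by
          rw [him]
          exact lt_of_le_of_ne (not_lt.1 hk) (h.abs_im_ne hη hτ k).symm)
    rw [Finset.sum_congr rfl fun k _ => hk k, Finset.sum_add_distrib, ← Finset.sum_filter,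
      Finset.sum_const, nsmul_eq_mul]
    have hc := h.card_close hη hτ
    congr 2
    rw [eq_sub_iff_add_eq]
    exact_mod_cast hc
  have hLN : (L : ℂ) = 2 * N := by exact_mod_cast h.bethe.length_eq
  rw [countingFunction, countingFunction, h1, h2]
  push_cast
  field_simp
  rw [hLN]
  ring

end IsAdmissible

lemma forall_of_periodic {F : ℝ → ℝ} (hF : Function.Periodic F Real.pi) {p : ℝ → Prop}
    (h : ∀ s ∈ Icc (-(Real.pi / 2)) (Real.pi / 2), p (F s)) (s : ℝ) : p (F s) := by
  obtain ⟨y, hy, e⟩ := hF.exists_mem_Ico Real.pi_pos s (-(Real.pi / 2))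
  rw [e]
  exact h y ⟨hy.1, by have := hy.2; linarith⟩

namespace IsAdmissible

variable {η α ϰ τ : ℝ} {L N : ℕ} {μ : Fin N → ℂ} {ι : ℤ} {x : ℝ} {ν : ℕ → ℝ}

lemma im_countingFunction (h : IsAdmissible η α ϰ τ L N μ ι x ν) (hη : 0 < η) (hτ : 0 < τ)
    (s : ℝ) : (countingFunction η α L N μ s).im = 0 := by
  refine forall_of_periodic (F := fun s : ℝ => (countingFunction η α L N μ s).im)
    (p := fun y => y = 0) (fun s => ?_) (fun s hs => (h.incr s hs).1) s
  simp only
  rw [Complex.ofReal_add, h.countingFunction_add_pi hη hτ]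
  have : (((N + wideCount η μ : ℕ) : ℂ) / L).im = 0 := by
    rw [← Complex.ofReal_natCast, ← Complex.ofReal_natCast, ← Complex.ofReal_div, Complex.ofReal_im]
  rw [Complex.add_im, this, add_zero]

lemma lt_re_density (h : IsAdmissible η α ϰ τ L N μ ι x ν) (hη : 0 < η) (hτ : 0 < τ)
    (s : ℝ) : ϰ < (density η L μ s).re := by
  refine forall_of_periodic (F := fun s : ℝ => (density η L μ s).re)
    (p := fun y => ϰ < y) (fun s => ?_) (fun s hs => ?_) s
  · simp only
    rw [Complex.ofReal_add, density_add_pi]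
  · rw [← (h.hasDerivAt hη hτ (w := s) (by simpa using stripRadius_pos hη hτ)).deriv]
    exact (h.incr s hs).2

end IsAdmissible

/-- The counting function on the real axis, as a real function. -/
def realCounting (η α : ℝ) (L N : ℕ) (μ : Fin N → ℂ) (s : ℝ) : ℝ :=
  (countingFunction η α L N μ s).re

namespace IsAdmissible

variable {η α ϰ τ : ℝ} {L N : ℕ} {μ : Fin N → ℂ} {ι : ℤ} {x : ℝ} {ν : ℕ → ℝ}

lemma ofReal_realCounting (h : IsAdmissible η α ϰ τ L N μ ι x ν) (hη : 0 < η) (hτ : 0 < τ)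
    (s : ℝ) : (realCounting η α L N μ s : ℂ) = countingFunction η α L N μ s := by
  refine Complex.ext (by simp [realCounting]) ?_
  rw [h.im_countingFunction hη hτ, Complex.ofReal_im]

lemma hasDerivAt_realCounting (h : IsAdmissible η α ϰ τ L N μ ι x ν) (hη : 0 < η) (hτ : 0 < τ)
    (s : ℝ) : HasDerivAt (fun s => (realCounting η α L N μ s : ℂ)) (density η L μ s) s := by
  simp only [h.ofReal_realCounting hη hτ]
  exact (h.hasDerivAt hη hτ (w := s) (by simpa using stripRadius_pos hη hτ)).comp_ofReal

lemma strictMono_realCounting (h : IsAdmissible η α ϰ τ L N μ ι x ν) (hη : 0 < η) (hτ : 0 < τ)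
    (hϰ : 0 < ϰ) : StrictMono (realCounting η α L N μ) := by
  refine strictMono_of_deriv_pos fun s => ?_
  have := Complex.reCLM.hasFDerivAt.comp_hasDerivAt s (h.hasDerivAt_realCounting hη hτ s)
  have h2 : HasDerivAt (realCounting η α L N μ) (density η L μ s).re s := this
  rw [h2.deriv]
  exact hϰ.trans (h.lt_re_density hη hτ s)

lemma realCounting_add_pi (h : IsAdmissible η α ϰ τ L N μ ι x ν) (hη : 0 < η) (hτ : 0 < τ)
    (s : ℝ) : realCounting η α L N μ (s + Real.pi) =
      realCounting η α L N μ s + (N + wideCount η μ : ℕ) / L := by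
  have h1 := h.countingFunction_add_pi hη hτ s
  rw [← h.ofReal_realCounting hη hτ, ← Complex.ofReal_add, ← h.ofReal_realCounting hη hτ] at h1
  apply Complex.ofReal_injective
  rw [h1]
  push_cast
  rfl

lemma realCounting_node (h : IsAdmissible η α ϰ τ L N μ ι x ν) (hη : 0 < η) (hτ : 0 < τ)
    {a : ℕ} (ha : a ∈ Finset.Icc 1 (N + wideCount η μ)) :
    realCounting η α L N μ (ν a) = (a - ι) / L := by
  have h1 := h.par.value a ha
  rw [← h.ofReal_realCounting hη hτ] at h1
  exact_mod_cast h1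

lemma N_pos (h : IsAdmissible η α ϰ τ L N μ ι x ν) : 0 < N := by
  have h1 := h.bethe.length_pos
  have h2 := h.bethe.length_eq
  omega

/-- The Bethe equations for a real root. -/
lemma exp_countingFunction (h : IsAdmissible η α ϰ τ L N μ ι x ν) (hη : 0 < η) (hτ : 0 < τ)
    {k : Fin N} (hk : (μ k).im = 0) :
    Complex.exp (2 * Real.pi * I * (L * countingFunction η α L N μ (μ k))) = 1 := by
  have hL := h.L_ne_zero
  have hpi : (Real.pi : ℂ) ≠ 0 := by exact_mod_cast Real.pi_ne_zero
  -- The additive constant of the counting function contributes `e^{iπ - 2πiα}`, which cancels the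
  -- left-hand side of the Bethe equations.
  have e : 2 * Real.pi * I * (L * countingFunction η α L N μ (μ k)) =
      L * (I * bareMomentum η (μ k)) + -∑ j, barePhase η (μ k - μ j) +
        (Real.pi * I + -(2 * I * Real.pi * α)) := by
    rw [countingFunction]
    field_simp
    ring
  have hm : |(μ k).im| < stripRadius η τ := by rw [hk, abs_zero]; exact stripRadius_pos hη hτ
  have h1 := exp_bareMomentum (mem_slit_regularSet_of_abs_lt (hm.trans_le (stripRadius_le η τ)))
  have h2 : ∀ j, Complex.exp (barePhase η (μ k - μ j)) = _ := fun j =>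
    exp_barePhase (h.sub_mem_slit hη hτ hm j)
  rw [e, Complex.exp_add, Complex.exp_add, Complex.exp_add, Complex.exp_nat_mul, h1,
    Complex.exp_neg, Complex.exp_sum, Finset.prod_congr rfl fun j _ => h2 j, Complex.exp_pi_mul_I,
    ← Finset.prod_inv_distrib, Complex.exp_neg]
  simp only [inv_div]
  have hb := h.bethe.bethe k
  have hne := Complex.exp_ne_zero (2 * I * Real.pi * α)
  rw [← hb]
  field_simp

/-- Both `ν_1` and the last `ν_T` lie in `[-π/2, π/2)`. Monotonicity at `ν_1` gives `L ξ̂(-π/2) ≤ 1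
- ι`, and at `ν_T`, with the increment `T / L` over a period, `-ι < L ξ̂(-π/2)`. An integer value of
`L ξ̂` on the period is therefore `a - ι` with `1 ≤ a ≤ T`, so no real root falls off the list. -/
lemma realCounting_bounds (h : IsAdmissible η α ϰ τ L N μ ι x ν) (hη : 0 < η) (hτ : 0 < τ)
    (hϰ : 0 < ϰ) {s : ℝ} (hs : s ∈ Ico (-(Real.pi / 2)) (Real.pi / 2)) :
    -ι < L * realCounting η α L N μ s ∧
      L * realCounting η α L N μ s < 1 - ι + (N + wideCount η μ : ℕ) := by
  have hmono := h.strictMono_realCounting hη hτ hϰ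
  have hN := h.N_pos
  have hL := h.L_pos
  set T := N + wideCount η μ
  have h1 : 1 ∈ Finset.Icc 1 T := Finset.mem_Icc.2 ⟨le_rfl, by omega⟩
  have hT : T ∈ Finset.Icc 1 T := Finset.mem_Icc.2 ⟨by omega, le_rfl⟩
  have hp := h.realCounting_add_pi hη hτ (-(Real.pi / 2))
  rw [show -(Real.pi / 2) + Real.pi = Real.pi / 2 by ring] at hp
  have b1 := hmono.monotone (h.par.mem 1 h1).2.1
  have b2 := hmono (h.par.mem T hT).2.2
  rw [h.realCounting_node hη hτ h1, le_div_iff₀ hL] at b1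
  rw [h.realCounting_node hη hτ hT, hp, div_lt_iff₀ hL, add_mul, div_mul_cancel₀ _ hL.ne'] at b2
  have c1 := hmono.monotone hs.1
  have c2 := hmono hs.2
  rw [hp] at c2
  have c3 := mul_le_mul_of_nonneg_left c1 hL.le
  have c4 := mul_lt_mul_of_pos_left c2 hL
  rw [mul_add, mul_div_cancel₀ _ hL.ne'] at c4
  push_cast at b1
  constructor <;> linarith

/-- The real roots are among the `ν_a`. -/
lemma exists_node_eq (h : IsAdmissible η α ϰ τ L N μ ι x ν) (hη : 0 < η) (hτ : 0 < τ)
    (hϰ : 0 < ϰ) {k : Fin N} (hk : (μ k).im = 0) :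
    ∃ a ∈ Finset.Icc 1 (N + wideCount η μ), μ k = (ν a : ℂ) := by
  have hμ : μ k = ((μ k).re : ℂ) := Complex.ext (by simp) (by simpa using hk)
  obtain ⟨m, hm⟩ := Complex.exp_eq_one_iff.1 (h.exp_countingFunction hη hτ hk)
  have hpi : (2 * Real.pi * I : ℂ) ≠ 0 := Complex.two_pi_I_ne_zero
  have hm' : (L : ℂ) * countingFunction η α L N μ (μ k) = m := by
    apply mul_left_cancel₀ hpi
    rw [hm]; ring
  rw [hμ, ← h.ofReal_realCounting hη hτ] at hm'
  have hm2 : (L : ℝ) * realCounting η α L N μ (μ k).re = m := by exact_mod_cast hm'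
  have hb := h.realCounting_bounds hη hτ hϰ (h.bethe.re_mem k)
  rw [hm2] at hb
  have b1 : -ι < m := by exact_mod_cast hb.1
  have b2 : m < 1 - ι + (N + wideCount η μ : ℕ) := by exact_mod_cast hb.2
  obtain ⟨a, ha⟩ := Int.eq_ofNat_of_zero_le (show 0 ≤ m + ι by linarith)
  have haT : a ∈ Finset.Icc 1 (N + wideCount η μ) := Finset.mem_Icc.2 (by omega)
  refine ⟨a, haT, ?_⟩
  rw [hμ]
  congr 1
  refine (h.strictMono_realCounting hη hτ hϰ).injective ?_
  rw [h.realCounting_node hη hτ haT, eq_div_iff h.L_pos.ne', mul_comm, hm2]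
  have : (m : ℝ) + ι = a := by exact_mod_cast ha
  linarith

open Classical in
lemma sum_node (h : IsAdmissible η α ϰ τ L N μ ι x ν) (hη : 0 < η) (hτ : 0 < τ)
    (hϰ : 0 < ϰ) (f : ℂ → ℂ) :
    ∑ a ∈ Finset.Icc 1 (N + wideCount η μ), f (ν a) =
      ∑ a ∈ holes η μ ν, f (ν a) + ∑ k ∈ Finset.univ.filter (fun k => (μ k).im = 0), f (μ k) := by
  rw [← Finset.sum_filter_add_sum_filter_not _ fun a => ∀ j, μ j ≠ (ν a : ℂ)]
  congr 1
  symm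
  choose! φ hφ hφ' using fun (k : Fin N) (hk : (μ k).im = 0) => h.exists_node_eq hη hτ hϰ hk
  refine Finset.sum_bij (fun k _ => φ k) ?_ ?_ ?_ ?_
  · intro k hk
    have hk := (Finset.mem_filter.1 hk).2
    refine Finset.mem_filter.2 ⟨hφ k hk, ?_⟩
    push Not
    exact ⟨k, hφ' k hk⟩
  · intro k hk j hj e
    have hk := (Finset.mem_filter.1 hk).2
    have hj := (Finset.mem_filter.1 hj).2
    exact h.bethe.injective (by rw [hφ' k hk, hφ' j hj, e])
  · intro a ha
    obtain ⟨ha1, ha2⟩ := Finset.mem_filter.1 ha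
    push Not at ha2
    obtain ⟨k, hk⟩ := ha2
    have him : (μ k).im = 0 := by rw [hk, Complex.ofReal_im]
    refine ⟨k, Finset.mem_filter.2 ⟨Finset.mem_univ _, him⟩, ?_⟩
    have e : ν (φ k) = ν a := by
      have := hφ' k him
      rw [hk] at this
      exact_mod_cast this.symm
    have e1 := h.realCounting_node hη hτ (hφ k him)
    rw [e, h.realCounting_node hη hτ ha1, div_left_inj' h.L_pos.ne'] at e1
    have : (a : ℝ) = φ k := by linarith
    exact_mod_cast this.symm
  · intro k hk
    rw [hφ' k (Finset.mem_filter.1 hk).2]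

/-- The grid has `N + n_w` points, of which the real roots occupy `N - n`. This count balances the
half phases `θ(ω - π/2)` in `countingFunction_sub_source`. -/
lemma card_holes (h : IsAdmissible η α ϰ τ L N μ ι x ν) (hη : 0 < η) (hτ : 0 < τ)
    (hϰ : 0 < ϰ) : (holes η μ ν).card = wideCount η μ + (complexRoots μ).card := by
  classical
  have h1 := h.sum_node hη hτ hϰ fun _ => 1
  simp only [Finset.sum_const, Nat.card_Icc, nsmul_eq_mul, mul_one] at h1
  have h2 := Finset.card_filter_add_card_filter_not (s := (Finset.univ : Finset (Fin N)))
    (fun k => (μ k).im = 0)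
  rw [Finset.card_univ, Fintype.card_fin] at h2
  have h3 : complexRoots μ = Finset.univ.filter fun k => ¬(μ k).im = 0 := by
    simp [complexRoots]
  rw [h3]
  have h1' : N + wideCount η μ + 1 - 1 = (holes η μ ν).card +
    (Finset.univ.filter fun k => (μ k).im = 0).card := by exact_mod_cast h1
  omega

end IsAdmissible

/-! ### The grid of the points `ν_a` -/

/-- The points `ν_1, …, ν_T`, followed by `ν_1 + π`. -/
def gridNode (ν : ℕ → ℝ) (T a : ℕ) : ℝ := if a < T then ν (a + 1) else ν 1 + Real.pi

/-- The width of the strip on which the density stays away from zero. -/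
def gridRadius (η τ ϰ : ℝ) : ℝ :=
  min (stripRadius η τ / 4) (ϰ / 2 / (densityBound η τ / (stripRadius η τ / 4)))

lemma gridRadius_pos {η τ ϰ : ℝ} (hη : 0 < η) (hτ : 0 < τ) (hϰ : 0 < ϰ) :
    0 < gridRadius η τ ϰ := by
  have := stripRadius_pos hη hτ
  have := densityBound_pos hη hτ
  exact lt_min (by positivity) (by positivity)

namespace IsAdmissible

variable {η α ϰ τ : ℝ} {L N : ℕ} {μ : Fin N → ℂ} {ι : ℤ} {x : ℝ} {ν : ℕ → ℝ}

/-- On the real axis `Re ρ > ϰ`. The second entry of `gridRadius` is `ϰ / 2` divided by Cauchy's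
bound for `ρ'`, so moving vertically by less than this radius costs at most half of the lower bound.
-/
lemma le_norm_density (h : IsAdmissible η α ϰ τ L N μ ι x ν) (hη : 0 < η) (hτ : 0 < τ)
    {w : ℂ} (hw : |w.im| < gridRadius η τ ϰ) : ϰ / 2 ≤ ‖density η L μ w‖ := by
  have hr := stripRadius_pos hη hτ
  have hb := densityBound_pos hη hτ
  have hw1 : |w.im| < stripRadius η τ / 4 := hw.trans_le (min_le_left _ _)
  have hw2 : |w.im| < ϰ / 2 / (densityBound η τ / (stripRadius η τ / 4)) :=
    hw.trans_le (min_le_right _ _)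
  have hconv : Convex ℝ {w : ℂ | |w.im| < stripRadius η τ / 4} := by
    have e : {w : ℂ | |w.im| < stripRadius η τ / 4} =
        Complex.imLm ⁻¹' Ioo (-(stripRadius η τ / 4)) (stripRadius η τ / 4) := by
      ext w; simp [abs_lt]
    rw [e]
    exact (convex_Ioo _ _).linear_preimage _
  have hd : DifferentiableOn ℂ (density η L μ) {w | |w.im| < stripRadius η τ / 2} :=
    (h.differentiableOn_density hη hτ).mono fun w (hw : |w.im| < stripRadius η τ / 2) =>
      show |w.im| < stripRadius η τ by linarith
  have hbd : ∀ w ∈ {w : ℂ | |w.im| < stripRadius η τ / 4},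
      ‖deriv (density η L μ) w‖ ≤ densityBound η τ / (stripRadius η τ / 4) := by
    intro w (hw : |w.im| < stripRadius η τ / 4)
    have := norm_deriv_le_of_strip (half_pos hr) hd (fun w hw => h.norm_density_le hη hτ hw)
      (w := w) (by linarith)
    convert this using 2
    ring
  have key := hconv.norm_image_sub_le_of_norm_deriv_le (𝕜 := ℂ) (f := density η L μ)
    (fun w (hw : |w.im| < stripRadius η τ / 4) => hd.differentiableAt
      ((isOpen_strip _).mem_nhds (show |w.im| < stripRadius η τ / 2 by linarith))) hbd
    (x := (w.re : ℂ)) (y := w) (by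
      show |((w.re : ℝ) : ℂ).im| < _
      rw [Complex.ofReal_im, abs_zero]
      positivity) hw1
  have hn : ‖w - w.re‖ = |w.im| := by
    have : w - w.re = w.im * I := by
      rw [sub_eq_iff_eq_add, add_comm, Complex.re_add_im]
    rw [this, norm_mul, Complex.norm_I, mul_one, Complex.norm_real, Real.norm_eq_abs]
  rw [hn] at key
  rw [lt_div_iff₀ (by positivity), mul_comm] at hw2
  have h1 : ϰ < ‖density η L μ (w.re : ℂ)‖ :=
    (h.lt_re_density hη hτ w.re).trans_le (Complex.re_le_norm _)
  have h2 := norm_sub_norm_le (density η L μ (w.re : ℂ)) (density η L μ w)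
  rw [norm_sub_rev] at h2
  linarith

/-- The normalisation puts `ν_1` at `0`: the node of index `a` is `ν_{a+1}`, and the last one is
`ν_1 + π`. -/
lemma isGrid (h : IsAdmissible η α ϰ τ L N μ ι x ν) (hη : 0 < η) (hτ : 0 < τ) (hϰ : 0 < ϰ) :
    IsGrid L (ϰ / 2) (gridRadius η τ ϰ) (density η L μ)
      (fun s => L * realCounting η α L N μ s - (1 - ι)) (gridNode ν (N + wideCount η μ))
      (N + wideCount η μ) := by
  have hL := h.L_pos
  have hN := h.N_pos
  have hr := stripRadius_pos hη hτ
  have hmono := h.strictMono_realCounting hη hτ hϰ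
  set T := N + wideCount η μ with hTdef
  have hnode : ∀ a ≤ T, L * realCounting η α L N μ (gridNode ν T a) - (1 - ι) = a := by
    intro a ha
    rw [gridNode]
    split_ifs with haT
    · rw [h.realCounting_node hη hτ (Finset.mem_Icc.2 ⟨by omega, haT⟩), mul_div_cancel₀ _ hL.ne']
      push_cast; ring
    · have : a = T := by omega
      rw [h.realCounting_add_pi hη hτ, h.realCounting_node hη hτ (Finset.mem_Icc.2 ⟨le_rfl, by omega⟩),
        ← hTdef, mul_add, mul_div_cancel₀ _ hL.ne', mul_div_cancel₀ _ hL.ne', this]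
      push_cast; ring
  refine ⟨?_, ?_, density_add_pi η L μ, fun w hw => h.le_norm_density hη hτ hw, fun s => ?_, ?_,
    fun a ha => ?_, hnode, ?_⟩
  · exact_mod_cast h.bethe.length_pos
  · refine (h.differentiableOn_density hη hτ).mono fun w (hw : |w.im| < _) => ?_
    have := hw.trans_le (min_le_left _ _)
    exact show |w.im| < stripRadius η τ by linarith
  · have := ((h.hasDerivAt_realCounting hη hτ s).const_mul (L : ℂ)).sub_const ((1 - ι : ℝ) : ℂ)
    refine (this.congr_of_eventuallyEq (Eventually.of_forall fun s => ?_)).congr_deriv (by simp)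
    push_cast
    ring
  · intro s s' hs
    have := mul_le_mul_of_nonneg_left (hmono.monotone hs) hL.le
    simp only
    linarith
  · refine hmono.le_iff_le.1 ?_
    have h1 := hnode a ha.le
    have h2 := hnode (a + 1) ha
    push_cast at h2
    refine le_of_mul_le_mul_left ?_ hL
    linarith
  · rw [gridNode, gridNode, if_neg (lt_irrefl _), if_pos (by omega)]

end IsAdmissible

/-- `ν_1` and its translate `ν_1 + π` each carry weight one half. The resulting correction vanishes
for a periodic `f` but not for the bare phase. -/
lemma sum_gridNode (ν : ℕ → ℝ) {T : ℕ} (hT : 0 < T) (f : ℝ → ℂ) :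
    ∑ a ∈ Finset.range T, (f (gridNode ν T a) + f (gridNode ν T (a + 1))) / 2 =
      ∑ a ∈ Finset.Icc 1 T, f (ν a) + (f (ν 1 + Real.pi) - f (ν 1)) / 2 := by
  have h1 : ∑ a ∈ Finset.range T, f (gridNode ν T a) = ∑ a ∈ Finset.Icc 1 T, f (ν a) := by
    rw [← Finset.Ico_add_one_right_eq_Icc, Finset.sum_Ico_eq_sum_range]
    refine Finset.sum_congr rfl fun a ha => ?_
    rw [gridNode, if_pos (by simpa using ha), add_comm]
  have h2 := Finset.sum_range_sub (fun a => f (gridNode ν T a)) T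
  rw [Finset.sum_sub_distrib, h1] at h2
  have e1 : gridNode ν T T = ν 1 + Real.pi := if_neg (lt_irrefl _)
  have e2 : gridNode ν T 0 = ν 1 := by rw [gridNode, if_pos hT]
  rw [e1, e2] at h2
  rw [← Finset.sum_div, Finset.sum_add_distrib, h1]
  linear_combination h2 / 2

/-- Sums over the points `ν_a` are integrals against the density, to all orders in `1 / L`. -/
theorem exists_sum_sub_integral_bound {η ϰ τ r : ℝ} (hη : 0 < η) (hϰ : 0 < ϰ) (hτ : 0 < τ)
    (hr : 0 < r) (M : ℕ) : ∃ C, 0 ≤ C ∧ ∀ (α : ℝ) (L N : ℕ) (μ : Fin N → ℂ) (ι : ℤ) (x : ℝ)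
      (ν : ℕ → ℝ), IsAdmissible η α ϰ τ L N μ ι x ν →
      ∀ (f : ℝ → ℂ) (g : ℂ → ℂ) (B : ℝ), (∀ s : ℝ, HasDerivAt f (g s) s) →
        DifferentiableOn ℂ g {w | |w.im| < r} →
        (∀ w, g (w + Real.pi) = g w) → (∀ w : ℂ, |w.im| < r → ‖g w‖ ≤ B) →
        ‖1 / (L : ℂ) * (∑ a ∈ Finset.Icc 1 (N + wideCount η μ), f (ν a) +
            (f (ν 1 + Real.pi) - f (ν 1)) / 2) -
          ∫ s in (ν 1)..(ν 1 + Real.pi), f s * density η L μ s‖ ≤ C * B / (L : ℝ) ^ M := by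
  obtain ⟨C, hC, h⟩ := exists_trapezoidal_bound (half_pos hϰ)
    (lt_min (gridRadius_pos hη hτ hϰ) hr) M
  refine ⟨C, hC, fun α L N μ ι x ν ha f g B hf hg hper hB => ?_⟩
  have hN : 0 < N + wideCount η μ := Nat.add_pos_left ha.N_pos _
  have := h L _ _ _ _ ((ha.isGrid hη hτ hϰ).mono_radius (min_le_left _ r)) f g B hf
    (hg.mono fun w (hw : |w.im| < _) => hw.trans_le (min_le_right _ _)) hper
    (fun w hw => hB w (hw.trans_le (min_le_right _ _)))
  rw [sum_gridNode ν hN] at this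
  have e2 : gridNode ν (N + wideCount η μ) 0 = ν 1 := by rw [gridNode, if_pos hN]
  rw [e2] at this
  simpa only [Complex.ofReal_natCast] using this

/-! ### The strip around the real axis -/

lemma kernelOp_sum {η : ℝ} {ι : Type*} (S : Finset ι) {f : ι → ℝ → ℂ}
    (hf : ∀ i ∈ S, ContinuousOn (f i) (Icc (-(Real.pi / 2)) (Real.pi / 2))) {w : ℂ}
    (hw : |w.im| < η) :
    kernelOp η (fun s => ∑ i ∈ S, f i s) w = ∑ i ∈ S, kernelOp η (f i) w := by
  simp only [kernelOp, Finset.mul_sum]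
  exact intervalIntegral.integral_finsetSum fun i hi => kernelOp_integrable (hf i hi) hw

/-- The asymptotic counting function on `[-π/2, π/2]`. -/
def realAsymptotic (η α : ℝ) (L : ℕ) {N : ℕ} (μ : Fin N → ℂ) (ι : ℤ) (ν : ℕ → ℝ) (s : ℝ) : ℂ :=
  dressedMomentum η s +
    1 / (2 * I * Real.pi * L) * (∑ a ∈ holes η μ ν, homDressedPhase η (ν a) s -
      ∑ a ∈ complexRoots μ, homDressedPhase η (μ a) s) + (1 - α - ι) / (2 * L)

open Classical in
/-- The image of the asymptotic counting function under `I + K`. -/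
def asymptoticSource (η α : ℝ) (L : ℕ) {N : ℕ} (μ : Fin N → ℂ) (ι : ℤ) (ν : ℕ → ℝ) (ω : ℂ) : ℂ :=
  bareMomentum η ω / (2 * Real.pi) -
      1 / (2 * I * Real.pi) * (1 / 2 * barePhase η (ω - (Real.pi / 2 : ℝ))) +
    1 / (2 * I * Real.pi * L) *
      (∑ a ∈ holes η μ ν, (barePhase η (ω - ν a) - 1 / 2 * barePhase η (ω - (Real.pi / 2 : ℝ))) -
      ∑ a ∈ complexRoots μ, (barePhase η (ω - μ a) -
        1 / 2 * (if |(μ a).im| < η then 1 else 0) * barePhase η (ω - (Real.pi / 2 : ℝ)))) +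
    (1 - α - ι) / L

/-- The defect of the counting function in the integral equation of its asymptotic form. -/
def sourceDefect (η α : ℝ) (L : ℕ) {N : ℕ} (μ : Fin N → ℂ) (ι : ℤ) (ν : ℕ → ℝ) (ω : ℂ) : ℂ :=
  countingFunction η α L N μ ω + kernelOp η (fun s => countingFunction η α L N μ s) ω -
    asymptoticSource η α L μ ι ν ω

namespace IsAdmissible

variable {η α ϰ τ : ℝ} {L N : ℕ} {μ : Fin N → ℂ} {ι : ℤ} {x : ℝ} {ν : ℕ → ℝ}

lemma abs_ofReal_im_lt {η : ℝ} (hη : 0 < η) (x : ℝ) : |(x : ℂ).im| < η := by simpa using hη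

lemma continuousOn_realAsymptotic (h : IsAdmissible η α ϰ τ L N μ ι x ν) (hη : 0 < η)
    (hτ : 0 < τ) :
    ContinuousOn (realAsymptotic η α L μ ι ν) (Icc (-(Real.pi / 2)) (Real.pi / 2)) :=
  ((solvesMomentumEquation_dressedMomentum hη).1.add (continuousOn_const.mul
    ((continuousOn_finsetSum _ fun a _ =>
        (homDressedPhase_equation hη (abs_ofReal_im_lt hη (ν a)).ne).1).sub
      (continuousOn_finsetSum _ fun k _ =>
        (homDressedPhase_equation hη (h.abs_im_ne hη hτ k)).1)))).add continuousOn_const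

lemma kernelOp_realAsymptotic (h : IsAdmissible η α ϰ τ L N μ ι x ν) (hη : 0 < η)
    (hτ : 0 < τ) {w : ℂ} (hw : |w.im| < η) :
    kernelOp η (realAsymptotic η α L μ ι ν) w = kernelOp η (dressedMomentum η) w +
      1 / (2 * I * Real.pi * L) * (∑ a ∈ holes η μ ν, kernelOp η (homDressedPhase η (ν a)) w -
        ∑ a ∈ complexRoots μ, kernelOp η (homDressedPhase η (μ a)) w) +
      (1 - α - ι) / (2 * L) := by
  have c1 := (solvesMomentumEquation_dressedMomentum hη).1
  have c2 : ∀ a ∈ holes η μ ν, ContinuousOn (fun s => homDressedPhase η (ν a) s)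
      (Icc (-(Real.pi / 2)) (Real.pi / 2)) := fun a _ =>
    (homDressedPhase_equation hη (abs_ofReal_im_lt hη (ν a)).ne).1
  have c3 : ∀ a ∈ complexRoots μ, ContinuousOn (fun s => homDressedPhase η (μ a) s)
      (Icc (-(Real.pi / 2)) (Real.pi / 2)) := fun k _ =>
    (homDressedPhase_equation hη (h.abs_im_ne hη hτ k)).1
  have c2' := continuousOn_finsetSum _ c2
  have c3' := continuousOn_finsetSum _ c3
  have c4 : ContinuousOn (fun s => 1 / (2 * I * Real.pi * L) *
      (∑ a ∈ holes η μ ν, homDressedPhase η (ν a) s -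
        ∑ a ∈ complexRoots μ, homDressedPhase η (μ a) s)) (Icc (-(Real.pi / 2)) (Real.pi / 2)) :=
    continuousOn_const.mul (c2'.sub c3')
  have c5 : ContinuousOn (fun s => dressedMomentum η s + 1 / (2 * I * Real.pi * L) *
      (∑ a ∈ holes η μ ν, homDressedPhase η (ν a) s -
        ∑ a ∈ complexRoots μ, homDressedPhase η (μ a) s)) (Icc (-(Real.pi / 2)) (Real.pi / 2)) :=
    c1.add c4
  have e1 : kernelOp η (realAsymptotic η α L μ ι ν) w = _ :=
    kernelOp_add c5 (continuousOn_const (c := ((1 - α - ι) / (2 * L) : ℂ))) hw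
  rw [e1, kernelOp_add c1 c4 hw, kernelOp_const_mul, kernelOp_sub c2' c3' hw, kernelOp_sum _ c2 hw,
    kernelOp_sum _ c3 hw, kernelOp_const _ hw]

lemma realAsymptotic_eq (h : IsAdmissible η α ϰ τ L N μ ι x ν) (hη : 0 < η) (hτ : 0 < τ)
    {s : ℝ} (hs : s ∈ Icc (-(Real.pi / 2)) (Real.pi / 2)) :
    realAsymptotic η α L μ ι ν s + kernelOp η (realAsymptotic η α L μ ι ν) s =
      asymptoticSource η α L μ ι ν s := by
  have hL := h.L_ne_zero
  have hm : -(Real.pi / 2) ∈ Icc (-(Real.pi / 2)) (Real.pi / 2) := left_mem_Icc.2 neg_pi_le_pi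
  have hp : Real.pi / 2 ∈ Icc (-(Real.pi / 2)) (Real.pi / 2) := right_mem_Icc.2 neg_pi_le_pi
  have e1 := (solvesMomentumEquation_dressedMomentum hη).2 s hs
  rw [dressedMomentum_eq hη _ hm, dressedMomentum_eq hη _ hp, momentumFun_neg_pi_div_two,
    momentumFun_pi_div_two hη] at e1
  have e2 := Finset.sum_congr rfl fun a (_ : a ∈ holes η μ ν) =>
    (homDressedPhase_equation hη (abs_ofReal_im_lt hη (ν a)).ne).2 s hs
  have e3 := Finset.sum_congr rfl fun k (_ : k ∈ complexRoots μ) =>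
    (homDressedPhase_equation hη (h.abs_im_ne hη hτ k)).2 s hs
  simp only [if_pos (abs_ofReal_im_lt hη _), mul_one] at e2
  rw [h.kernelOp_realAsymptotic hη hτ (abs_ofReal_im_lt hη s), realAsymptotic, asymptoticSource,
    ← e2, ← e3, Finset.sum_add_distrib, Finset.sum_add_distrib]
  have e4 : bareMomentum η s / (2 * Real.pi) -
      1 / (2 * I * Real.pi) * (1 / 2 * barePhase η (s - (Real.pi / 2 : ℝ))) =
      dressedMomentum η s + kernelOp η (dressedMomentum η) s := by
    rw [e1]
    push_cast
    ring
  rw [e4]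
  field_simp
  ring

lemma asymptoticCountingFunction_eq (h : IsAdmissible η α ϰ τ L N μ ι x ν) (hη : 0 < η)
    (hτ : 0 < τ) {ω : ℂ} (hω : |ω.im| < η) (hr : IsRegularPoint η μ ν ω) :
    asymptoticCountingFunction η α L μ ι ν ω = asymptoticSource η α L μ ι ν ω -
      kernelOp η (realAsymptotic η α L μ ι ν) ω := by
  have hL := h.L_ne_zero
  have e2 := Finset.sum_congr rfl fun a (ha : a ∈ holes η μ ν) =>
    phase_eq_sub_kernelOp hη (abs_ofReal_im_lt hη (ν a)).ne hω
      (by rw [Complex.ofReal_re]; exact hr.holes a ha)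
  have e3 := Finset.sum_congr rfl fun k (hk : k ∈ complexRoots μ) =>
    phase_eq_sub_kernelOp hη (h.abs_im_ne hη hτ k) hω (hr.roots k hk)
  simp only [if_pos (abs_ofReal_im_lt hη _), mul_one] at e2
  rw [h.kernelOp_realAsymptotic hη hτ hω, asymptoticCountingFunction, asymptoticSource,
    momentum_eq_sub_kernelOp hη hω hr.momentum, e2, e3, Finset.sum_sub_distrib (f := fun a =>
      barePhase η (ω - ν a) - 1 / 2 * barePhase η (ω - (Real.pi / 2 : ℝ))),
    Finset.sum_sub_distrib (f := fun a => barePhase η (ω - μ a) -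
        1 / 2 * (if |(μ a).im| < η then 1 else 0) * barePhase η (ω - (Real.pi / 2 : ℝ)))]
  field_simp
  ring

open Classical in
lemma card_close_complexRoots (h : IsAdmissible η α ϰ τ L N μ ι x ν) (hη : 0 < η) (hτ : 0 < τ) :
    ((complexRoots μ).filter fun k => |(μ k).im| < η).card + wideCount η μ =
      (complexRoots μ).card := by
  rw [← Finset.card_filter_add_card_filter_not (s := complexRoots μ) (fun k => |(μ k).im| < η)]
  have e : (Finset.univ.filter fun k => η < |(μ k).im|) =
      (complexRoots μ).filter fun k => ¬|(μ k).im| < η := by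
    ext k
    simp only [complexRoots, Finset.mem_filter, Finset.mem_univ, true_and, not_lt]
    exact ⟨fun hk => ⟨fun h0 => by rw [h0, abs_zero] at hk; linarith, hk.le⟩,
      fun hk => lt_of_le_of_ne hk.2 (h.abs_im_ne hη hτ k).symm⟩
  rw [← e, wideCount]

open Classical in
lemma sum_roots (μ : Fin N → ℂ) (f : ℂ → ℂ) : ∑ k, f (μ k) =
    ∑ k ∈ Finset.univ.filter (fun k => (μ k).im = 0), f (μ k) + ∑ k ∈ complexRoots μ, f (μ k) := by
  rw [← Finset.sum_filter_add_sum_filter_not _ fun k => (μ k).im = 0]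
  rfl

/-- The counting function against the source of its asymptotic form. -/
lemma countingFunction_sub_source (h : IsAdmissible η α ϰ τ L N μ ι x ν) (hη : 0 < η) (hτ : 0 < τ)
    (hϰ : 0 < ϰ) (ω : ℂ) :
    countingFunction η α L N μ ω - asymptoticSource η α L μ ι ν ω =
      1 / (2 * I * Real.pi * L) * ((N + wideCount η μ : ℕ) * barePhase η (ω - (Real.pi / 2 : ℝ)) -
        ∑ a ∈ Finset.Icc 1 (N + wideCount η μ), barePhase η (ω - ν a)) +
      (2 * ι - 1) / (2 * L) := by
  classical
  have hL := h.L_ne_zero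
  have hpi : (Real.pi : ℂ) ≠ 0 := by exact_mod_cast Real.pi_ne_zero
  have e1 := sum_roots μ fun w => barePhase η (ω - w)
  have e2 := h.sum_node hη hτ hϰ fun w => barePhase η (ω - w)
  have e3 : ∑ a ∈ complexRoots μ, 1 / 2 * (if |(μ a).im| < η then 1 else 0) *
      barePhase η (ω - (Real.pi / 2 : ℝ)) = 1 / 2 * ((complexRoots μ).card - wideCount η μ) *
      barePhase η (ω - (Real.pi / 2 : ℝ)) := by
    rw [← Finset.sum_mul, ← Finset.mul_sum, ← Finset.sum_filter, Finset.sum_const, nsmul_eq_mul,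
      mul_one, ← h.card_close_complexRoots hη hτ]
    push_cast
    ring
  -- In units of `1 / (2πi L)` and with `n` complex roots, the source contains `θ(ω - π/2)` with the
  -- coefficient `-L/2 - (n_w + n)/2 + (n - n_w)/2 = -(N + n_w)`: one term for each grid point.
  have hc : ((holes η μ ν).card : ℂ) = wideCount η μ + (complexRoots μ).card := by
    exact_mod_cast h.card_holes hη hτ hϰ
  have hLN : (L : ℂ) = 2 * N := by exact_mod_cast h.bethe.length_eq
  rw [countingFunction, asymptoticSource, e1, e2, Finset.sum_sub_distrib, Finset.sum_sub_distrib,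
    e3, Finset.sum_const, nsmul_eq_mul, hc]
  have hN : (N : ℂ) = L / 2 := by rw [hLN]; ring
  push_cast
  rw [hN]
  field_simp
  ring

lemma continuous_density (h : IsAdmissible η α ϰ τ L N μ ι x ν) (hη : 0 < η) (hτ : 0 < τ) :
    Continuous fun s : ℝ => density η L μ s :=
  continuous_ofReal_of_differentiableOn (stripRadius_pos hη hτ) (h.differentiableOn_density hη hτ)

lemma integral_density (h : IsAdmissible η α ϰ τ L N μ ι x ν) (hη : 0 < η) (hτ : 0 < τ) (a b : ℝ) :
    (∫ s in a..b, density η L μ s) =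
      countingFunction η α L N μ b - countingFunction η α L N μ a := by
  rw [← h.ofReal_realCounting hη hτ, ← h.ofReal_realCounting hη hτ]
  exact intervalIntegral.integral_eq_sub_of_hasDerivAt
    (fun s _ => h.hasDerivAt_realCounting hη hτ s)
    ((h.continuous_density hη hτ).intervalIntegrable _ _)

lemma continuous_countingFunction (h : IsAdmissible η α ϰ τ L N μ ι x ν) (hη : 0 < η)
    (hτ : 0 < τ) : Continuous fun s : ℝ => countingFunction η α L N μ s := by
  simp only [← h.ofReal_realCounting hη hτ]
  exact continuous_iff_continuousAt.2 fun s => (h.hasDerivAt_realCounting hη hτ s).continuousAt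

end IsAdmissible

lemma hasDerivAt_barePhase_sub {η : ℝ} {ω : ℂ} (hω : |ω.im| < η) (s : ℝ) :
    HasDerivAt (fun s : ℝ => barePhase η (ω - s)) (-(2 * I * Real.pi * kernel η (ω - s))) s := by
  have h1 := hasDerivAt_barePhase (mem_slit_regularSet_of_abs_lt (c := η) (w := ω - s)
    (by simpa using hω))
  have h2 : HasDerivAt (fun s : ℂ => ω - s) (-1) (s : ℂ) := (hasDerivAt_id _).const_sub _
  have h3 := (h1.comp (s : ℂ) h2).comp_ofReal
  rw [mul_neg_one] at h3
  exact h3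

namespace IsAdmissible

variable {η α ϰ τ : ℝ} {L N : ℕ} {μ : Fin N → ℂ} {ι : ℤ} {x : ℝ} {ν : ℕ → ℝ}

/-- The defect is an error of the trapezoidal rule. -/
theorem sourceDefect_eq (h : IsAdmissible η α ϰ τ L N μ ι x ν) (hη : 0 < η) (hτ : 0 < τ)
    (hϰ : 0 < ϰ) {ω : ℂ} (hω : |ω.im| < η) :
    2 * I * Real.pi * sourceDefect η α L μ ι ν ω =
      -(1 / (L : ℂ) * (∑ a ∈ Finset.Icc 1 (N + wideCount η μ), barePhase η (ω - ν a) +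
            (barePhase η (ω - ((ν 1 + Real.pi : ℝ) : ℂ)) - barePhase η (ω - ν 1)) / 2) -
          ∫ s in (ν 1)..(ν 1 + Real.pi), barePhase η (ω - s) * density η L μ s) := by
  have hL := h.L_ne_zero
  have hpi : (Real.pi : ℂ) ≠ 0 := by exact_mod_cast Real.pi_ne_zero
  have hρ := h.continuous_density hη hτ
  have hθ : Continuous fun s : ℝ => barePhase η (ω - s) :=
    continuous_iff_continuousAt.2 fun s => (hasDerivAt_barePhase_sub hω s).continuousAt
  have hθρ : Continuous fun s : ℝ => barePhase η (ω - s) * density η L μ s := hθ.mul hρ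
  have hshift : ∀ s : ℝ, barePhase η (ω - ((s + Real.pi : ℝ) : ℂ)) =
      barePhase η (ω - s) - 2 * I * Real.pi := by
    intro s
    have := barePhase_add_pi_of_abs_lt (η := η) (w := ω - ((s + Real.pi : ℝ) : ℂ))
      (by simpa using hω)
    rw [show ω - ((s + Real.pi : ℝ) : ℂ) + Real.pi = ω - s by push_cast; ring] at this
    rw [this]; ring
  -- Integration by parts converts `K ξ̂` into the integral of `θ(ω - s)` against the density, plus
  -- boundary terms.
  have hk := integral_kernel_mul hω (g := fun s : ℝ => countingFunction η α L N μ s)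
    (g' := fun s : ℝ => density η L μ s) (a := -(Real.pi / 2)) (b := Real.pi / 2)
    (fun s _ => by
      have := h.hasDerivAt_realCounting hη hτ s
      simpa only [h.ofReal_realCounting hη hτ] using this) hρ.continuousOn
  -- The window `[-π/2, π/2]` is moved to `[ν_1, ν_1 + π]`. Quasi-periodicity of the phase costs
  -- `2πi (ξ̂(ν_1) - ξ̂(-π/2))`, where `ξ̂(ν_1) = (1 - ι)/L` is known and `ξ̂(-π/2)` cancels against
  -- the boundary terms of `hk`.
  have hw1 : (∫ s in (Real.pi / 2)..(ν 1 + Real.pi), barePhase η (ω - s) * density η L μ s) =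
      (∫ s in (-(Real.pi / 2))..(ν 1), barePhase η (ω - s) * density η L μ s) -
        2 * I * Real.pi * ∫ s in (-(Real.pi / 2))..(ν 1), density η L μ s := by
    rw [← intervalIntegral.integral_const_mul, ← intervalIntegral.integral_sub
      (hθρ.intervalIntegrable _ _) ((hρ.const_mul _).intervalIntegrable _ _)]
    have := intervalIntegral.integral_comp_add_right (a := -(Real.pi / 2)) (b := ν 1)
      (fun s : ℝ => barePhase η (ω - s) * density η L μ s) Real.pi
    rw [show -(Real.pi / 2) + Real.pi = Real.pi / 2 by ring] at this
    rw [← this]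
    refine intervalIntegral.integral_congr fun s _ => ?_
    rw [hshift, Complex.ofReal_add, density_add_pi]
    ring
  have hw2 := intervalIntegral.integral_add_adjacent_intervals
    (hθρ.intervalIntegrable (μ := volume) (-(Real.pi / 2)) (ν 1))
    (hθρ.intervalIntegrable (ν 1) (ν 1 + Real.pi))
  have hw3 := intervalIntegral.integral_add_adjacent_intervals
    (hθρ.intervalIntegrable (μ := volume) (-(Real.pi / 2)) (Real.pi / 2))
    (hθρ.intervalIntegrable (Real.pi / 2) (ν 1 + Real.pi))
  rw [h.integral_density hη hτ] at hw1
  have h1 : 1 ∈ Finset.Icc 1 (N + wideCount η μ) :=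
    Finset.mem_Icc.2 ⟨le_rfl, Nat.add_pos_left h.N_pos _⟩
  rw [h.par.value 1 h1] at hw1
  have hX := h.countingFunction_add_pi hη hτ (-(Real.pi / 2))
  have e1 : ((-(Real.pi / 2) : ℝ) : ℂ) + Real.pi = ((Real.pi / 2 : ℝ) : ℂ) := by push_cast; ring
  rw [e1] at hX
  have hs := hshift (-(Real.pi / 2))
  rw [show -(Real.pi / 2) + Real.pi = Real.pi / 2 by ring] at hs
  have hd := h.countingFunction_sub_source hη hτ hϰ ω
  have hdef : 2 * I * Real.pi * sourceDefect η α L μ ι ν ω =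
      2 * I * Real.pi * (countingFunction η α L N μ ω - asymptoticSource η α L μ ι ν ω) +
      2 * I * Real.pi * kernelOp η (fun s => countingFunction η α L N μ s) ω := by
    rw [sourceDefect]; ring
  rw [hdef, hd]
  have hk' : 2 * I * Real.pi * kernelOp η (fun s => countingFunction η α L N μ s) ω = _ := hk
  rw [hk', hX, hshift]
  have hb : barePhase η (ω - ((-(Real.pi / 2) : ℝ) : ℂ)) =
      barePhase η (ω - ((Real.pi / 2 : ℝ) : ℂ)) + 2 * I * Real.pi := by
    rw [hs]; ring
  rw [hb]
  generalize hJ : (∫ s in (-(Real.pi / 2))..(Real.pi / 2), barePhase η (ω - s) * density η L μ s)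
    = J at *
  generalize hW : (∫ s in (ν 1)..(ν 1 + Real.pi), barePhase η (ω - s) * density η L μ s) = W at *
  have hJW : J = W + 2 * I * Real.pi *
      (((1 : ℕ) - ι) / L - countingFunction η α L N μ ((-(Real.pi / 2) : ℝ) : ℂ)) := by
    linear_combination hw3 - hw2 - hw1
  rw [hJW]
  field_simp
  push_cast
  ring

end IsAdmissible

/-- For `|Im ω| ≤ η - δ` and `|Im s| < δ/2` the argument `ω - s` stays at distance at least `δ/2`
from the poles of the kernel, so the derivative of the test function `θ(ω - s)` is bounded by a
constant depending on `η` and `δ` only. -/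
theorem exists_sourceDefect_bound {η ϰ τ δ : ℝ} (hη : 0 < η) (hϰ : 0 < ϰ) (hτ : 0 < τ)
    (hδ : 0 < δ) (M : ℕ) : ∃ C, 0 ≤ C ∧ ∀ (α : ℝ) (L N : ℕ) (μ : Fin N → ℂ) (ι : ℤ) (x : ℝ)
      (ν : ℕ → ℝ), IsAdmissible η α ϰ τ L N μ ι x ν → ∀ ω : ℂ, |ω.im| ≤ η - δ →
        ‖sourceDefect η α L μ ι ν ω‖ ≤ C / (L : ℝ) ^ M := by
  obtain ⟨C, hC, hb⟩ := exists_sum_sub_integral_bound hη hϰ hτ (half_pos hδ) M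
  set B : ℝ := 2 * Real.pi * (|Real.sinh (2 * η)| / (2 * Real.pi * (δ / 2) * (δ / 2)))
  have hpi := Real.pi_pos
  have hn : ‖(2 * I * Real.pi : ℂ)‖ = 2 * Real.pi := by
    rw [norm_mul, norm_mul, Complex.norm_I, Complex.norm_real, Real.norm_of_nonneg hpi.le]; simp
  refine ⟨C * B / (2 * Real.pi), by positivity, fun α L N μ ι x ν h ω hω => ?_⟩
  have hω' : |ω.im| < η := by linarith
  have him : ∀ w : ℂ, |w.im| < δ / 2 → |(ω - w).im| < η - δ / 2 := by
    intro w hw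
    have := abs_sub ω.im w.im
    rw [Complex.sub_im]
    linarith
  have key := hb α L N μ ι x ν h (fun s => barePhase η (ω - s))
    (fun w => -(2 * I * Real.pi * kernel η (ω - w))) B (hasDerivAt_barePhase_sub hω')
    (fun w hw => by
      have hw' := him w hw
      have : DifferentiableAt ℂ (fun w => kernel η (ω - w)) w :=
        DifferentiableAt.comp (f := fun w : ℂ => ω - w) w
          ((differentiableOn_kernel η).differentiableAt ((isOpen_regularSet η).mem_nhds
            (mem_regularSet_of_abs_lt (by linarith)))) (by fun_prop)
      exact ((this.const_mul _).neg).differentiableWithinAt)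
    (fun w => by
      rw [← kernel_add_pi η (ω - (w + Real.pi))]
      congr 3; ring)
    (fun w hw => by
      rw [norm_neg, norm_mul, hn]
      refine mul_le_mul_of_nonneg_left (norm_kernel_le η (half_pos hδ) ?_) (by positivity)
      rw [abs_of_pos hη, abs_sub_comm]
      exact le_trans (by linarith [him w hw]) (le_abs_self _))
  have e := h.sourceDefect_eq hη hτ hϰ hω'
  have e2 : 2 * Real.pi * ‖sourceDefect η α L μ ι ν ω‖ ≤ C * B / (L : ℝ) ^ M := by
    rw [← hn, ← norm_mul, e, norm_neg]
    exact key
  calc _ = 2 * Real.pi * ‖sourceDefect η α L μ ι ν ω‖ / (2 * Real.pi) := by field_simp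
    _ ≤ C * B / (L : ℝ) ^ M / (2 * Real.pi) := by gcongr
    _ = _ := by ring

/-- The asymptotic formula in the strip around the real axis. -/
theorem exists_bound_of_abs_le {η ϰ τ δ : ℝ} (hη : 0 < η) (hϰ : 0 < ϰ) (hτ : 0 < τ)
    (hδ : 0 < δ) (M : ℕ) : ∃ C, 0 ≤ C ∧ ∀ (α : ℝ) (L N : ℕ) (μ : Fin N → ℂ) (ι : ℤ) (x : ℝ)
      (ν : ℕ → ℝ), IsAdmissible η α ϰ τ L N μ ι x ν → ∀ ω : ℂ, |ω.im| ≤ η - δ →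
        IsRegularPoint η μ ν ω →
        ‖countingFunction η α L N μ ω - asymptoticCountingFunction η α L μ ι ν ω‖ ≤
          C / (L : ℝ) ^ M := by
  obtain ⟨C, hC, hb⟩ := exists_sourceDefect_bound hη hϰ hτ hδ M
  have hpi := Real.pi_pos
  set κ : ℝ := |Real.sinh (2 * η)| / (2 * Real.pi * δ * δ)
  have hκ : 0 ≤ κ := by positivity
  have hst := stabilityConst_pos hη
  refine ⟨C + Real.pi * (κ * (stabilityConst η * C)), by positivity,
    fun α L N μ ι x ν h ω hω hr => ?_⟩
  have hω' : |ω.im| < η := by linarith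
  have hL := h.L_pos
  set D : ℝ → ℂ := fun s => countingFunction η α L N μ s - realAsymptotic η α L μ ι ν s
  have c1 := (h.continuous_countingFunction hη hτ).continuousOn
    (s := Icc (-(Real.pi / 2)) (Real.pi / 2))
  have c2 := h.continuousOn_realAsymptotic hη hτ
  have hKD : ∀ w : ℂ, |w.im| < η → kernelOp η D w =
      kernelOp η (fun s => countingFunction η α L N μ s) w -
        kernelOp η (realAsymptotic η α L μ ι ν) w := fun w hw => kernelOp_sub c1 c2 hw
  have hD : ∀ s ∈ Icc (-(Real.pi / 2)) (Real.pi / 2), ‖D s‖ ≤ stabilityConst η * (C / (L : ℝ) ^ M) := by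
    -- On the real interval `D + K D` is the defect, so stability bounds `D`.
    refine norm_le_of_norm_add_kernelOp_le hη (c1.sub c2) fun s hs => ?_
    have e : D s + kernelOp η D s = sourceDefect η α L μ ι ν s := by
      rw [hKD s (IsAdmissible.abs_ofReal_im_lt hη s), sourceDefect, ← h.realAsymptotic_eq hη hτ hs]
      ring
    have := hb α L N μ ι x ν h s (by
      rw [Complex.ofReal_im, abs_zero]; exact (abs_nonneg _).trans hω)
    rw [← e] at this
    exact this
  -- In the strip the difference is expressed by the defect at `ω` and by the values of `D` on the
  -- real interval alone.
  have e : countingFunction η α L N μ ω - asymptoticCountingFunction η α L μ ι ν ω =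
      sourceDefect η α L μ ι ν ω - kernelOp η D ω := by
    rw [hKD ω hω', h.asymptoticCountingFunction_eq hη hτ hω' hr, sourceDefect]
    ring
  have hK : ‖kernelOp η D ω‖ ≤ κ * (stabilityConst η * (C / (L : ℝ) ^ M)) * Real.pi := by
    have := intervalIntegral.norm_integral_le_of_norm_le_const (a := -(Real.pi / 2))
      (b := Real.pi / 2) (f := fun s : ℝ => kernel η (ω - s) * D s)
      (C := κ * (stabilityConst η * (C / (L : ℝ) ^ M))) fun s hs => by
        rw [uIoc_of_le neg_pi_le_pi] at hs
        rw [norm_mul]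
        refine mul_le_mul (norm_kernel_le η hδ ?_) (hD s (Ioc_subset_Icc_self hs)) (norm_nonneg _) hκ
        have : (ω - s).im = ω.im := by simp
        rw [this, abs_of_pos hη, abs_sub_comm]
        exact le_trans (by linarith) (le_abs_self _)
    rwa [show Real.pi / 2 - -(Real.pi / 2) = Real.pi by ring, abs_of_pos hpi] at this
  rw [e]
  calc _ ≤ C / (L : ℝ) ^ M + κ * (stabilityConst η * (C / (L : ℝ) ^ M)) * Real.pi :=
        (norm_sub_le _ _).trans (add_le_add (hb α L N μ ι x ν h ω hω) hK)
    _ = _ := by ring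

/-! ### Away from the real axis -/

/-- The shift `c = η` is used in the upper, `c = -η` in the lower half plane. -/
def IsShift (η c : ℝ) (v : ℂ) : Prop := (c = η ∧ η / 2 < v.im) ∨ (c = -η ∧ v.im < -(η / 2))

/-- The contribution of a wide root that is not shared by all roots. -/
def wideTerm (η : ℝ) (v z : ℂ) : ℂ :=
  if η < z.im then bareMomentum η (v - z + I * η)
  else if z.im < -η then bareMomentum η (v - z - I * η) else 0

lemma IsShift.lt_abs_im {η c : ℝ} {v : ℂ} (h : IsShift η c v) : η / 2 < |v.im| := by
  rcases h with ⟨-, h⟩ | ⟨-, h⟩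
  · exact h.trans_le (le_abs_self _)
  · exact lt_abs.2 (Or.inr (by linarith))

/-- `s ↦ p₀(v - s)` is holomorphic on the side of the axis away from `v`, and its integral is given
by the residue formulas. A root with `|Im z| < η` yields the pure shift. A wide root yields in
addition a term that does not depend on which half plane `v` lies in, and the same term occurs in
`phase_add_phase`, where it cancels in the final identity. -/
lemma IsShift.integral_bareMomentum_mul_kernel {η c : ℝ} (hη : 0 < η) {v : ℂ} (h : IsShift η c v)
    {z : ℂ} (hz : |z.im| ≠ η) :
    (∫ s in (-(Real.pi / 2))..(Real.pi / 2), bareMomentum η (v - s) * kernel η ((s : ℝ) - z)) =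
      bareMomentum η (v - z + I * c) - wideTerm η v z := by
  rcases h with ⟨rfl, h⟩ | ⟨rfl, h⟩
  · obtain ⟨l, hl⟩ := exists_lowerPeriodic_bareMomentum_sub hη h
    have e1 : v - (z - I * c) = v - z + I * c := by ring
    have e2 : v - (z + I * c) = v - z - I * c := by ring
    rcases lt_or_gt_of_ne hz with hz | hz
    · have hz' := abs_lt.1 hz
      rw [hl.integral_mul_kernel_of_abs_lt hz, wideTerm, if_neg (by linarith), if_neg (by linarith),
        sub_zero, e1]
    · rcases lt_abs.1 hz with hz | hz
      · rw [hl.integral_mul_kernel_of_lt hη hz, wideTerm, if_pos hz, sub_self]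
      · have hz' : z.im < -c := by linarith
        rw [hl.integral_mul_kernel_of_lt_neg hη hz', wideTerm, if_neg (by linarith), if_pos hz',
          e1, e2]
  · obtain ⟨l, hl⟩ := exists_lowerPeriodic_bareMomentum_add hη h
    have e : (∫ s in (-(Real.pi / 2))..(Real.pi / 2),
        bareMomentum η (v - s) * kernel η ((s : ℝ) - z)) =
        ∫ s in (-(Real.pi / 2))..(Real.pi / 2),
          bareMomentum η ((s : ℝ) + v) * kernel η ((s : ℝ) - -z) := by
      rw [← integral_comp_neg_symm]
      refine intervalIntegral.integral_congr fun s _ => ?_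
      rw [← kernel_neg η ((s : ℝ) - -z)]
      congr 2 <;> push_cast <;> ring
    have e1 : -z - I * η + v = v - z + I * (-η : ℝ) := by push_cast; ring
    have e2 : -z + I * η + v = v - z + I * η := by ring
    have e3 : v - z - I * η = v - z + I * (-η : ℝ) := by push_cast; ring
    rw [e]
    rcases lt_or_gt_of_ne hz with hz | hz
    · have hz' := abs_lt.1 hz
      rw [hl.integral_mul_kernel_of_abs_lt (by simpa using hz), wideTerm, if_neg (by linarith),
        if_neg (by linarith), sub_zero, e1]
    · rcases lt_abs.1 hz with hz | hz
      · rw [hl.integral_mul_kernel_of_lt_neg hη (by simpa using hz), wideTerm, if_pos hz, e1, e2]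
      · have hz' : z.im < -η := by linarith
        rw [hl.integral_mul_kernel_of_lt hη (by simpa using hz), wideTerm, if_neg (by linarith),
          if_pos hz', e3, sub_self]

lemma IsShift.integral_bareMomentum_mul_deriv {η c : ℝ} (hη : 0 < η) {v : ℂ}
    (h : IsShift η c v) :
    (∫ s in (-(Real.pi / 2))..(Real.pi / 2), bareMomentum η (v - s) * bareMomentumDeriv η (s : ℝ)) =
      2 * Real.pi * bareMomentum η (v + I * (c / 2 : ℝ)) := by
  rcases h with ⟨rfl, h⟩ | ⟨rfl, h⟩
  · obtain ⟨l, hl⟩ := exists_lowerPeriodic_bareMomentum_sub hη h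
    rw [hl.integral_mul_bareMomentumDeriv hη, sub_neg_eq_add]
  · obtain ⟨l, hl⟩ := exists_lowerPeriodic_bareMomentum_add hη h
    have e : -(I * (η / 2 : ℝ)) + v = v + I * (-η / 2 : ℝ) := by push_cast; ring
    rw [← e, ← hl.integral_mul_bareMomentumDeriv hη, ← integral_comp_neg_symm]
    refine intervalIntegral.integral_congr fun s _ => ?_
    rw [← bareMomentumDeriv_neg]
    congr 2 <;> push_cast <;> ring

lemma IsShift.hasDerivAt_bareMomentum_sub {η c : ℝ} (hη : 0 < η) {v : ℂ} (h : IsShift η c v)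
    (s : ℝ) : HasDerivAt (fun s : ℝ => bareMomentum η (v - s)) (-bareMomentumDeriv η (v - s)) s := by
  have h1 := hasDerivAt_bareMomentum (η := η) (w := v - s) (mem_slit_regularSet_of_im (by
    have : (v - s).im = v.im := by simp
    rw [this, abs_of_pos (half_pos hη)]
    exact h.lt_abs_im.ne'))
  have h2 : HasDerivAt (fun s : ℂ => v - s) (-1) (s : ℂ) := (hasDerivAt_id _).const_sub _
  have h3 := (h1.comp (s : ℂ) h2).comp_ofReal
  rw [mul_neg_one] at h3
  exact h3

lemma IsShift.bareMomentum_periodic {η c : ℝ} (hη : 0 < η) {v : ℂ} (h : IsShift η c v) (s : ℝ) :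
    bareMomentum η (v - ((s + Real.pi : ℝ) : ℂ)) = bareMomentum η (v - s) := by
  rcases h with ⟨rfl, h⟩ | ⟨rfl, h⟩
  · obtain ⟨l, hl⟩ := exists_lowerPeriodic_bareMomentum_sub hη h
    have := hl.per s (by simp)
    rw [Complex.ofReal_add]
    exact this
  · obtain ⟨l, hl⟩ := exists_lowerPeriodic_bareMomentum_add hη h
    have := hl.per (-((s + Real.pi : ℝ) : ℂ)) (by simp)
    rw [show -((s + Real.pi : ℝ) : ℂ) + Real.pi + v = v - s by push_cast; ring,
      show -((s + Real.pi : ℝ) : ℂ) + v = v - ((s + Real.pi : ℝ) : ℂ) by ring] at this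
    exact this.symm

namespace IsAdmissible

variable {η α ϰ τ : ℝ} {L N : ℕ} {μ : Fin N → ℂ} {ι : ℤ} {x : ℝ} {ν : ℕ → ℝ}

/-- Periodicity in `s` allows the window `[-π/2, π/2]`, where each summand of the density is
evaluated by residues. The identity is exact, so no integral equation has to be solved away from the
real axis. -/
lemma integral_bareMomentum_mul_density (h : IsAdmissible η α ϰ τ L N μ ι x ν) (hη : 0 < η)
    (hτ : 0 < τ) {c : ℝ} {v : ℂ} (hv : IsShift η c v) :
    (∫ s in (ν 1)..(ν 1 + Real.pi), bareMomentum η (v - s) * density η L μ s) =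
      bareMomentum η (v + I * (c / 2 : ℝ)) -
        1 / L * ∑ k, (bareMomentum η (v - μ k + I * c) - wideTerm η v (μ k)) := by
  have hpi : (Real.pi : ℂ) ≠ 0 := by exact_mod_cast Real.pi_ne_zero
  have hper : Function.Periodic (fun s : ℝ => bareMomentum η (v - s) * density η L μ s) Real.pi := by
    intro s
    simp only
    rw [hv.bareMomentum_periodic hη, Complex.ofReal_add, density_add_pi]
  rw [hper.intervalIntegral_add_eq (ν 1) (-(Real.pi / 2)),
    show -(Real.pi / 2) + Real.pi = Real.pi / 2 by ring]
  have hP : Continuous fun s : ℝ => bareMomentum η (v - s) :=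
    continuous_iff_continuousAt.2 fun s => (hv.hasDerivAt_bareMomentum_sub hη s).continuousAt
  have hp0 : Continuous fun s : ℝ => bareMomentumDeriv η s := by
    refine continuous_iff_continuousAt.2 fun s => ContinuousAt.comp (f := fun s : ℝ => (s : ℂ))
      ((differentiableOn_bareMomentumDeriv η).differentiableAt
        ((isOpen_regularSet _).mem_nhds (mem_regularSet_of_abs_lt ?_))).continuousAt
      Complex.continuous_ofReal.continuousAt
    simpa using half_pos hη
  have hK : ∀ k, Continuous fun s : ℝ => kernel η (s - μ k) := by
    intro k
    have := continuous_kernel_sub (η := η) (x := μ k)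
      (by rw [abs_of_pos hη]; exact h.abs_im_ne hη hτ k)
    have e : (fun s : ℝ => kernel η (s - μ k)) = fun s : ℝ => kernel η (μ k - s) := by
      funext s
      rw [← kernel_neg, neg_sub]
    rw [e]
    exact this
  have e1 : (∫ s in (-(Real.pi / 2))..(Real.pi / 2), bareMomentum η (v - s) * density η L μ s) =
      ∫ s in (-(Real.pi / 2))..(Real.pi / 2),
        (1 / (2 * Real.pi) * (bareMomentum η (v - s) * bareMomentumDeriv η (s : ℝ)) -
          1 / L * ∑ k, bareMomentum η (v - s) * kernel η ((s : ℝ) - μ k)) := by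
    refine intervalIntegral.integral_congr fun s _ => ?_
    simp only [density]
    rw [← Finset.mul_sum]
    ring
  have c1 : Continuous fun s : ℝ =>
      (1 / (2 * Real.pi) * (bareMomentum η (v - s) * bareMomentumDeriv η (s : ℝ)) : ℂ) :=
    continuous_const.mul (hP.mul hp0)
  have c3 : ∀ k, Continuous fun s : ℝ => bareMomentum η (v - s) * kernel η ((s : ℝ) - μ k) :=
    fun k => hP.mul (hK k)
  have c2 : Continuous fun s : ℝ =>
      (1 / L * ∑ k, bareMomentum η (v - s) * kernel η ((s : ℝ) - μ k) : ℂ) :=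
    continuous_const.mul (continuous_finsetSum _ fun k _ => c3 k)
  rw [e1, intervalIntegral.integral_sub (c1.intervalIntegrable _ _) (c2.intervalIntegrable _ _),
    intervalIntegral.integral_const_mul, intervalIntegral.integral_const_mul,
    intervalIntegral.integral_finsetSum fun k _ => (c3 k).intervalIntegrable _ _,
    hv.integral_bareMomentum_mul_deriv hη,
    Finset.sum_congr rfl fun k _ =>
      hv.integral_bareMomentum_mul_kernel hη (h.abs_im_ne hη hτ k)]
  congr 1
  field_simp

end IsAdmissible

/-! ### Phases at shifted points -/

lemma phase_add_phase {η : ℝ} (hη : 0 < η) {z v : ℂ} (hz : |z.im| ≠ η)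
    (h1 : Disjoint (contour (z.re - Real.pi / 2) (v + I * (η / 2 : ℝ))) (phaseBranchPoints η z))
    (h2 : Disjoint (contour (z.re - Real.pi / 2) (v - I * (η / 2 : ℝ))) (phaseBranchPoints η z)) :
    phase η (v + I * (η / 2 : ℝ)) z + phase η (v - I * (η / 2 : ℝ)) z =
      I * (bareMomentum η (v - z) + wideTerm η v z) := by
  rcases lt_or_gt_of_ne hz with hz | hz
  · have hz' := abs_lt.1 hz
    rw [phase_add_phase_of_abs_lt hη hz h1 h2, wideTerm, if_neg (by linarith),
      if_neg (by linarith), add_zero]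
  · rcases lt_abs.1 hz with hz | hz
    · rw [phase_eq_of_lt hη hz h1, phase_eq_of_lt hη hz h2, wideTerm, if_pos hz,
        show v + I * (η / 2 : ℝ) - z + I * (η / 2 : ℝ) = v - z + I * η by push_cast; ring,
        show v - I * (η / 2 : ℝ) - z + I * (η / 2 : ℝ) = v - z by ring]
      ring
    · have hz' : z.im < -η := by linarith
      rw [phase_eq_of_lt_neg hη hz' h1, phase_eq_of_lt_neg hη hz' h2, wideTerm,
        if_neg (by linarith), if_pos hz',
        show v - I * (η / 2 : ℝ) - z - I * (η / 2 : ℝ) = v - z - I * η by push_cast; ring,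
        show v + I * (η / 2 : ℝ) - z - I * (η / 2 : ℝ) = v - z by ring]
      ring

/-- The point where the branches of the bare functions are compared. -/
structure IsSplitPoint (η c : ℝ) (u : ℂ) : Prop where
  base : u ∈ slit (regularSet (η / 2))
  shift : u + I * c ∈ slit (regularSet (η / 2))
  mid : u + I * (c / 2 : ℝ) ∈ slit (regularSet η)

lemma IsSplitPoint.barePhase_eq {η c : ℝ} {u : ℂ} (hc : c = η ∨ c = -η)
    (h : IsSplitPoint η c u) :
    barePhase η (u + I * (c / 2 : ℝ)) = I * (bareMomentum η (u + I * c) + bareMomentum η u) := by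
  rcases hc with rfl | rfl
  · have e1 : u + I * (c / 2 : ℝ) + I * (c / 2 : ℝ) = u + I * c := by push_cast; ring
    have e2 : u + I * (c / 2 : ℝ) - I * (c / 2 : ℝ) = u := by ring
    have := XXZ.barePhase_eq h.mid (by rw [e1]; exact h.shift) (by rw [e2]; exact h.base)
    rwa [e1, e2] at this
  · have e1 : u + I * (-η / 2 : ℝ) + I * (η / 2 : ℝ) = u := by push_cast; ring
    have e2 : u + I * (-η / 2 : ℝ) - I * (η / 2 : ℝ) = u + I * (-η : ℝ) := by push_cast; ring
    have := XXZ.barePhase_eq h.mid (by rw [e1]; exact h.base) (by rw [e2]; exact h.shift)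
    rwa [e1, e2, add_comm (bareMomentum η u)] at this

lemma isSplitPoint_of_im {η c : ℝ} (hη : 0 < η) {u : ℂ} (h : IsShift η c u) :
    IsSplitPoint η c u := by
  have a2 : |η / 2| = η / 2 := abs_of_pos (half_pos hη)
  rcases h with ⟨rfl, h⟩ | ⟨rfl, h⟩
  · refine ⟨mem_slit_regularSet_of_im ?_, mem_slit_regularSet_of_im ?_,
      mem_slit_regularSet_of_im ?_⟩
    · rw [a2, abs_of_pos (by linarith)]; exact h.ne'
    · have e : (u + I * c).im = u.im + c := by simp
      rw [e, a2, abs_of_pos (by linarith)]; linarith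
    · have e : (u + I * (c / 2 : ℝ)).im = u.im + c / 2 := by simp
      rw [e, abs_of_pos hη, abs_of_pos (by linarith)]; linarith
  · refine ⟨mem_slit_regularSet_of_im ?_, mem_slit_regularSet_of_im ?_,
      mem_slit_regularSet_of_im ?_⟩
    · rw [a2, abs_of_neg (by linarith)]; linarith
    · have e : (u + I * (-η : ℝ)).im = u.im - η := by simp; ring
      rw [e, a2, abs_of_neg (by linarith)]; linarith
    · have e : (u + I * (-η / 2 : ℝ)).im = u.im - η / 2 := by simp; ring
      rw [e, abs_of_pos hη, abs_of_neg (by linarith)]; linarith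

/-- Points of a slit translated along the imaginary direction. -/
lemma add_mem_slit {A B : Set ℂ} {u : ℂ} {h h' : ℝ} (h1 : u + I * h ∈ slit A)
    (h2 : u + I * h' ∈ slit A) {b : ℝ}
    (hAB : ∀ w : ℂ, w + I * h ∈ A → w + I * h' ∈ A → w + I * b ∈ B) : u + I * b ∈ slit B := by
  intro t ht
  have e : ∀ b : ℝ, (t : ℂ) + (u + I * b).im * I = t + u.im * I + I * b := by
    intro b
    simp
    ring
  have hre : ∀ b : ℝ, (u + I * b).re = u.re := by simp
  rw [hre] at ht
  have k1 := h1 t (by rwa [hre])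
  have k2 := h2 t (by rwa [hre])
  rw [e] at k1 k2 ⊢
  exact hAB _ k1 k2

/-- The hypotheses control the horizontal lines through `v ± iη/2`. After the shift by `z`, the
poles of `p₀` at the two heights and of `θ` between them correspond to branch points on these lines.
If `z` is wide and lies in the half plane opposite to `v`, then `v - z` is so far from the axis that
its height alone decides. -/
lemma isSplitPoint_of_disjoint {η c : ℝ} (hη : 0 < η) {z v : ℂ} (hz : |z.im| ≠ η)
    (hv : IsShift η c v)
    (h1 : Disjoint (contour (z.re - Real.pi / 2) (v + I * (η / 2 : ℝ))) (phaseBranchPoints η z))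
    (h2 : Disjoint (contour (z.re - Real.pi / 2) (v - I * (η / 2 : ℝ))) (phaseBranchPoints η z)) :
    IsSplitPoint η c (v - z) := by
  have e0 : v - z = v - z + I * (0 : ℝ) := by simp
  rcases lt_or_gt_of_ne hz with hz | hz
  · have s1 := sub_mem_slit_of_disjoint_phaseBranchPoints hz h1
    have s2 := sub_mem_slit_of_disjoint_phaseBranchPoints hz h2
    rw [show v + I * (η / 2 : ℝ) - z = v - z + I * (η / 2 : ℝ) by ring] at s1
    rw [show v - I * (η / 2 : ℝ) - z = v - z + I * (-(η / 2) : ℝ) by push_cast; ring] at s2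
    have s1 := slit_mono (dressedRegularSet_subset_regularSet η η) s1
    have s2 := slit_mono (dressedRegularSet_subset_regularSet η η) s2
    refine ⟨?_, ?_, ?_⟩
    · rw [e0]
      refine add_mem_slit s1 s2 fun w k1 k2 => ⟨?_, ?_⟩
      · convert k2.1 using 2; push_cast; ring
      · convert k1.2 using 2; push_cast; ring
    · refine add_mem_slit s1 s2 fun w k1 k2 => ?_
      rcases hv with ⟨rfl, -⟩ | ⟨rfl, -⟩
      · refine ⟨?_, ?_⟩
        · convert k1.1 using 2; push_cast; ring
        · convert k2.1 using 2; push_cast; ring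
      · refine ⟨?_, ?_⟩
        · convert k1.2 using 2; push_cast; ring
        · convert k2.2 using 2; push_cast; ring
    · rcases hv with ⟨rfl, -⟩ | ⟨rfl, -⟩
      · exact s1
      · rwa [neg_div]
  rcases lt_abs.1 hz with hz | hz
  · rcases hv with ⟨rfl, hv⟩ | ⟨rfl, hv⟩
    · have s1 := sub_add_mem_slit_of_disjoint_phaseBranchPoints hz h1
      have s2 := sub_add_mem_slit_of_disjoint_phaseBranchPoints hz h2
      rw [show v + I * (c / 2 : ℝ) - (z - I * (c / 2 : ℝ)) = v - z + I * c by
        push_cast; ring] at s1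
      rw [show v - I * (c / 2 : ℝ) - (z - I * (c / 2 : ℝ)) = v - z by ring, e0] at s2
      refine ⟨by rwa [e0], s1, add_mem_slit s1 s2 fun w k1 k2 => ⟨?_, ?_⟩⟩
      · convert k1.1 using 2; push_cast; ring
      · convert k2.2 using 2; push_cast; ring
    · exact isSplitPoint_of_im hη (Or.inr ⟨rfl, by rw [Complex.sub_im]; linarith⟩)
  · rcases hv with ⟨rfl, hv⟩ | ⟨rfl, hv⟩
    · exact isSplitPoint_of_im hη (Or.inl ⟨rfl, by rw [Complex.sub_im]; linarith⟩)
    · have hz : z.im < -η := by linarith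
      have s1 := sub_sub_mem_slit_of_disjoint_phaseBranchPoints hz h1
      have s2 := sub_sub_mem_slit_of_disjoint_phaseBranchPoints hz h2
      rw [show v + I * (η / 2 : ℝ) - (z + I * (η / 2 : ℝ)) = v - z by ring, e0] at s1
      rw [show v - I * (η / 2 : ℝ) - (z + I * (η / 2 : ℝ)) = v - z + I * (-η : ℝ) by
        push_cast; ring] at s2
      refine ⟨by rwa [e0], s2, add_mem_slit s1 s2 fun w k1 k2 => ⟨?_, ?_⟩⟩
      · convert k1.1 using 2; push_cast; ring
      · convert k2.2 using 2; push_cast; ring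

namespace IsAdmissible

variable {η α ϰ τ : ℝ} {L N : ℕ} {μ : Fin N → ℂ} {ι : ℤ} {x : ℝ} {ν : ℕ → ℝ}

lemma wideTerm_of_im_eq_zero {η : ℝ} (hη : 0 < η) (v : ℂ) {z : ℂ} (hz : z.im = 0) :
    wideTerm η v z = 0 := by
  rw [wideTerm, hz, if_neg (by linarith), if_neg (by linarith)]

/-- The counting function against two shifted copies of its asymptotic form. -/
theorem countingFunction_sub_asymptotic (h : IsAdmissible η α ϰ τ L N μ ι x ν) (hη : 0 < η)
    (hτ : 0 < τ) (hϰ : 0 < ϰ) {c : ℝ} {v : ℂ} (hv : IsShift η c v)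
    (h1 : IsRegularPoint η μ ν (v + I * (η / 2 : ℝ)))
    (h2 : IsRegularPoint η μ ν (v - I * (η / 2 : ℝ))) :
    2 * Real.pi * (countingFunction η α L N μ (v + I * (c / 2 : ℝ)) -
      (asymptoticCountingFunction η α L μ ι ν (v + I * (η / 2 : ℝ)) +
        asymptoticCountingFunction η α L μ ι ν (v - I * (η / 2 : ℝ)) - (1 - 2 * ι) / (2 * L))) =
      -(1 / (L : ℂ) * (∑ a ∈ Finset.Icc 1 (N + wideCount η μ), bareMomentum η (v - ν a) +
            (bareMomentum η (v - ((ν 1 + Real.pi : ℝ) : ℂ)) - bareMomentum η (v - ν 1)) / 2) -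
          ∫ s in (ν 1)..(ν 1 + Real.pi), bareMomentum η (v - s) * density η L μ s) := by
  classical
  have hL := h.L_ne_zero
  have hpi : (Real.pi : ℂ) ≠ 0 := by exact_mod_cast Real.pi_ne_zero
  have hc : c = η ∨ c = -η := hv.imp And.left And.left
  have hsplit : ∀ k, IsSplitPoint η c (v - μ k) := by
    intro k
    by_cases hk : (μ k).im = 0
    · refine isSplitPoint_of_im hη ?_
      rwa [IsShift, Complex.sub_im, hk, sub_zero]
    · have hk' : k ∈ complexRoots μ := by simp [complexRoots, hk]
      exact isSplitPoint_of_disjoint hη (h.abs_im_ne hη hτ k) hv (h1.roots k hk') (h2.roots k hk')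
  have eθ : ∑ k, barePhase η (v + I * (c / 2 : ℝ) - μ k) =
      I * (∑ k, bareMomentum η (v - μ k + I * c) + ∑ k, bareMomentum η (v - μ k)) := by
    rw [← Finset.sum_add_distrib, Finset.mul_sum]
    refine Finset.sum_congr rfl fun k _ => ?_
    rw [← (hsplit k).barePhase_eq hc]
    congr 1; ring
  have em := momentum_add_momentum hη h1.momentum h2.momentum
  have eh : ∑ a ∈ holes η μ ν, phase η (v + I * (η / 2 : ℝ)) (ν a) +
      ∑ a ∈ holes η μ ν, phase η (v - I * (η / 2 : ℝ)) (ν a) =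
      I * ∑ a ∈ holes η μ ν, bareMomentum η (v - ν a) := by
    rw [← Finset.sum_add_distrib, Finset.mul_sum]
    refine Finset.sum_congr rfl fun a ha => ?_
    exact phase_add_phase_of_abs_lt hη (abs_ofReal_im_lt hη _)
      (by rw [Complex.ofReal_re]; exact h1.holes a ha)
      (by rw [Complex.ofReal_re]; exact h2.holes a ha)
  have er : ∑ k ∈ complexRoots μ, phase η (v + I * (η / 2 : ℝ)) (μ k) +
      ∑ k ∈ complexRoots μ, phase η (v - I * (η / 2 : ℝ)) (μ k) =
      I * (∑ k ∈ complexRoots μ, bareMomentum η (v - μ k) + ∑ k, wideTerm η v (μ k)) := by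
    have e0 := sum_roots μ fun z => wideTerm η v z
    rw [Finset.sum_eq_zero fun k hk => wideTerm_of_im_eq_zero hη v (Finset.mem_filter.1 hk).2,
      zero_add] at e0
    rw [e0, ← Finset.sum_add_distrib, ← Finset.sum_add_distrib, Finset.mul_sum]
    exact Finset.sum_congr rfl fun k hk =>
      phase_add_phase hη (h.abs_im_ne hη hτ k) (h1.roots k hk) (h2.roots k hk)
  have e1 := sum_roots μ fun z => bareMomentum η (v - z)
  have e2 := h.sum_node hη hτ hϰ fun z => bareMomentum η (v - z)
  -- The test function is periodic, so the end correction of the trapezoidal rule vanishes; the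
  -- integral is replaced by its exact value and the grid sum by holes and real roots.
  rw [h.integral_bareMomentum_mul_density hη hτ hv, hv.bareMomentum_periodic hη, sub_self, e2,
    countingFunction, eθ, e1, Finset.sum_sub_distrib]
  have ea : asymptoticCountingFunction η α L μ ι ν (v + I * (η / 2 : ℝ)) +
        asymptoticCountingFunction η α L μ ι ν (v - I * (η / 2 : ℝ)) =
      1 / (2 * I * Real.pi * L) * (I * ∑ a ∈ holes η μ ν, bareMomentum η (v - ν a) -
        I * (∑ k ∈ complexRoots μ, bareMomentum η (v - μ k) + ∑ k, wideTerm η v (μ k))) +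
        (1 - α - ι) / L := by
    rw [← eh, ← er, asymptoticCountingFunction, asymptoticCountingFunction]
    -- The two momenta cancel, leaving only the phases and the constants.
    linear_combination em
  rw [ea]
  have hI : I ≠ 0 := Complex.I_ne_zero
  field_simp
  ring

end IsAdmissible

/-- The asymptotic formulas away from the real axis. -/
theorem exists_bound_of_isShift {η ϰ τ δ : ℝ} (hη : 0 < η) (hϰ : 0 < ϰ) (hτ : 0 < τ)
    (hδ : 0 < δ) (M : ℕ) : ∃ C, 0 ≤ C ∧ ∀ (α : ℝ) (L N : ℕ) (μ : Fin N → ℂ) (ι : ℤ) (x : ℝ)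
      (ν : ℕ → ℝ), IsAdmissible η α ϰ τ L N μ ι x ν → ∀ (c : ℝ) (v : ℂ), IsShift η c v →
        η / 2 + δ ≤ |v.im| → IsRegularPoint η μ ν (v + I * (η / 2 : ℝ)) →
        IsRegularPoint η μ ν (v - I * (η / 2 : ℝ)) →
        ‖countingFunction η α L N μ (v + I * (c / 2 : ℝ)) -
          (asymptoticCountingFunction η α L μ ι ν (v + I * (η / 2 : ℝ)) +
            asymptoticCountingFunction η α L μ ι ν (v - I * (η / 2 : ℝ)) -
            (1 - 2 * ι) / (2 * L))‖ ≤ C / (L : ℝ) ^ M := by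
  obtain ⟨C, hC, hb⟩ := exists_sum_sub_integral_bound hη hϰ hτ (half_pos hδ) M
  set B : ℝ := |Real.sinh η| / (δ / 2 * (δ / 2))
  have hpi := Real.pi_pos
  have hn : ‖(2 * Real.pi : ℂ)‖ = 2 * Real.pi := by
    rw [norm_mul, Complex.norm_real, Real.norm_of_nonneg hpi.le]; simp
  refine ⟨C * B / (2 * Real.pi), by positivity, fun α L N μ ι x ν h c v hv hδv h1 h2 => ?_⟩
  have him : ∀ w : ℂ, |w.im| < δ / 2 → η / 2 + δ / 2 < |(v - w).im| := by
    intro w hw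
    have := abs_sub_abs_le_abs_sub v.im w.im
    rw [Complex.sub_im]
    linarith
  have key := hb α L N μ ι x ν h (fun s => bareMomentum η (v - s))
    (fun w => -bareMomentumDeriv η (v - w)) B (hv.hasDerivAt_bareMomentum_sub hη)
    (fun w hw => by
      have hw' := him w hw
      have : DifferentiableAt ℂ (fun w => bareMomentumDeriv η (v - w)) w :=
        DifferentiableAt.comp (f := fun w : ℂ => v - w) w
          ((differentiableOn_bareMomentumDeriv η).differentiableAt ((isOpen_regularSet _).mem_nhds
            (mem_regularSet_of_im (by rw [abs_of_pos (half_pos hη)]; linarith)))) (by fun_prop)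
      exact this.neg.differentiableWithinAt)
    (fun w => by
      rw [← bareMomentumDeriv_add_pi η (v - (w + Real.pi))]
      congr 2; ring)
    (fun w hw => by
      rw [norm_neg]
      refine norm_bareMomentumDeriv_le η (half_pos hδ) ?_
      rw [abs_of_pos (half_pos hη)]
      exact le_trans (by linarith [him w hw]) (le_abs_self _))
  rw [← norm_neg, ← h.countingFunction_sub_asymptotic hη hτ hϰ hv h1 h2, norm_mul, hn] at key
  rw [div_right_comm, le_div_iff₀ (by positivity), mul_comm]
  exact key

end XXZ

end

theorem mainTheorem2 (η : ℝ) (hη : 0 < η) (α : ℝ) (n : ℕ) (ϰ : ℝ) (hϰ : 0 < ϰ)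
    (τ : ℝ) (hτ : 0 < τ) (δ : ℝ) (hδ : 0 < δ) (M : ℕ) :
    ∃ C : ℝ, ∀ (L N : ℕ) (μ : Fin N → ℂ) (ι : ℤ) (x : ℝ) (ν : ℕ → ℝ),
      XXZ.IsBetheSolution η α L N μ →
      (XXZ.complexRoots μ).card = n →
      (∀ a ∈ XXZ.complexRoots μ, τ ≤ |(|(μ a).im| - η)|) →
      XXZ.IsUniformlyIncreasing ϰ η α L N μ →
      XXZ.IsRealParametrisation η α L N μ ι x ν →
      (∀ ω : ℂ, |ω.im| ≤ η - δ → XXZ.IsRegularPoint η μ ν ω →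
        ‖XXZ.countingFunction η α L N μ ω -
          XXZ.asymptoticCountingFunction η α L μ ι ν ω‖ ≤ C / (L : ℝ) ^ M) ∧
      (∀ ω : ℂ, η + δ ≤ ω.im → XXZ.IsRegularPoint η μ ν ω →
        XXZ.IsRegularPoint η μ ν (ω - Complex.I * η) →
        ‖XXZ.countingFunction η α L N μ ω -
          (XXZ.asymptoticCountingFunction η α L μ ι ν ω +
            XXZ.asymptoticCountingFunction η α L μ ι ν (ω - Complex.I * η) -
            (1 - 2 * ι) / (2 * L))‖ ≤ C / (L : ℝ) ^ M) ∧
      (∀ ω : ℂ, ω.im ≤ -η - δ → XXZ.IsRegularPoint η μ ν ω →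
        XXZ.IsRegularPoint η μ ν (ω + Complex.I * η) →
        ‖XXZ.countingFunction η α L N μ ω -
          (XXZ.asymptoticCountingFunction η α L μ ι ν ω +
            XXZ.asymptoticCountingFunction η α L μ ι ν (ω + Complex.I * η) -
            (1 - 2 * ι) / (2 * L))‖ ≤ C / (L : ℝ) ^ M) := by
  obtain ⟨C₁, hC₁, hb₁⟩ := XXZ.exists_bound_of_abs_le hη hϰ hτ hδ M
  obtain ⟨C₂, hC₂, hb₂⟩ := XXZ.exists_bound_of_isShift hη hϰ hτ hδ M
  refine ⟨C₁ + C₂, fun L N μ ι x ν hB _ hgap hinc hpar => ?_⟩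
  have h : XXZ.IsAdmissible η α ϰ τ L N μ ι x ν := ⟨hB, hgap, hinc, hpar⟩
  have hL := h.L_pos
  have le₁ : C₁ / (L : ℝ) ^ M ≤ (C₁ + C₂) / (L : ℝ) ^ M := by gcongr; linarith
  have le₂ : C₂ / (L : ℝ) ^ M ≤ (C₁ + C₂) / (L : ℝ) ^ M := by gcongr; linarith
  refine ⟨fun ω hω hr => (hb₁ α L N μ ι x ν h ω hω hr).trans le₁, fun ω hω hr hr' => ?_,
    fun ω hω hr hr' => ?_⟩
  · have him : (ω - Complex.I * (η / 2 : ℝ)).im = ω.im - η / 2 := by simp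
    have e1 : ω - Complex.I * (η / 2 : ℝ) + Complex.I * (η / 2 : ℝ) = ω := by ring
    have e2 : ω - Complex.I * (η / 2 : ℝ) - Complex.I * (η / 2 : ℝ) = ω - Complex.I * η := by
      push_cast; ring
    -- The midpoint of `ω` and `ω - iη` plays the role of `v`; its height is at least `η/2 + δ`. In
    -- the lower half plane the midpoint of `ω` and `ω + iη` is used, with `c = -η`.
    have key := hb₂ α L N μ ι x ν h η (ω - Complex.I * (η / 2 : ℝ))
      (Or.inl ⟨rfl, by rw [him]; linarith⟩)
      (by rw [him]; exact le_trans (by linarith) (le_abs_self _))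
      (by rwa [e1]) (by rwa [e2])
    rw [e1, e2] at key
    exact key.trans le₂
  · have him : (ω + Complex.I * (η / 2 : ℝ)).im = ω.im + η / 2 := by simp
    have e1 : ω + Complex.I * (η / 2 : ℝ) + Complex.I * (η / 2 : ℝ) = ω + Complex.I * η := by
      push_cast; ring
    have e2 : ω + Complex.I * (η / 2 : ℝ) - Complex.I * (η / 2 : ℝ) = ω := by ring
    have e3 : ω + Complex.I * (η / 2 : ℝ) + Complex.I * (-η / 2 : ℝ) = ω := by push_cast; ring
    have key := hb₂ α L N μ ι x ν h (-η) (ω + Complex.I * (η / 2 : ℝ))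
      (Or.inr ⟨rfl, by rw [him]; linarith⟩)
      (by rw [him]; exact le_trans (by linarith) (neg_le_abs _))
      (by rwa [e1]) (by rwa [e2])
    rw [e1, e2, e3, add_comm (XXZ.asymptoticCountingFunction η α L μ ι ν (ω + Complex.I * η))] at key
    exact key.trans le₂
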